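/- Let $n\ge 4$ and $l\ge 1$. Write $[01]$ and $[(n{-}1)\,n]$ for the whole blocks obtained by gluing two blocks of half-unit depth of colours $0,1$, resp. $n-1,n$; a block of colour $i$, $2\le i\le n-2$, has unit depth and is a whole block by itself. All blocks have unit height and unit width. \emph{Pattern.} Columns of unit depth are divided into rows of unit height, filled by whole blocks which from bottom to top repeat the cycle $[01],2,3,\dots,n-2,[(n{-}1)n],n-2,\dots,3,2$. A $\delta$ is one cycle. A row strictly between $[01]$ and the $[(n{-}1)n]$ above it is supporting, a row strictly between $[(n{-}1)n]$ and the next $[01]$ above it is covering, the rows $[01]$ and $[(n{-}1)n]$ are both. Columns are numbered $0,1,2,\dots$ from right to left; in even columns the blocks $0,n-1$ are in the back and $1,n$ in front, in odd columns $0\leftrightarrow1$ and $n-1\leftrightarrow n$ are exchanged. A position ($i$-slot) or $i$-block has the role (supporting/covering) of its row. \emph{Slices.} A level-$1$ slice is a stack following the pattern, standing on the ground (a horizontal line which may be chosen arbitrarily low), in which nothing lies above an incomplete row; only the row on its top may be incomplete, consisting then of one block of half-unit depth. A level-$l$ pre-slice is a tuple $C=(c_1,\dots,c_l)$ of level-$1$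 slices (its layers; $c_1$ is the fore-most, $c_l$ the rear-most) with $c_1\subset c_2\subset\dots\subset c_l\subset c_1+\delta$. To split a whole $j$-block ($j\in\{[01],2,\dots,n-2,[(n{-}1)n]\}$) is to take, among the layers whose top is a covering (resp. supporting) unbroken $j$-block, the fore-most one of those in the higher height, to break off the upper half of this block, and to place it in the supporting (resp. covering) full $j$-slot which is the rear-most of those in the lower height among the layers with such a slot on top; this requires that such a block and such a slot exist, and it may be repeated on the results. A level-$l$ slice is a result of repeatedly splitting (possibly never) a level-$l$ pre-slice which admits no further splitting. For $j=[01]$ and $j=[(n{-}1)n]$ the splittings of $j$-blocks contained in a slice can be reversed in a unique way (un-splitting); the halves which are moved back by this are called upper halves, the halves which become whole blocks lower halves. \emph{Operators on slices.} Let $2\le i\le n-2$. The top of a layer is a full $i$-slot if a whole $i$-block fits on it, a half-slot if it is a broken half of an $i$-block. $\tilde f_iC$ is obtained by putting two halves of an $i$-block on $C$: (1) if there are both covering and supporting full slots, one half in the rear-most covering full slot of lower height and one in the rear-most supporting full slot of lower height; (2) if there are full slots of one role only, one half in the rear-most one of lower height, and then the other half in the rear-most half-slot of lower height of the same role; (3)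 if there are only half-slots, one half in the rear-most covering and one in the rear-most supporting half-slot of lower height; (4) otherwise $\tilde f_iC=0$. $\tilde e_iC$ is obtained by removing two halves of $i$-blocks (from an unbroken block its upper half) by the same rules with slots replaced by blocks on the top of layers, rear-most by fore-most and lower by higher. For $i\in\{0,1\}$ (resp. $\{n-1,n\}$) un-split all $[01]$-blocks (resp. $[(n{-}1)n]$-blocks), put an $i$-block in the rear-most $i$-slot of lower height (for $\tilde e_i$: remove the fore-most $i$-block of higher height from the top of the layers), and then split all these whole blocks possible; if there is no $i$-slot (no such $i$-block), the result is $0$. Let $\varphi_i(C)=\max\{m:\tilde f_i^mC\ne0\}$ and $\varepsilon_i(C)=\max\{m:\tilde e_i^mC\ne0\}$. \emph{Young walls.} A level-$l$ Young wall $\mathbf Y$ of type $D_n^{(1)}$ is a finite or infinite (to the left) sequence of level-$l$ slices, following the pattern and standing on a common ground, such that for any two consecutive columns and every layer there is no free space to the right of a block of the left column. Here, in addition to the obvious cases, there is free space if, in the same row, the left is a whole block and the right is a broken half; or the left is a single half-unit depth block and the right is an upper broken half; or the left is a lower broken half and the right is a single half-unit depth block. There is none if the left is a single half-unit depth block and the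 right a lower half, or the left is an upper half and the right a single half-unit depth block, or if both are broken halves. $\mathbf Y$ is proper if, in each layer, no two columns whose tops are of unit depth and of integer height have the same height. Let $\mathcal{PW}$ be the set of level-$l$ proper Young walls. \emph{Operators on walls.} Under each column $C$ of $\mathbf Y\in\mathcal{PW}$ write $\varepsilon_i(C)$ many $1$'s followed by $\varphi_i(C)$ many $0$'s. Cancelling successively every pair $(0,1)$ leaves the $i$-signature of $\mathbf Y$, consisting of $1$'s followed by $0$'s. $\tilde f_i\mathbf Y$ (resp. $\tilde e_i\mathbf Y$) is obtained by replacing the column $C$ of the leftmost $0$ (resp. rightmost $1$) of the $i$-signature by $\tilde f_iC$ (resp. $\tilde e_iC$), and is $0$ if there is no such letter. $\varphi_i(\mathbf Y)$ and $\varepsilon_i(\mathbf Y)$ are the numbers of $0$'s and $1$'s in the $i$-signature, and $\overline{\mathrm{wt}}(\mathbf Y)=\sum_{i=0}^n(\varphi_i(\mathbf Y)-\varepsilon_i(\mathbf Y))\Lambda_i$. \textbf{Theorem.} These notions are well defined: the maxima $\varphi_i(C),\varepsilon_i(C)$ exist for every level-$l$ slice $C$, the $i$-signature of every $\mathbf Y\in\mathcal{PW}$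 is finite for all $i\in I=\{0,\dots,n\}$, and $\tilde f_i\mathbf Y,\tilde e_i\mathbf Y\in\mathcal{PW}\cup\{0\}$, where $\tilde f_i\mathbf Y=0$ (resp. $\tilde e_i\mathbf Y=0$) if and only if $\varphi_i(\mathbf Y)=0$ (resp. $\varepsilon_i(\mathbf Y)=0$); if $\mathbf Y$ is infinite and stands on a given ground, so do $\tilde f_i\mathbf Y$ and $\tilde e_i\mathbf Y$, if nonzero. The set $\mathcal{PW}$, together with the maps $\overline{\mathrm{wt}},\tilde e_i,\tilde f_i,\varepsilon_i,\varphi_i$ $(i\in I)$, is a $U_q'(\mathfrak g)$-crystal for the affine Kac–Moody algebra $\mathfrak g$ of type $D_n^{(1)}$ with Cartan matrix $(a_{ij})$. That is, for all $i\in I$ and $b,b'\in\mathcal{PW}$: $\varphi_i(b)=\varepsilon_i(b)+\langle h_i,\overline{\mathrm{wt}}(b)\rangle$; if $\tilde e_ib\neq0$, then $\overline{\mathrm{wt}}(\tilde e_ib)=\overline{\mathrm{wt}}(b)+\alpha_i$, $\varepsilon_i(\tilde e_ib)=\varepsilon_i(b)-1$, $\varphi_i(\tilde e_ib)=\varphi_i(b)+1$;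 if $\tilde f_ib\ne0$, then $\overline{\mathrm{wt}}(\tilde f_ib)=\overline{\mathrm{wt}}(b)-\alpha_i$, $\varepsilon_i(\tilde f_ib)=\varepsilon_i(b)+1$, $\varphi_i(\tilde f_ib)=\varphi_i(b)-1$; $\tilde f_ib=b'$ if and only if $\tilde e_ib'=b$; and $\tilde e_ib=\tilde f_ib=0$ whenever $\varphi_i(b)=-\infty$ (which does not occur). Here $\alpha_i=\sum_ja_{ji}\Lambda_j$ in the classical weight lattice $\bigoplus_j\mathbb Z\Lambda_j$ and $\langle h_i,\Lambda_j\rangle=\delta_{ij}$. -/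

import Mathlib

namespace YoungWall

/-! ### The stacking pattern

A column of unit width and unit depth is divided into unit cubes, the rows, numbered by `ℤ` from
bottom to top.  The pattern is periodic with period `2 * n - 4`; one period (a cycle) consists of
the rows `01, 2, …, n-2, (n-1)n, n-2, …, 2`.  A block of colour `0, 1, n-1, n` has half-unit depth,
so that a row of type `01` or `(n-1)n` holds two of them, one in front and one in the back. -/

/-- The whole blocks: the gluing `01`, the unit depth blocks of colour `i`, the gluing `(n-1)n`. -/
inductive Whole
  | zo
  | mid (i : ℕ)
  | nn
  deriving DecidableEq

/-- Position of a row in its cycle, a number from `0` to `2 * n - 5`. -/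
def phase (n : ℕ) (r : ℤ) : ℕ := (r % (2 * (n : ℤ) - 4)).toNat

/-- The whole block which fills the row `r`. -/
def rowBlock (n : ℕ) (r : ℤ) : Whole :=
  if phase n r = 0 then .zo
  else if phase n r + 2 < n then .mid (phase n r + 1)
  else if phase n r + 2 = n then .nn
  else .mid (2 * n - 3 - phase n r)

/-- The two roles of a position. -/
inductive Role
  | supporting
  | covering
  deriving DecidableEq

def Role.swap : Role → Role
  | .supporting => .covering
  | .covering => .supporting

/-- Rows below the next `(n-1)n`-row of the cycle are supporting, those above it are covering;
the rows `01` and `(n-1)n` are both. -/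
def HasRole (n : ℕ) (r : ℤ) : Role → Prop
  | .supporting => phase n r + 2 ≤ n
  | .covering => phase n r = 0 ∨ n ≤ phase n r + 2

instance (n : ℕ) (r : ℤ) (ρ : Role) : Decidable (HasRole n r ρ) := by
  cases ρ <;> unfold HasRole <;> infer_instance

/-- The two half-unit depth places of a row. -/
inductive Side
  | front
  | back
  deriving DecidableEq

def Side.swap : Side → Side
  | .front => .back
  | .back => .front

/-- Colour of the block at the place `s` of the row `r` in the `k`-th column of the pattern,
columns being counted from the right, starting with `0`.  In even columns `0` and `n-1` are in the
back and `1` and `n` in front; in odd columns they are exchanged. -/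
def color (n k : ℕ) (r : ℤ) (s : Side) : ℕ :=
  match rowBlock n r with
  | .zo => if s = .back ↔ Even k then 0 else 1
  | .mid i => i
  | .nn => if s = .back ↔ Even k then n - 1 else n

/-! ### Layers, pre-slices, splitting, slices -/

/-- What stands in the row on top of the last complete row of a layer: nothing, one block of
half-unit depth, or a broken half (of half-unit height) of a whole block. -/
inductive Top
  | flat
  | single (s : Side)
  | half
  deriving DecidableEq

/-- A layer: all rows below the row `row` are filled, and `top` describes the row `row`.
The ground on which the layer stands is not part of the data. -/
@[ext]
structure Layer where
  row : ℤ
  top : Top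
  deriving DecidableEq

/-- A level-1 slice: no broken halves, and a single half-unit depth block only where the pattern has
blocks of half-unit depth. -/
def IsLevelOne (n : ℕ) (c : Layer) : Prop :=
  c.top = .flat ∨
    ∃ s, c.top = .single s ∧ (rowBlock n c.row = .zo ∨ rowBlock n c.row = .nn)

/-- The places filled by (the blocks of) a level-1 slice. -/
def Layer.blocks (c : Layer) : Set (ℤ × Side) :=
  {x | x.1 < c.row ∨ (x.1 = c.row ∧ c.top = .single x.2)}

/-- Adding one `δ`-column, that is, one full cycle. -/
def Layer.addDelta (n : ℕ) (c : Layer) : Layer := ⟨c.row + (2 * (n : ℤ) - 4), c.top⟩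

/-- `l` layers, listed from the fore-most (`0`) to the rear-most. -/
abbrev Layers (l : ℕ) := Fin l → Layer

/-- Level-`l` pre-slices: `c₁ ⊆ c₂ ⊆ ⋯ ⊆ c_l ⊆ c₁ + δ`. -/
def IsPreSlice (n : ℕ) {l : ℕ} (C : Layers l) : Prop :=
  (∀ p, IsLevelOne n (C p)) ∧
  (∀ p q, p ≤ q → (C p).blocks ⊆ (C q).blocks) ∧
  (∀ p q, (C q).blocks ⊆ ((C p).addDelta n).blocks)

/-- Among the indices in `S`: of those with the highest `h`, the fore-most one. -/
def foremostHighest {l : ℕ} (h : Fin l → ℤ) (S : Fin l → Bool) : Option (Fin l) :=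
  (List.finRange l).find? fun p =>
    S p && decide (∀ q, S q = true → h q < h p ∨ (h q = h p ∧ p ≤ q))

/-- Among the indices in `S`: of those with the lowest `h`, the rear-most one. -/
def rearmostLowest {l : ℕ} (h : Fin l → ℤ) (S : Fin l → Bool) : Option (Fin l) :=
  (List.finRange l).find? fun p =>
    S p && decide (∀ q, S q = true → h p < h q ∨ (h q = h p ∧ q ≤ p))

/-- The top of the layer is occupied by an (unbroken) whole `j`-block of role `ρ`. -/
def topBlock (n : ℕ) (j : Whole) (ρ : Role) (c : Layer) : Bool :=
  decide (c.top = .flat ∧ rowBlock n (c.row - 1) = j ∧ HasRole n (c.row - 1) ρ)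

/-- The top of the layer is a (full) whole `j`-slot of role `ρ`. -/
def topSlot (n : ℕ) (j : Whole) (ρ : Role) (c : Layer) : Bool :=
  decide (c.top = .flat ∧ rowBlock n c.row = j ∧ HasRole n c.row ρ)

/-- The top of the layer is a broken half of a whole `j`-block in a position of role `ρ`; this is at
the same time a half-block and a half-slot. -/
def topHalf (n : ℕ) (j : Whole) (ρ : Role) (c : Layer) : Bool :=
  decide (c.top = .half ∧ rowBlock n c.row = j ∧ HasRole n c.row ρ)

/-- Put one half of a whole block on top of a layer. -/
def Layer.putHalf (c : Layer) : Layer :=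
  match c.top with
  | .flat => ⟨c.row, .half⟩
  | .half => ⟨c.row + 1, .flat⟩
  | .single s => ⟨c.row, .single s⟩

/-- Take one half of a whole block away from the top of a layer. -/
def Layer.takeHalf (c : Layer) : Layer :=
  match c.top with
  | .flat => ⟨c.row - 1, .half⟩
  | .half => ⟨c.row, .flat⟩
  | .single s => ⟨c.row, .single s⟩

def putHalfAt {l : ℕ} (C : Layers l) (p : Fin l) : Layers l :=
  Function.update C p (C p).putHalf

def takeHalfAt {l : ℕ} (C : Layers l) (p : Fin l) : Layers l :=
  Function.update C p (C p).takeHalf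

def rows {l : ℕ} (C : Layers l) (p : Fin l) : ℤ := (C p).row

/-- Splitting a `j`-block: the top half of the fore-most `j`-block of role `ρ` among those in the
higher height is broken off and placed in the rear-most `j`-slot of the other role among those in
the lower height; `none` if there is no such block or no such slot. -/
def split (n : ℕ) {l : ℕ} (j : Whole) (ρ : Role) (C : Layers l) : Option (Layers l) :=
  match foremostHighest (rows C) (fun p => topBlock n j ρ (C p)),
      rearmostLowest (rows C) (fun p => topSlot n j ρ.swap (C p)) with
  | some b, some a => some (putHalfAt (takeHalfAt C b) a)
  | _, _ => none

/-- Level-`l` slices: the results of repeatedly splitting a pre-slice which admit no further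
splitting. -/
def IsSlice (n : ℕ) {l : ℕ} (C : Layers l) : Prop :=
  (∃ D : Layers l, IsPreSlice n D ∧
    Relation.ReflTransGen (fun X Y => ∃ j ρ, split n j ρ X = some Y) D C) ∧
  ∀ j ρ, split n j ρ C = none

/-! ### Kashiwara operators on slices -/

/-- Apply `g` as long as possible, but at most `m` times. -/
def repeatStep {α : Type*} (g : α → Option α) : ℕ → α → α
  | 0, x => x
  | m + 1, x =>
    match g x with
    | none => x
    | some y => repeatStep g m y

/-- Split every possible `j`-block (`j = 01` or `j = (n-1)n`, where the two roles coincide).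
Every splitting uses up a layer with a `j`-block on its top, so `l` steps suffice. -/
def splitAll (n : ℕ) {l : ℕ} (j : Whole) (C : Layers l) : Layers l :=
  repeatStep (split n j .supporting) l C

/-- The inverse of splitting a `j`-block (`j = 01` or `j = (n-1)n`): the half placed last, which is
the fore-most half among those in the higher height, is returned to the block it was broken off
from, whose other half is the rear-most half among those in the lower height. -/
def unsplit (n : ℕ) {l : ℕ} (j : Whole) (C : Layers l) : Option (Layers l) :=
  match foremostHighest (rows C) (fun p => topHalf n j .supporting (C p)),
      rearmostLowest (rows C) (fun p => topHalf n j .supporting (C p)) with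
  | some a, some b => if a = b then none else some (putHalfAt (takeHalfAt C a) b)
  | _, _ => none

/-- Un-split every possible `j`-block. -/
def unsplitAll (n : ℕ) {l : ℕ} (j : Whole) (C : Layers l) : Layers l :=
  repeatStep (unsplit n j) l C

/-- Place a half-unit depth `i`-block on a layer in the `k`-th column of the pattern; `none` if the
top of the layer is not an `i`-slot. -/
def Layer.putBlock (n k i : ℕ) (c : Layer) : Option Layer :=
  if rowBlock n c.row = .zo ∨ rowBlock n c.row = .nn then
    match c.top with
    | .flat =>
      if color n k c.row .front = i then some ⟨c.row, .single .front⟩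
      else if color n k c.row .back = i then some ⟨c.row, .single .back⟩
      else none
    | .single s => if color n k c.row s.swap = i then some ⟨c.row + 1, .flat⟩ else none
    | .half => none
  else none

/-- Remove a half-unit depth `i`-block from the top of a layer in the `k`-th column of the pattern;
`none` if there is no `i`-block on the top. -/
def Layer.takeBlock (n k i : ℕ) (c : Layer) : Option Layer :=
  match c.top with
  | .flat =>
    if rowBlock n (c.row - 1) = .zo ∨ rowBlock n (c.row - 1) = .nn then
      if color n k (c.row - 1) .front = i then some ⟨c.row - 1, .single .back⟩
      else if color n k (c.row - 1) .back = i then some ⟨c.row - 1, .single .front⟩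
      else none
    else none
  | .single s => if color n k c.row s = i then some ⟨c.row, .flat⟩ else none
  | .half => none

/-- The row of the top block of a layer without broken half on top. -/
def Layer.topRow (c : Layer) : ℤ :=
  match c.top with
  | .flat => c.row - 1
  | _ => c.row

/-- `f̃ᵢ` on slices for `2 ≤ i ≤ n - 2`. -/
def fMid (n : ℕ) {l : ℕ} (i : ℕ) (C : Layers l) : Option (Layers l) :=
  let slot (ρ : Role) := rearmostLowest (rows C) fun p => topSlot n (.mid i) ρ (C p)
  let halfSlot (ρ : Role) (D : Layers l) :=
    rearmostLowest (rows D) fun p => topHalf n (.mid i) ρ (D p)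
  match slot .supporting, slot .covering with
  | some a, some b => some (putHalfAt (putHalfAt C a) b)
  | some a, none => (halfSlot .supporting (putHalfAt C a)).map (putHalfAt (putHalfAt C a))
  | none, some b => (halfSlot .covering (putHalfAt C b)).map (putHalfAt (putHalfAt C b))
  | none, none =>
    match halfSlot .supporting C, halfSlot .covering C with
    | some a, some b => some (putHalfAt (putHalfAt C a) b)
    | _, _ => none

/-- `ẽᵢ` on slices for `2 ≤ i ≤ n - 2`. -/
def eMid (n : ℕ) {l : ℕ} (i : ℕ) (C : Layers l) : Option (Layers l) :=
  let block (ρ : Role) := foremostHighest (rows C) fun p => topBlock n (.mid i) ρ (C p)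
  let halfBlock (ρ : Role) (D : Layers l) :=
    foremostHighest (rows D) fun p => topHalf n (.mid i) ρ (D p)
  match block .supporting, block .covering with
  | some a, some b => some (takeHalfAt (takeHalfAt C a) b)
  | some a, none => (halfBlock .supporting (takeHalfAt C a)).map (takeHalfAt (takeHalfAt C a))
  | none, some b => (halfBlock .covering (takeHalfAt C b)).map (takeHalfAt (takeHalfAt C b))
  | none, none =>
    match halfBlock .supporting C, halfBlock .covering C with
    | some a, some b => some (takeHalfAt (takeHalfAt C a) b)
    | _, _ => none

/-- The whole block containing the half-unit depth `i`-block, for `i = 0, 1, n - 1, n`. -/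
def wholeOf (i : ℕ) : Whole := if i ≤ 1 then .zo else .nn

/-- `f̃ᵢ` on slices standing in the `k`-th column of the pattern, for `i = 0, 1, n - 1, n`. -/
def fEnd (n k : ℕ) {l : ℕ} (i : ℕ) (C : Layers l) : Option (Layers l) :=
  let D := unsplitAll n (wholeOf i) C
  (rearmostLowest (rows D) fun p => ((D p).putBlock n k i).isSome).bind fun p =>
    ((D p).putBlock n k i).map fun c => splitAll n (wholeOf i) (Function.update D p c)

/-- `ẽᵢ` on slices standing in the `k`-th column of the pattern, for `i = 0, 1, n - 1, n`. -/
def eEnd (n k : ℕ) {l : ℕ} (i : ℕ) (C : Layers l) : Option (Layers l) :=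
  let D := unsplitAll n (wholeOf i) C
  (foremostHighest (fun p => (D p).topRow) fun p => ((D p).takeBlock n k i).isSome).bind fun p =>
    ((D p).takeBlock n k i).map fun c => splitAll n (wholeOf i) (Function.update D p c)

/-- `f̃ᵢ` on slices standing in the `k`-th column; `none` is the value `0`. -/
def fSlice (n k i : ℕ) {l : ℕ} (C : Layers l) : Option (Layers l) :=
  if 2 ≤ i ∧ i + 2 ≤ n then fMid n i C else fEnd n k i C

/-- `ẽᵢ` on slices standing in the `k`-th column; `none` is the value `0`. -/
def eSlice (n k i : ℕ) {l : ℕ} (C : Layers l) : Option (Layers l) :=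
  if 2 ≤ i ∧ i + 2 ≤ n then eMid n i C else eEnd n k i C

/-- The numbers `m` such that the partial map `g` can be applied `m` times to `x`. -/
def powersDefined {α : Type*} (g : α → Option α) (x : α) : Set ℕ :=
  {m | (fun y : Option α => y.bind g)^[m] (some x) ≠ none}

/-- `φᵢ` of a slice in the `k`-th column. -/
noncomputable def phiSlice (n k i : ℕ) {l : ℕ} (C : Layers l) : ℕ :=
  sSup (powersDefined (fSlice n k i) C)

/-- `εᵢ` of a slice in the `k`-th column. -/
noncomputable def epsSlice (n k i : ℕ) {l : ℕ} (C : Layers l) : ℕ :=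
  sSup (powersDefined (eSlice n k i) C)

/-! ### Young walls -/

/-- A sequence of columns, `Y 0` being the rightmost one, `Y 1` its left neighbour, and so on;
`Y k = none` if there are at most `k` columns. -/
abbrev Wall (l : ℕ) := ℕ → Option (Layers l)

/-- The top of the layer `p` is the upper half of a broken `01`- or `(n-1)n`-block: after
un-splitting, there is nothing left of it. -/
def IsUpperHalf (n : ℕ) {l : ℕ} (C : Layers l) (p : Fin l) : Prop :=
  (C p).top = .half ∧
    ∃ j, (j = .zo ∨ j = .nn) ∧ rowBlock n (C p).row = j ∧
      unsplitAll n j C p = ⟨(C p).row, .flat⟩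

/-- The top of the layer `p` is the lower half of a broken `01`- or `(n-1)n`-block: after
un-splitting, it has become a whole block. -/
def IsLowerHalf (n : ℕ) {l : ℕ} (C : Layers l) (p : Fin l) : Prop :=
  (C p).top = .half ∧
    ∃ j, (j = .zo ∨ j = .nn) ∧ rowBlock n (C p).row = j ∧
      unsplitAll n j C p = ⟨(C p).row + 1, .flat⟩

/-- In the layer `p`, there is no free space to the right of any block of the left slice `A`,
the slice `B` being its right neighbour. -/
def NoFreeSpace (n : ℕ) {l : ℕ} (A B : Layers l) (p : Fin l) : Prop :=
  (A p).row < (B p).row ∨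
  ((A p).row = (B p).row ∧
    match (A p).top, (B p).top with
    | .flat, _ => True
    | .single s, .single t => s = t
    | .half, .half => True
    | .single _, .half => IsLowerHalf n B p
    | .half, .single _ => IsUpperHalf n A p
    | _, .flat => False)

/-- No column of the wall reaches below the row `g`. -/
def StandsOn {l : ℕ} (g : ℤ) (Y : Wall l) : Prop :=
  ∀ k C, Y k = some C → ∀ p, g ≤ (C p).row

/-- Level-`l` Young walls.  The last condition says that the wall stands on some ground, above which
every column consists of finitely many blocks. -/
structure IsYoungWall (n : ℕ) {l : ℕ} (Y : Wall l) : Prop where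
  connected : ∀ k, Y k = none → Y (k + 1) = none
  slices : ∀ k C, Y k = some C → IsSlice n C
  noFreeSpace : ∀ k A B, Y (k + 1) = some A → Y k = some B → ∀ p, NoFreeSpace n A B p
  ground : ∃ g : ℤ, StandsOn g Y

/-- Proper Young walls: in each layer, no two columns whose tops are of unit depth and of integer
height have the same height. -/
structure IsProper (n : ℕ) {l : ℕ} (Y : Wall l) : Prop extends IsYoungWall n Y where
  proper : ∀ k k' A B, k ≠ k' → Y k = some A → Y k' = some B →
    ∀ p, (A p).top = .flat → (B p).top = .flat → (A p).row ≠ (B p).row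

/-- The set of level-`l` proper Young walls. -/
abbrev ProperWall (n l : ℕ) := {Y : Wall l // IsProper n Y}

/-! ### Signatures -/

inductive Sign
  | one
  | zero
  deriving DecidableEq

/-- The `i`-signature of the `k`-th column, read from left to right, every letter being marked with
the column it stems from. -/
noncomputable def columnWord (n i : ℕ) {l : ℕ} (Y : Wall l) (k : ℕ) : List (Sign × ℕ) :=
  match Y k with
  | none => []
  | some C =>
    List.replicate (epsSlice n k i C) (.one, k) ++ List.replicate (phiSlice n k i C) (.zero, k)

/-- The word of the rightmost `K` columns, read from left to right. -/
noncomputable def word (n i : ℕ) {l : ℕ} (Y : Wall l) : ℕ → List (Sign × ℕ)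
  | 0 => []
  | K + 1 => columnWord n i Y K ++ word n i Y K

/-- Write a letter to the left of a word and cancel the pair `(0, 1)` that may have arisen. -/
def cancelStep (x : Sign × ℕ) (w : List (Sign × ℕ)) : List (Sign × ℕ) :=
  match x.1, w with
  | .zero, (.one, _) :: v => v
  | _, w => x :: w

/-- Successively cancel all pairs `(0, 1)`. -/
def cancel (w : List (Sign × ℕ)) : List (Sign × ℕ) := w.foldr cancelStep []

/-- The number of letters `s` of the `k`-th column in the `i`-signature of the wall.  When the word
is extended by further columns to the left, such letters can get cancelled, but none can reappear;
so the number is the least one that occurs. -/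
noncomputable def signCount (n i : ℕ) {l : ℕ} (Y : Wall l) (s : Sign) (k : ℕ) : ℕ :=
  sInf {m | ∃ K, k < K ∧ m = (cancel (word n i Y K)).count (s, k)}

/-- Number of `0`s in the `i`-signature. -/
noncomputable def phiWall (n i : ℕ) {l : ℕ} (Y : Wall l) : ℕ := ∑ᶠ k, signCount n i Y .zero k

/-- Number of `1`s in the `i`-signature. -/
noncomputable def epsWall (n i : ℕ) {l : ℕ} (Y : Wall l) : ℕ := ∑ᶠ k, signCount n i Y .one k

/-- The column `k` contains the leftmost `0` of the `i`-signature. -/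
def HasLeftmostZero (n i : ℕ) {l : ℕ} (Y : Wall l) (k : ℕ) : Prop :=
  signCount n i Y .zero k ≠ 0 ∧ ∀ m, k < m → signCount n i Y .zero m = 0

/-- The column `k` contains the rightmost `1` of the `i`-signature. -/
def HasRightmostOne (n i : ℕ) {l : ℕ} (Y : Wall l) (k : ℕ) : Prop :=
  signCount n i Y .one k ≠ 0 ∧ ∀ m, m < k → signCount n i Y .one m = 0

/-- Replace the `k`-th column by its image under `g`; `none` if there is no such column or `g` is
`0` on it. -/
def replaceColumn {l : ℕ} (g : Layers l → Option (Layers l)) (Y : Wall l) (k : ℕ) :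
    Option (Wall l) :=
  ((Y k).bind g).map fun C => Function.update Y k (some C)

open Classical in
/-- `f̃ᵢ` on sequences of columns. -/
noncomputable def fWall (n i : ℕ) {l : ℕ} (Y : Wall l) : Option (Wall l) :=
  if h : ∃ k, HasLeftmostZero n i Y k then replaceColumn (fSlice n h.choose i) Y h.choose else none

open Classical in
/-- `ẽᵢ` on sequences of columns. -/
noncomputable def eWall (n i : ℕ) {l : ℕ} (Y : Wall l) : Option (Wall l) :=
  if h : ∃ k, HasRightmostOne n i Y k then replaceColumn (eSlice n h.choose i) Y h.choose else none

open Classical in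
/-- Regard a sequence of columns as a proper Young wall, if it is one. -/
noncomputable def toProper (n : ℕ) {l : ℕ} (Y : Wall l) : Option (ProperWall n l) :=
  if h : IsProper n Y then some ⟨Y, h⟩ else none

/-- `f̃ᵢ` on proper Young walls. -/
noncomputable def fProper {n l : ℕ} (i : Fin (n + 1)) (Y : ProperWall n l) :
    Option (ProperWall n l) :=
  (fWall n i Y.1).bind (toProper n)

/-- `ẽᵢ` on proper Young walls. -/
noncomputable def eProper {n l : ℕ} (i : Fin (n + 1)) (Y : ProperWall n l) :
    Option (ProperWall n l) :=
  (eWall n i Y.1).bind (toProper n)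

/-- `φᵢ` on proper Young walls. -/
noncomputable def phiProper {n l : ℕ} (i : Fin (n + 1)) (Y : ProperWall n l) : ℤ :=
  phiWall n i Y.1

/-- `εᵢ` on proper Young walls. -/
noncomputable def epsProper {n l : ℕ} (i : Fin (n + 1)) (Y : ProperWall n l) : ℤ :=
  epsWall n i Y.1

/-- The classical weight `∑ᵢ (φᵢ(Y) - εᵢ(Y)) Λᵢ`, as the family of its coefficients. -/
noncomputable def wtProper {n l : ℕ} (Y : ProperWall n l) : Fin (n + 1) → ℤ :=
  fun i => phiProper i Y - epsProper i Y

/-! ### Crystals -/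

/-- The generalized Cartan matrix of type `D_n^{(1)}`, `n ≥ 4`.  The edges of its Dynkin diagram are
`0 - 2`, `1 - 2`, `2 - 3`, …, `(n-2) - (n-1)`, `(n-2) - n`. -/
def affineCartanD (n : ℕ) : Matrix (Fin (n + 1)) (Fin (n + 1)) ℤ :=
  let edge (i j : ℕ) : Prop :=
    (i = 0 ∧ j = 2) ∨ (1 ≤ i ∧ j = i + 1 ∧ j + 1 ≤ n) ∨ (i + 2 = n ∧ j = n)
  Matrix.of fun i j =>
    if i = j then 2
    else if edge i j ∨ edge j i then -1
    else 0

/-- The simple root `αᵢ = ∑ⱼ aⱼᵢ Λⱼ` in the classical weight lattice `⨁ⱼ ℤ Λⱼ`. -/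
def simpleRoot {I : Type*} (A : Matrix I I ℤ) (i : I) : I → ℤ := fun j => A j i

/-- Crystals over the quantum group `U_q'(g)` of the affine Lie algebra `g` with Cartan matrix `A`.
Weights lie in the classical weight lattice and are given by their coefficients with respect to the
fundamental weights, so that `⟨hᵢ, λ⟩` is `λ i`; the value `0` of `ẽᵢ`, `f̃ᵢ` is `none` and the
value `-∞` of `εᵢ`, `φᵢ` is `⊥`. -/
structure IsCrystal {I B : Type*} (A : Matrix I I ℤ) (wt : B → I → ℤ)
    (e f : I → B → Option B) (ε φ : I → B → WithBot ℤ) : Prop where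
  phi_eq : ∀ i b, φ i b = ε i b + (wt b i : WithBot ℤ)
  wt_e : ∀ i b b', e i b = some b' → wt b' = wt b + simpleRoot A i
  wt_f : ∀ i b b', f i b = some b' → wt b' = wt b - simpleRoot A i
  eps_e : ∀ i b b', e i b = some b' → ε i b = ε i b' + 1
  phi_e : ∀ i b b', e i b = some b' → φ i b' = φ i b + 1
  eps_f : ∀ i b b', f i b = some b' → ε i b' = ε i b + 1
  phi_f : ∀ i b b', f i b = some b' → φ i b = φ i b' + 1
  f_iff_e : ∀ i b b', f i b = some b' ↔ e i b' = some b
  bot : ∀ i b, φ i b = ⊥ → e i b = none ∧ f i b = none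

end YoungWall

/-! Extend the `l` layers of a slice to a family indexed by all integers, in which passing from
index `p` to `p + l` adds one cycle, and measure heights in half units. The chain of inclusions
makes the heights weakly increasing in the index, and splitting preserves this. Hence a slice is
recorded by the function `a`, where `a h` is the first index of height at least `h`, together with
the positions `Q` of the single half-unit depth blocks in the rows `01` and `(n-1)n`. This is a
`Code`, quasi-periodic with period `2 * cycleLength n`. In this picture "rear-most of those in the
lower height" is the last index of a height class modulo the period, "fore-most of those in the
higher height" is the first one, and putting or taking a half changes one value of `a`, together
with its translates, by one (`Rep.put_half`, `Rep.take_half`).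

The reflection `h ↦ 2 - h` of heights exchanges the two roles: with `b = 2 * i - 2`, the supporting
`i`-slots have height `b` and the covering ones height `-b`, modulo the period. Splitting takes a
half from the first layer of some even height `g` and puts it on the last layer of height `2 - g`.
Therefore halves occur equally often at heights `h` and `2 - h` (`symm`), in the rows of half-unit
depth blocks as many halves precede the single blocks as follow them (`balance`), and no splitting
is left exactly when for each even `h` one of the classes `h`, `2 - h` is empty (`disj`). Conversely
every code with these properties comes from a pre-slice, since halves can be reassembled pair by
pair. This is `isSlice_iff`.

On codes the operators are explicit: `Code.midF` and `Code.endF` lower two values, chosen according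
to which classes are empty, and `Code.midE`, `Code.endE` raise them again. By `disj` the choices
made on the way back are the opposite ones, so the operators are mutually inverse. The numbers `φᵢ`,
`εᵢ` are differences of values of `a` and `Q`. Turning slices upside down (`Code.dual`) exchanges
`ẽᵢ` and `f̃ᵢ`, which halves the work. Since `φⱼ - εⱼ` is linear in the code, its change under `f̃ᵢ`
is computed class by class and yields the Cartan matrix (`Code.wt_f`).

For two neighbouring columns, absence of free space together with properness becomes a system of
inequalities between their codes, `Code.Rel`; it is transitive, so distant columns need no separate
treatment. Applying `f̃ᵢ` to a column can only spoil the relation to its right neighbour, and does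
not if `φᵢ` of the column exceeds `εᵢ` of that neighbour (`Code.Rel.f_left`). The leftmost `0` of
the signature provides exactly this inequality. The rightmost `1` plays the same role for `ẽᵢ` and
the left neighbour (`Code.Rel.e_right`).

In an infinite wall the finitely many values of the codes which matter for `i` are monotone along
the columns and bounded by the ground, so they become constant. Equal values in neighbouring columns
force `φᵢ` of the left one to equal `εᵢ` of the right one (`Code.Rel.phi_eq_eps`), so far to the
left all letters cancel. The rest is the combinatorics of cancellation: changing the leftmost `0`
into a `1` makes it the rightmost `1`, and conversely, and `φᵢ - εᵢ` of a wall changes by what it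
changes in the replaced column. -/

namespace YoungWall

/-! ### Heights and residue classes -/

/-- The number of rows in a cycle. -/
def cycleLength (n : ℕ) : ℤ := 2 * (n : ℤ) - 4

/-- The height of a layer in half units, a half-unit depth block being counted like a half. -/
def Layer.height (c : Layer) : ℤ :=
  match c.top with
  | .flat => 2 * c.row
  | _ => 2 * c.row + 1

theorem Layer.height_of_flat {c : Layer} (h : c.top = .flat) : c.height = 2 * c.row := by
  simp [Layer.height, h]

theorem Layer.height_of_ne_flat {c : Layer} (h : c.top ≠ .flat) : c.height = 2 * c.row + 1 := by
  unfold Layer.height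
  split <;> simp_all

theorem Layer.height_cases (c : Layer) :
    (c.top = .flat ∧ c.height = 2 * c.row) ∨ (c.top ≠ .flat ∧ c.height = 2 * c.row + 1) := by
  by_cases h : c.top = .flat
  · exact .inl ⟨h, height_of_flat h⟩
  · exact .inr ⟨h, height_of_ne_flat h⟩

/-- The parity of the height separates flat tops from the others, so only the distinction between a
half and the two single blocks remains. -/
theorem Layer.ext_height {c d : Layer} (h : c.height = d.height)
    (hs : ∀ s, c.top = .single s ↔ d.top = .single s) : c = d := by
  rcases c with ⟨r, t⟩
  rcases d with ⟨r', t'⟩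
  cases t <;> cases t' <;> simp [Layer.height] at h hs ⊢ <;>
    first | omega | exact ⟨by omega, by simp_all⟩

/-- The rows which can be filled by a whole block `j` in role `ρ` are congruent to this one. -/
def baseRow (n : ℕ) : Whole → Role → ℤ
  | .zo, _ => 0
  | .nn, _ => (n : ℤ) - 2
  | .mid i, .supporting => (i : ℤ) - 1
  | .mid i, .covering => 1 - (i : ℤ)

/-- The whole blocks which occur in the pattern. -/
def IsWhole (n : ℕ) : Whole → Prop
  | .mid i => 2 ≤ i ∧ i + 2 ≤ n
  | _ => True

/-- Two forms of `b` are allowed because the covering rows are based at the negative number `1 - i`,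
one cycle below the phase. -/
theorem phase_eq_iff {n : ℕ} (hn : 4 ≤ n) (r b : ℤ) (b' : ℕ) (hb' : (b' : ℤ) < cycleLength n)
    (hb : b = b' ∨ b = b' - cycleLength n) : cycleLength n ∣ r - b ↔ phase n r = b' := by
  have hT : (2 * (n : ℤ) - 4) = cycleLength n := rfl
  have h0 : 0 < cycleLength n := by unfold cycleLength; omega
  have h1 : b % cycleLength n = b' := by
    rcases hb with h | h
    · rw [h]; exact Int.emod_eq_of_lt (by omega) hb'
    · rw [h, Int.sub_emod_right]; exact Int.emod_eq_of_lt (by omega) hb'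
  have h2 := Int.emod_nonneg r h0.ne'
  rw [← Int.modEq_iff_dvd, Int.ModEq, h1, phase, hT]
  omega

theorem phase_lt {n : ℕ} (hn : 4 ≤ n) (r : ℤ) : (phase n r : ℤ) < cycleLength n := by
  have h0 : 0 < cycleLength n := by unfold cycleLength; omega
  have h2 := Int.emod_nonneg r h0.ne'
  have h3 := Int.emod_lt_of_pos r h0
  have hT : (2 * (n : ℤ) - 4) = cycleLength n := rfl
  rw [phase, hT]
  omega

/-- Turns the pattern into congruences modulo a cycle. `IsWhole` is needed on the right because
`baseRow` also has values for colours `i` without a row. -/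
theorem rowBlock_iff {n : ℕ} (hn : 4 ≤ n) (r : ℤ) (j : Whole) (ρ : Role) :
    rowBlock n r = j ∧ HasRole n r ρ ↔ IsWhole n j ∧ cycleLength n ∣ r - baseRow n j ρ := by
  have hlt := phase_lt hn r
  have hT : cycleLength n = 2 * (n : ℤ) - 4 := rfl
  rcases j with _ | i | _
  · have := phase_eq_iff hn r 0 0 (by omega) (by omega)
    cases ρ <;> simp only [rowBlock, HasRole, IsWhole, baseRow] <;> rw [this] <;>
      split_ifs <;> simp <;> omega
  · by_cases hi : 2 ≤ i ∧ i + 2 ≤ n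
    · cases ρ
      · have := phase_eq_iff hn r (i - 1) (i - 1) (by omega) (by omega)
        simp only [rowBlock, HasRole, IsWhole, baseRow]
        rw [this]
        split_ifs <;> simp <;> omega
      · have := phase_eq_iff hn r (1 - i) (2 * n - 3 - i) (by omega) (by omega)
        simp only [rowBlock, HasRole, IsWhole, baseRow]
        rw [this]
        split_ifs <;> simp <;> omega
    · simp only [rowBlock, IsWhole, hi, false_and, iff_false, not_and]
      intro h
      exfalso
      split_ifs at h <;> simp at h <;> omega
  · have := phase_eq_iff hn r (n - 2) (n - 2) (by omega) (by omega)
    cases ρ <;> simp only [rowBlock, HasRole, IsWhole, baseRow] <;> rw [this] <;>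
      split_ifs <;> simp <;> omega

theorem hasRole_or {n : ℕ} (r : ℤ) : HasRole n r .supporting ∨ HasRole n r .covering := by
  simp only [HasRole]; omega

theorem isWhole_rowBlock {n : ℕ} (hn : 4 ≤ n) (r : ℤ) : IsWhole n (rowBlock n r) := by
  rcases hasRole_or (n := n) r with h | h
  · exact ((rowBlock_iff hn r _ _).1 ⟨rfl, h⟩).1
  · exact ((rowBlock_iff hn r _ _).1 ⟨rfl, h⟩).1

theorem rowBlock_zo_iff {n : ℕ} (hn : 4 ≤ n) (r : ℤ) :
    rowBlock n r = .zo ↔ cycleLength n ∣ r := by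
  have := rowBlock_iff hn r .zo .supporting
  have h2 := rowBlock_iff hn r .zo .covering
  simp only [IsWhole, baseRow, sub_zero, true_and] at this h2
  constructor
  · intro h
    rcases hasRole_or (n := n) r with h' | h'
    · exact this.1 ⟨h, h'⟩
    · exact h2.1 ⟨h, h'⟩
  · exact fun h => (this.2 h).1

theorem rowBlock_nn_iff {n : ℕ} (hn : 4 ≤ n) (r : ℤ) :
    rowBlock n r = .nn ↔ cycleLength n ∣ r - (n - 2) := by
  have := rowBlock_iff hn r .nn .supporting
  have h2 := rowBlock_iff hn r .nn .covering
  simp only [IsWhole, baseRow, true_and] at this h2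
  constructor
  · intro h
    rcases hasRole_or (n := n) r with h' | h'
    · exact this.1 ⟨h, h'⟩
    · exact h2.1 ⟨h, h'⟩
  · exact fun h => (this.2 h).1

/-- The `(n-1)n`-rows lie half a cycle, `n - 2` rows, above the `01`-rows; so the two kinds together
are the multiples of half a cycle. -/
theorem rowBlock_end_iff {n : ℕ} (hn : 4 ≤ n) (r : ℤ) :
    (rowBlock n r = .zo ∨ rowBlock n r = .nn) ↔ cycleLength n ∣ 2 * r := by
  rw [rowBlock_zo_iff hn, rowBlock_nn_iff hn]
  have hT : cycleLength n = 2 * ((n : ℤ) - 2) := by unfold cycleLength; ring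
  constructor
  · rintro (h | ⟨m, h⟩)
    · exact h.mul_left 2
    · exact ⟨2 * m + 1, by linear_combination 2 * h - hT⟩
  · rintro ⟨m, h⟩
    rcases Int.even_or_odd' m with ⟨m', h' | h'⟩
    · exact .inl ⟨m', by rw [h'] at h; linarith⟩
    · refine .inr ⟨m', ?_⟩
      rw [h'] at h
      have : 2 * (r - ((n : ℤ) - 2)) = 2 * (cycleLength n * m') := by linear_combination h + hT
      linarith

theorem dvd_two_mul_sub_iff {n : ℕ} (r b : ℤ) :
    2 * cycleLength n ∣ 2 * r - 2 * b ↔ cycleLength n ∣ r - b := by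
  rw [← mul_sub]
  exact mul_dvd_mul_iff_left two_ne_zero

/-! ### Selection of layers -/

/-- The predicates in the two selections single out at most one index, so the order of the list
searched is irrelevant. -/
theorem find?_eq_some_of_unique {α : Type*} {L : List α} {P : α → Bool} {x : α} (hx : x ∈ L)
    (hP : P x = true) (hu : ∀ y, P y = true → y = x) : L.find? P = some x := by
  rcases h : L.find? P with _ | y
  · rw [List.find?_eq_none] at h
    exact absurd hP (h x hx)
  · rw [hu y (List.find?_some h)]

theorem rearmostLowest_eq_some {l : ℕ} {h : Fin l → ℤ} {S : Fin l → Bool} {p : Fin l}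
    (hp : S p = true) (hm : ∀ q, S q = true → h p < h q ∨ (h q = h p ∧ q ≤ p)) :
    rearmostLowest h S = some p := by
  refine find?_eq_some_of_unique (List.mem_finRange p) (by simpa [hp] using hm) fun y hy => ?_
  simp only [Bool.and_eq_true, decide_eq_true_eq] at hy
  have h1 := hy.2 p hp
  have h2 := hm y hy.1
  omega

theorem rearmostLowest_eq_none {l : ℕ} {h : Fin l → ℤ} {S : Fin l → Bool}
    (hS : ∀ p, S p = false) : rearmostLowest h S = none := by
  simp [rearmostLowest, hS]

theorem foremostHighest_eq_some {l : ℕ} {h : Fin l → ℤ} {S : Fin l → Bool} {p : Fin l}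
    (hp : S p = true) (hm : ∀ q, S q = true → h q < h p ∨ (h q = h p ∧ p ≤ q)) :
    foremostHighest h S = some p := by
  refine find?_eq_some_of_unique (List.mem_finRange p) (by simpa [hp] using hm) fun y hy => ?_
  simp only [Bool.and_eq_true, decide_eq_true_eq] at hy
  have h1 := hy.2 p hp
  have h2 := hm y hy.1
  omega

theorem foremostHighest_eq_none {l : ℕ} {h : Fin l → ℤ} {S : Fin l → Bool}
    (hS : ∀ p, S p = false) : foremostHighest h S = none := by
  simp [foremostHighest, hS]

end YoungWall

namespace YoungWall

/-! ### Codes of slices -/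

/-- A slice, extended periodically to a sequence of layers indexed by `ℤ`, is encoded by the index
`a h` of the first layer of height at least `h` and by indices `Q s e` such that the layers with a
single block on the side `s` in the row of the heights `e`, `e + 1` are those with index in
`[Q s e, Q s.swap e)`. -/
@[ext]
structure Code where
  a : ℤ → ℤ
  Q : Side → ℤ → ℤ

/-- Add `k` to the values of `f` at the heights congruent to `g`. -/
def bump (n : ℕ) (f : ℤ → ℤ) (g k : ℤ) : ℤ → ℤ :=
  fun x => f x + if 2 * cycleLength n ∣ x - g then k else 0

def Code.bumpA (n : ℕ) (c : Code) (g k : ℤ) : Code := ⟨bump n c.a g k, c.Q⟩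

def Code.bumpQ (n : ℕ) (c : Code) (s : Side) (e k : ℤ) : Code :=
  ⟨c.a, Function.update c.Q s (bump n (c.Q s) e k)⟩

/-- One further cycle corresponds to `l` further layers. -/
def QuasiPeriodic (n l : ℕ) (f : ℤ → ℤ) : Prop := ∀ h, f (h + 2 * cycleLength n) = f h + l

theorem cycleLength_pos {n : ℕ} (hn : 4 ≤ n) : 4 ≤ cycleLength n := by
  unfold cycleLength; omega

theorem cycleLength_even (n : ℕ) : Even (cycleLength n) := ⟨(n : ℤ) - 2, by unfold cycleLength; ring⟩

theorem QuasiPeriodic.add_mul {n l : ℕ} {f : ℤ → ℤ} (hf : QuasiPeriodic n l f) (h m : ℤ) :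
    f (h + 2 * cycleLength n * m) = f h + l * m := by
  induction m with
  | zero => simp
  | succ m ih =>
    rw [show h + 2 * cycleLength n * ((m : ℤ) + 1) = h + 2 * cycleLength n * m + 2 * cycleLength n by
      ring, hf, ih]
    ring
  | pred m ih =>
    have := hf (h + 2 * cycleLength n * (-(m : ℤ) - 1))
    rw [show h + 2 * cycleLength n * (-(m : ℤ) - 1) + 2 * cycleLength n
      = h + 2 * cycleLength n * (-(m : ℤ)) by ring, ih] at this
    linear_combination -this

theorem bump_add_mul {n : ℕ} (f : ℤ → ℤ) (g k m : ℤ) :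
    bump n f (g + 2 * cycleLength n * m) k = bump n f g k := by
  funext x
  have : 2 * cycleLength n ∣ x - (g + 2 * cycleLength n * m) ↔ 2 * cycleLength n ∣ x - g := by
    rw [← sub_sub]
    exact dvd_sub_left (Dvd.intro _ rfl)
  simp only [bump, this]

theorem bump_of_dvd {n : ℕ} {f : ℤ → ℤ} {g k x : ℤ} (h : 2 * cycleLength n ∣ x - g) :
    bump n f g k x = f x + k := by simp [bump, h]

theorem bump_of_not_dvd {n : ℕ} {f : ℤ → ℤ} {g k x : ℤ} (h : ¬ 2 * cycleLength n ∣ x - g) :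
    bump n f g k x = f x := by simp [bump, h]

theorem exists_eq_add_mul_of_dvd {n : ℕ} {x g : ℤ} (h : 2 * cycleLength n ∣ x - g) :
    ∃ m, x = g + 2 * cycleLength n * m := by
  obtain ⟨m, hm⟩ := h
  exact ⟨m, by linarith⟩

theorem QuasiPeriodic.bump {n l : ℕ} {f : ℤ → ℤ} (hf : QuasiPeriodic n l f) (g k : ℤ) :
    QuasiPeriodic n l (bump n f g k) := by
  intro h
  have : 2 * cycleLength n ∣ h + 2 * cycleLength n - g ↔ 2 * cycleLength n ∣ h - g := by
    rw [show h + 2 * cycleLength n - g = h - g + 2 * cycleLength n by ring]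
    exact dvd_add_left (dvd_refl _)
  simp only [YoungWall.bump, this, hf h]
  ring

/-- `lower` and `upper` say that the single blocks of the row starting at height `e` sit among the
layers of height `e + 1`, whose indices form `[a (e + 1), a (e + 2))`. -/
structure Code.Basic (n l : ℕ) (c : Code) : Prop where
  mono : ∀ h, c.a h ≤ c.a (h + 1)
  period : QuasiPeriodic n l c.a
  periodQ : ∀ s, QuasiPeriodic n l (c.Q s)
  lower : ∀ s e, cycleLength n ∣ e → c.a (e + 1) ≤ c.Q s e
  upper : ∀ s e, cycleLength n ∣ e → c.Q s e ≤ c.a (e + 2)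

theorem Code.Basic.monotone {n l : ℕ} {c : Code} (hc : c.Basic n l) : Monotone c.a :=
  monotone_int_of_le_succ hc.mono

/-- Eight half units are at most one period, because `n ≥ 4` gives a cycle at least four rows. -/
theorem Code.Basic.sub_le {n l : ℕ} {c : Code} (hc : c.Basic n l) (hn : 4 ≤ n) {h h' : ℤ}
    (h1 : h' ≤ h + 8) : c.a h' ≤ c.a h + l := by
  rw [← hc.period]
  exact hc.monotone (by have := cycleLength_pos hn; omega)

/-- The layers `C` are encoded by `c`. -/
structure Rep (n : ℕ) {l : ℕ} (C : Layers l) (c : Code) : Prop where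
  le_iff : ∀ (p : Fin l) h, c.a h ≤ (p : ℕ) ↔ h ≤ (C p).height
  single_iff : ∀ (p : Fin l) s, (C p).top = .single s ↔
    cycleLength n ∣ (C p).height - 1 ∧ c.Q s ((C p).height - 1) ≤ (p : ℕ) ∧
      ((p : ℕ) : ℤ) < c.Q s.swap ((C p).height - 1)

/-- Finds among the translates of an arbitrary index the one that belongs to a genuine layer. -/
theorem exists_index {l : ℕ} (hl : 1 ≤ l) (x : ℤ) :
    ∃ (p : Fin l) (m : ℤ), ((p : ℕ) : ℤ) = x + l * m := by
  have h1 := Int.emod_nonneg x (show (l : ℤ) ≠ 0 by omega)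
  have h2 := Int.emod_lt_of_pos x (show (0 : ℤ) < l by omega)
  refine ⟨⟨(x % l).toNat, by omega⟩, -(x / l), ?_⟩
  have := Int.emod_add_mul_ediv x l
  simp only
  rw [Int.toNat_of_nonneg h1]
  linarith

section
variable {n l : ℕ} {C C' : Layers l} {c c' : Code}

theorem Rep.lt_iff (hC : Rep n C c) (p : Fin l) (h : ℤ) :
    ((p : ℕ) : ℤ) < c.a h ↔ (C p).height < h := by
  rw [← not_le, hC.le_iff, not_le]

theorem Rep.height_eq_iff (hC : Rep n C c) (p : Fin l) (h : ℤ) :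
    (C p).height = h ↔ c.a h ≤ (p : ℕ) ∧ ((p : ℕ) : ℤ) < c.a (h + 1) := by
  rw [hC.le_iff, hC.lt_iff]; omega

theorem Rep.unique (hC : Rep n C c) (hC' : Rep n C' c) : C = C' := by
  funext p
  have h : (C p).height = (C' p).height :=
    le_antisymm ((hC'.le_iff p _).1 ((hC.le_iff p _).2 le_rfl))
      ((hC.le_iff p _).1 ((hC'.le_iff p _).2 le_rfl))
  exact Layer.ext_height h fun s => by rw [hC.single_iff, hC'.single_iff, h]

theorem Rep.update {p : Fin l} {x : Layer} (hC : Rep n C c)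
    (ha : ∀ q ≠ p, ∀ h, c'.a h ≤ (q : ℕ) ↔ c.a h ≤ (q : ℕ))
    (hQ : ∀ q ≠ p, ∀ s e, c'.Q s e ≤ (q : ℕ) ↔ c.Q s e ≤ (q : ℕ))
    (hp : ∀ h, c'.a h ≤ (p : ℕ) ↔ h ≤ x.height)
    (hx : ∀ s, x.top = .single s ↔ cycleLength n ∣ x.height - 1 ∧ c'.Q s (x.height - 1) ≤ (p : ℕ) ∧
      ((p : ℕ) : ℤ) < c'.Q s.swap (x.height - 1)) :
    Rep n (Function.update C p x) c' where
  le_iff q h := by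
    by_cases hq : q = p
    · subst hq; simpa using hp h
    · rw [Function.update_of_ne hq, ha q hq, hC.le_iff]
  single_iff q s := by
    by_cases hq : q = p
    · subst hq; simpa using hx s
    · rw [Function.update_of_ne hq, hC.single_iff, hQ q hq, ← not_le, ← not_le, hQ q hq]

/-- Lowering the value at the translate by `m` periods changes the comparison only for the index `f
g - 1 + l * m`, and among these only `p` itself lies in `[0, l)`. -/
theorem bump_neg_le_iff {f : ℤ → ℤ} {g : ℤ} (hf : QuasiPeriodic n l f) {p q : Fin l}
    (hp : ((p : ℕ) : ℤ) = f g - 1) (hq : q ≠ p) (x : ℤ) :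
    bump n f g (-1) x ≤ (q : ℕ) ↔ f x ≤ (q : ℕ) := by
  by_cases h : 2 * cycleLength n ∣ x - g
  · obtain ⟨m, rfl⟩ := exists_eq_add_mul_of_dvd h
    rw [bump_of_dvd h, hf.add_mul]
    have hq' : (q : ℕ) ≠ p := fun h => hq (Fin.ext h)
    have h1 := q.isLt
    have h2 := p.isLt
    rcases lt_trichotomy m 0 with hm | hm | hm
    · have : (l : ℤ) * m ≤ l * (-1) := by gcongr; omega
      omega
    · subst hm; omega
    · have : (l : ℤ) * 1 ≤ l * m := by gcongr; omega
      omega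
  · rw [bump_of_not_dvd h]

theorem bump_one_le_iff {f : ℤ → ℤ} {g : ℤ} (hf : QuasiPeriodic n l f) {p q : Fin l}
    (hp : ((p : ℕ) : ℤ) = f g) (hq : q ≠ p) (x : ℤ) :
    bump n f g 1 x ≤ (q : ℕ) ↔ f x ≤ (q : ℕ) := by
  by_cases h : 2 * cycleLength n ∣ x - g
  · obtain ⟨m, rfl⟩ := exists_eq_add_mul_of_dvd h
    rw [bump_of_dvd h, hf.add_mul]
    have hq' : (q : ℕ) ≠ p := fun h => hq (Fin.ext h)
    have h1 := q.isLt
    have h2 := p.isLt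
    rcases lt_trichotomy m 0 with hm | hm | hm
    · have : (l : ℤ) * m ≤ l * (-1) := by gcongr; omega
      omega
    · subst hm; omega
    · have : (l : ℤ) * 1 ≤ l * m := by gcongr; omega
      omega
  · rw [bump_of_not_dvd h]

/-- The layer `p` is the last one below height `g`, at height `g - 1` by `hg`; afterwards its height
is `g`. Translates of the lowered value further up exceed `p` by at least `l - 1`, enough since they
are compared after one more period. -/
theorem bump_neg_le_self_iff (hn : 4 ≤ n) {f : ℤ → ℤ} {g : ℤ} (hf : QuasiPeriodic n l f)
    (hm : Monotone f) {p : Fin l} (hp : ((p : ℕ) : ℤ) = f g - 1) (hg : f (g - 1) < f g) (x : ℤ) :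
    bump n f g (-1) x ≤ (p : ℕ) ↔ x ≤ g := by
  have hT := cycleLength_pos hn
  have hlt := p.isLt
  rcases lt_trichotomy x g with hx | hx | hx
  · have h1 : f x ≤ f (g - 1) := hm (by omega)
    have h2 : bump n f g (-1) x ≤ f x := by unfold bump; split_ifs <;> omega
    omega
  · subst hx
    rw [bump_of_dvd (by simp)]; omega
  · have h1 : f g ≤ f x := hm hx.le
    by_cases h : 2 * cycleLength n ∣ x - g
    · have h3 := Int.le_of_dvd (by omega) h
      have h4 : f (g + 2 * cycleLength n) ≤ f x := hm (by omega)
      rw [hf] at h4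
      rw [bump_of_dvd h]; omega
    · rw [bump_of_not_dvd h]; omega

theorem bump_one_le_self_iff (hn : 4 ≤ n) {f : ℤ → ℤ} {g : ℤ} (hf : QuasiPeriodic n l f)
    (hm : Monotone f) {p : Fin l} (hp : ((p : ℕ) : ℤ) = f g) (hg : f g < f (g + 1)) (x : ℤ) :
    bump n f g 1 x ≤ (p : ℕ) ↔ x ≤ g - 1 := by
  have hT := cycleLength_pos hn
  have hlt := p.isLt
  rcases lt_trichotomy x g with hx | hx | hx
  · have h1 : f x ≤ f g := hm (by omega)
    by_cases h : 2 * cycleLength n ∣ x - g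
    · have h3 := Int.le_of_dvd (by omega) ((dvd_sub_comm).1 h)
      have h4 : f (x + 2 * cycleLength n) ≤ f g := hm (by omega)
      rw [hf] at h4
      rw [bump_of_dvd h]; omega
    · rw [bump_of_not_dvd h]; omega
  · subst hx
    rw [bump_of_dvd (by simp)]; omega
  · have h1 : f (g + 1) ≤ f x := hm (by omega)
    have h2 : f x ≤ bump n f g 1 x := by unfold bump; split_ifs <;> omega
    omega

/-! ### Selection of layers and codes -/

/-- Candidates lie in translates of a window no longer than a period, and the key only remembers the
number `m` of the translate. A candidate in an earlier window than `p` would have a negative index,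
one in a later window has a larger key, and in its own window `p` is the last index. -/
theorem Rep.rearmostLowest_eq (hn : 4 ≤ n) (hc : c.Basic n l) (hC : Rep n C c) {S : Fin l → Bool}
    {key : Fin l → ℤ} {lo hi κ : ℤ} (hlohi : hi ≤ lo + 2 * cycleLength n)
    (hS : ∀ p, S p = true → ∃ m, lo + 2 * cycleLength n * m ≤ (C p).height ∧
      (C p).height < hi + 2 * cycleLength n * m ∧ key p = κ + cycleLength n * m)
    {p : Fin l} {m : ℤ} (hp : ((p : ℕ) : ℤ) = c.a hi + l * m - 1) (hSp : S p = true) :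
    rearmostLowest key S = some p := by
  have hT := cycleLength_pos hn
  refine rearmostLowest_eq_some hSp fun q hq => ?_
  obtain ⟨m1, h1, h2, h3⟩ := hS q hq
  obtain ⟨m2, h4, h5, h6⟩ := hS p hSp
  rw [← hC.lt_iff, hc.period.add_mul] at h2
  have hltp := p.isLt
  have hmul : ∀ x y : ℤ, x < y → (l : ℤ) * x + l ≤ l * y := fun x y h => by
    have : (l : ℤ) * (x + 1) ≤ l * y := by gcongr; omega
    linarith
  have hp' : (C p).height < hi + 2 * cycleLength n * m := by
    rw [← hC.lt_iff, hc.period.add_mul]; omega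
  have hm2 : m2 = m := by
    rcases lt_trichotomy m2 m with h | h | h
    · rw [← hC.lt_iff, hc.period.add_mul] at h5
      have := hmul _ _ h
      omega
    · exact h
    · have : 2 * cycleLength n * (m + 1) ≤ 2 * cycleLength n * m2 := by gcongr; omega
      rw [mul_add] at this
      omega
  subst hm2
  rcases lt_trichotomy m1 m2 with h | h | h
  · have := hmul _ _ h
    omega
  · subst h
    right
    exact ⟨by omega, Fin.le_def.2 (by omega)⟩
  · left
    rw [h3, h6]
    gcongr

theorem Rep.foremostHighest_eq (hn : 4 ≤ n) (hc : c.Basic n l) (hC : Rep n C c) {S : Fin l → Bool}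
    {key : Fin l → ℤ} {lo hi κ : ℤ} (hlohi : hi ≤ lo + 2 * cycleLength n)
    (hS : ∀ p, S p = true → ∃ m, lo + 2 * cycleLength n * m ≤ (C p).height ∧
      (C p).height < hi + 2 * cycleLength n * m ∧ key p = κ + cycleLength n * m)
    {p : Fin l} {m : ℤ} (hp : ((p : ℕ) : ℤ) = c.a lo + l * m) (hSp : S p = true) :
    foremostHighest key S = some p := by
  have hT := cycleLength_pos hn
  refine foremostHighest_eq_some hSp fun q hq => ?_
  obtain ⟨m1, h1, h2, h3⟩ := hS q hq
  obtain ⟨m2, h4, h5, h6⟩ := hS p hSp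
  rw [← hC.le_iff, hc.period.add_mul] at h1
  have hltp := p.isLt
  have hltq := q.isLt
  have hmul : ∀ x y : ℤ, x < y → (l : ℤ) * x + l ≤ l * y := fun x y h => by
    have : (l : ℤ) * (x + 1) ≤ l * y := by gcongr; omega
    linarith
  have hp' : lo + 2 * cycleLength n * m ≤ (C p).height := by
    rw [← hC.le_iff, hc.period.add_mul]; omega
  have hm2 : m2 = m := by
    rcases lt_trichotomy m2 m with h | h | h
    · have : 2 * cycleLength n * (m2 + 1) ≤ 2 * cycleLength n * m := by gcongr; omega
      rw [mul_add] at this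
      omega
    · exact h
    · rw [← hC.le_iff, hc.period.add_mul] at h4
      have := hmul _ _ h
      omega
  subst hm2
  rcases lt_trichotomy m1 m2 with h | h | h
  · left
    rw [h3, h6]
    gcongr
  · subst h
    right
    exact ⟨by omega, Fin.le_def.2 (by omega)⟩
  · have := hmul _ _ h
    omega

/-! ### Moving halves -/

theorem Layer.putHalf_spec {x : Layer} (hx : ∀ s, x.top ≠ .single s) :
    x.putHalf.height = x.height + 1 ∧ ∀ s, x.putHalf.top ≠ .single s := by
  rcases x with ⟨r, t⟩
  cases t <;> simp_all [Layer.putHalf, Layer.height]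
  ring

theorem Layer.takeHalf_spec {x : Layer} (hx : ∀ s, x.top ≠ .single s) :
    x.takeHalf.height = x.height - 1 ∧ ∀ s, x.takeHalf.top ≠ .single s := by
  rcases x with ⟨r, t⟩
  cases t <;> simp_all [Layer.takeHalf, Layer.height]
  ring

/-- The hypotheses say that the last layer of height `g - 1` exists and does not carry a single
block, so that it can be raised without disturbing `Q`. -/
theorem Code.Basic.lowerA (hc : c.Basic n l) {g : ℤ} (hg : c.a (g - 1) < c.a g)
    (hQ : cycleLength n ∣ g - 2 → ∀ s, c.Q s (g - 2) < c.a g) : (c.bumpA n g (-1)).Basic n l where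
  mono h := by
    have h1 := hc.mono h
    simp only [bumpA]
    by_cases hd : 2 * cycleLength n ∣ h + 1 - g
    · obtain ⟨m, hm⟩ := exists_eq_add_mul_of_dvd hd
      obtain rfl : h = g - 1 + 2 * cycleLength n * m := by linarith
      have h2 : bump n c.a g (-1) (g - 1 + 2 * cycleLength n * m) ≤
        c.a (g - 1 + 2 * cycleLength n * m) := by unfold bump; split_ifs <;> omega
      rw [bump_of_dvd hd, hm, hc.period.add_mul]
      rw [hc.period.add_mul] at h2
      omega
    · rw [bump_of_not_dvd hd]
      unfold bump; split_ifs <;> omega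
  period := hc.period.bump _ _
  periodQ := hc.periodQ
  lower s e he := by
    have h1 := hc.lower s e he
    simp only [bumpA]
    unfold bump; split_ifs <;> omega
  upper s e he := by
    have h1 := hc.upper s e he
    simp only [bumpA]
    by_cases hd : 2 * cycleLength n ∣ e + 2 - g
    · obtain ⟨m, hm⟩ := exists_eq_add_mul_of_dvd hd
      obtain rfl : e = g - 2 + 2 * cycleLength n * m := by linarith
      have h2 : cycleLength n ∣ g - 2 := by
        refine (dvd_add_left ?_).1 he
        exact ⟨2 * m, by ring⟩
      have h3 := hQ h2 s
      rw [bump_of_dvd hd, hm, hc.period.add_mul, (hc.periodQ s).add_mul]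
      omega
    · rw [bump_of_not_dvd hd]
      exact h1

/-- Mirror image: the first layer of height `g` exists and carries no single block. -/
theorem Code.Basic.raiseA (hc : c.Basic n l) {g : ℤ} (hg : c.a g < c.a (g + 1))
    (hQ : cycleLength n ∣ g - 1 → ∀ s, c.a g < c.Q s (g - 1)) : (c.bumpA n g 1).Basic n l where
  mono h := by
    have h1 := hc.mono h
    simp only [bumpA]
    by_cases hd : 2 * cycleLength n ∣ h - g
    · obtain ⟨m, hm⟩ := exists_eq_add_mul_of_dvd hd
      have h2 : c.a (g + 1 + 2 * cycleLength n * m) ≤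
        bump n c.a g 1 (g + 1 + 2 * cycleLength n * m) := by unfold bump; split_ifs <;> omega
      rw [bump_of_dvd hd, hm, hc.period.add_mul, show g + 2 * cycleLength n * m + 1 =
        g + 1 + 2 * cycleLength n * m by ring]
      rw [hc.period.add_mul] at h2
      omega
    · rw [bump_of_not_dvd hd]
      unfold bump; split_ifs <;> omega
  period := hc.period.bump _ _
  periodQ := hc.periodQ
  upper s e he := by
    have h1 := hc.upper s e he
    simp only [bumpA]
    unfold bump; split_ifs <;> omega
  lower s e he := by
    have h1 := hc.lower s e he
    simp only [bumpA]
    by_cases hd : 2 * cycleLength n ∣ e + 1 - g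
    · obtain ⟨m, hm⟩ := exists_eq_add_mul_of_dvd hd
      obtain rfl : e = g - 1 + 2 * cycleLength n * m := by linarith
      have h2 : cycleLength n ∣ g - 1 := by
        refine (dvd_add_left ?_).1 he
        exact ⟨2 * m, by ring⟩
      have h3 := hQ h2 s
      rw [bump_of_dvd hd, hm, hc.period.add_mul, (hc.periodQ s).add_mul]
      omega
    · rw [bump_of_not_dvd hd]
      exact h1

theorem Rep.last_spec (hc : c.Basic n l) (hC : Rep n C c) {g : ℤ}
    (hg : c.a (g - 1) < c.a g) (hQ : cycleLength n ∣ g - 2 → ∀ s, c.Q s (g - 2) < c.a g)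
    {p : Fin l} {m : ℤ} (hp : ((p : ℕ) : ℤ) = c.a g + l * m - 1) :
    (C p).height = g + 2 * cycleLength n * m - 1 ∧ ∀ s, (C p).top ≠ .single s := by
  set g' := g + 2 * cycleLength n * m with hg'
  have e1 : c.a g' = c.a g + l * m := hc.period.add_mul _ _
  have e2 : c.a (g' - 1) = c.a (g - 1) + l * m := by
    rw [← hc.period.add_mul, hg']; congr 1; ring
  have e3 : ∀ s, c.Q s (g' - 2) = c.Q s (g - 2) + l * m := fun s => by
    rw [← (hc.periodQ s).add_mul, hg']; congr 1; ring
  have hH : (C p).height = g' - 1 := by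
    rw [hC.height_eq_iff, sub_add_cancel]; omega
  refine ⟨hH, ?_⟩
  intro s hs
  rw [hC.single_iff, hH, sub_sub, one_add_one_eq_two] at hs
  have h2 : cycleLength n ∣ g - 2 := by
    have := hs.1
    rw [show g' - 2 = g - 2 + cycleLength n * (2 * m) by rw [hg']; ring] at this
    exact (dvd_add_left (Dvd.intro _ rfl)).1 this
  have h3 := hQ h2 s.swap
  have h4 := hs.2.2
  rw [e3] at h4
  omega

theorem Rep.first_spec (hc : c.Basic n l) (hC : Rep n C c) {g : ℤ}
    (hg : c.a g < c.a (g + 1)) (hQ : cycleLength n ∣ g - 1 → ∀ s, c.a g < c.Q s (g - 1))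
    {p : Fin l} {m : ℤ} (hp : ((p : ℕ) : ℤ) = c.a g + l * m) :
    (C p).height = g + 2 * cycleLength n * m ∧ ∀ s, (C p).top ≠ .single s := by
  set g' := g + 2 * cycleLength n * m with hg'
  have e1 : c.a g' = c.a g + l * m := hc.period.add_mul _ _
  have e2 : c.a (g' + 1) = c.a (g + 1) + l * m := by
    rw [← hc.period.add_mul, hg']; congr 1; ring
  have e3 : ∀ s, c.Q s (g' - 1) = c.Q s (g - 1) + l * m := fun s => by
    rw [← (hc.periodQ s).add_mul, hg']; congr 1; ring
  have hH : (C p).height = g' := by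
    rw [hC.height_eq_iff]; omega
  refine ⟨hH, ?_⟩
  intro s hs
  rw [hC.single_iff, hH] at hs
  have h2 : cycleLength n ∣ g - 1 := by
    have := hs.1
    rw [show g' - 1 = g - 1 + cycleLength n * (2 * m) by rw [hg']; ring] at this
    exact (dvd_add_left (Dvd.intro _ rfl)).1 this
  have h3 := hQ h2 s
  have h4 := hs.2.1
  rw [e3] at h4
  omega

/-- Raising the last layer of height `g - 1` moves only the boundary `a g`, by one index, and its
translates. -/
theorem Rep.put_half (hn : 4 ≤ n) (hc : c.Basic n l) (hC : Rep n C c) {g : ℤ}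
    (hg : c.a (g - 1) < c.a g) (hQ : cycleLength n ∣ g - 2 → ∀ s, c.Q s (g - 2) < c.a g)
    {p : Fin l} {m : ℤ} (hp : ((p : ℕ) : ℤ) = c.a g + l * m - 1) :
    Rep n (putHalfAt C p) (c.bumpA n g (-1)) := by
  set g' := g + 2 * cycleLength n * m with hg'
  have e1 : c.a g' = c.a g + l * m := hc.period.add_mul _ _
  have e2 : c.a (g' - 1) = c.a (g - 1) + l * m := by
    rw [← hc.period.add_mul, hg']; congr 1; ring
  obtain ⟨hH, hns⟩ := hC.last_spec hc hg hQ hp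
  rw [← hg'] at hH
  obtain ⟨h1, h2⟩ := Layer.putHalf_spec hns
  refine hC.update (fun q hq h => ?_) (fun _ _ _ _ => Iff.rfl) (fun h => ?_) fun s => ?_
  · simp only [Code.bumpA]
    rw [← bump_add_mul c.a g (-1) m, ← hg']
    exact bump_neg_le_iff hc.period (by omega) hq h
  · simp only [Code.bumpA]
    rw [← bump_add_mul c.a g (-1) m, ← hg', h1, hH, sub_add_cancel]
    exact bump_neg_le_self_iff hn hc.period hc.monotone (by omega) (by omega) h
  · simp only [h2, false_iff, h1, hH, sub_add_cancel, Code.bumpA]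
    rintro ⟨h3, h4, -⟩
    have := hc.lower s _ h3
    rw [sub_add_cancel] at this
    omega

theorem Rep.take_half (hn : 4 ≤ n) (hc : c.Basic n l) (hC : Rep n C c) {g : ℤ}
    (hg : c.a g < c.a (g + 1)) (hQ : cycleLength n ∣ g - 1 → ∀ s, c.a g < c.Q s (g - 1))
    {p : Fin l} {m : ℤ} (hp : ((p : ℕ) : ℤ) = c.a g + l * m) :
    Rep n (takeHalfAt C p) (c.bumpA n g 1) := by
  set g' := g + 2 * cycleLength n * m with hg'
  have e1 : c.a g' = c.a g + l * m := hc.period.add_mul _ _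
  have e2 : c.a (g' + 1) = c.a (g + 1) + l * m := by
    rw [← hc.period.add_mul, hg']; congr 1; ring
  obtain ⟨hH, hns⟩ := hC.first_spec hc hg hQ hp
  rw [← hg'] at hH
  obtain ⟨h1, h2⟩ := Layer.takeHalf_spec hns
  refine hC.update (fun q hq h => ?_) (fun _ _ _ _ => Iff.rfl) (fun h => ?_) fun s => ?_
  · simp only [Code.bumpA]
    rw [← bump_add_mul c.a g 1 m, ← hg']
    exact bump_one_le_iff hc.period (by omega) hq h
  · simp only [Code.bumpA]
    rw [← bump_add_mul c.a g 1 m, ← hg', h1, hH]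
    exact bump_one_le_self_iff hn hc.period hc.monotone (by omega) (by omega) h
  · simp only [h2, false_iff, h1, hH, Code.bumpA]
    rintro ⟨h3, -, h4⟩
    have := hc.upper s.swap _ h3
    rw [show g' - 1 - 1 + 2 = g' by ring] at this
    omega

end

end YoungWall

/-! ### Height classes of slots, blocks and halves -/

namespace YoungWall

section
variable {n l : ℕ} {C : Layers l} {c : Code}

theorem row_eq_of_height_eq {x : Layer} {y m : ℤ} (h : x.height = y + 2 * cycleLength n * m) :
    x.row = y / 2 + cycleLength n * m := by
  have := x.height_cases
  rw [mul_assoc] at h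
  omega

/-- The rear-most lowest layer of the height class `x` is a translate of the last index before `a (x
+ 1)`. -/
theorem Rep.rearmost_class (hn : 4 ≤ n) (hl : 1 ≤ l) (hc : c.Basic n l) (hC : Rep n C c)
    {S : Fin l → Bool} {x : ℤ}
    (hS : ∀ p, S p = true ↔ 2 * cycleLength n ∣ (C p).height - x ∧ ∀ s, (C p).top ≠ .single s)
    (hx : c.a x < c.a (x + 1)) (hQ : cycleLength n ∣ x - 1 → ∀ s, c.Q s (x - 1) < c.a (x + 1)) :
    ∃ p m, rearmostLowest (rows C) S = some p ∧ ((p : ℕ) : ℤ) = c.a (x + 1) + l * m - 1 := by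
  have hT := cycleLength_pos hn
  obtain ⟨p, m, hp⟩ := exists_index hl (c.a (x + 1) - 1)
  have hp' : ((p : ℕ) : ℤ) = c.a (x + 1) + l * m - 1 := by linarith
  have h1 := hC.last_spec hc (g := x + 1) (by simpa using hx)
    (by rwa [show x + 1 - 2 = x - 1 by ring]) hp'
  refine ⟨p, m, hC.rearmostLowest_eq hn hc (lo := x) (κ := x / 2) (by omega) (fun q hq => ?_) hp'
    ((hS p).2 ⟨⟨m, by rw [h1.1]; ring⟩, h1.2⟩), hp'⟩
  obtain ⟨m', hm'⟩ := exists_eq_add_mul_of_dvd ((hS q).1 hq).1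
  exact ⟨m', hm'.ge, by omega, row_eq_of_height_eq hm'⟩

theorem Rep.foremost_class (hn : 4 ≤ n) (hl : 1 ≤ l) (hc : c.Basic n l) (hC : Rep n C c)
    {S : Fin l → Bool} {x : ℤ}
    (hS : ∀ p, S p = true ↔ 2 * cycleLength n ∣ (C p).height - x ∧ ∀ s, (C p).top ≠ .single s)
    (hx : c.a x < c.a (x + 1)) (hQ : cycleLength n ∣ x - 1 → ∀ s, c.a x < c.Q s (x - 1)) :
    ∃ p m, foremostHighest (rows C) S = some p ∧ ((p : ℕ) : ℤ) = c.a x + l * m := by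
  have hT := cycleLength_pos hn
  obtain ⟨p, m, hp⟩ := exists_index hl (c.a x)
  have h1 := hC.first_spec hc hx hQ hp
  refine ⟨p, m, hC.foremostHighest_eq hn hc (hi := x + 1) (κ := x / 2) (by omega)
    (fun q hq => ?_) hp ((hS p).2 ⟨⟨m, by rw [h1.1]; ring⟩, h1.2⟩), hp⟩
  obtain ⟨m', hm'⟩ := exists_eq_add_mul_of_dvd ((hS q).1 hq).1
  exact ⟨m', hm'.ge, by omega, row_eq_of_height_eq hm'⟩

theorem Rep.class_empty (hc : c.Basic n l) (hC : Rep n C c) {x : ℤ} (hx : c.a x = c.a (x + 1))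
    (p : Fin l) : ¬ 2 * cycleLength n ∣ (C p).height - x := by
  intro h
  obtain ⟨m, hm⟩ := exists_eq_add_mul_of_dvd h
  rw [hC.height_eq_iff, show x + 2 * cycleLength n * m + 1 = x + 1 + 2 * cycleLength n * m by ring,
    hc.period.add_mul, hc.period.add_mul] at hm
  omega

/-- Parity of the height already excludes halves and single blocks; the clause on single blocks
gives slots, blocks and halves the common form required by `Rep.rearmost_class` and
`Rep.foremost_class`. -/
theorem topSlot_iff (hn : 4 ≤ n) {j : Whole} (hj : IsWhole n j) (ρ : Role) (x : Layer) :
    topSlot n j ρ x = true ↔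
      2 * cycleLength n ∣ x.height - 2 * baseRow n j ρ ∧ ∀ s, x.top ≠ .single s := by
  rw [topSlot, decide_eq_true_iff, rowBlock_iff hn, ← dvd_two_mul_sub_iff]
  rcases x.height_cases with ⟨h, h'⟩ | ⟨h, h'⟩
  · simp [h, h', hj]
  · simp only [h, false_and, false_iff, h']
    rintro ⟨⟨m, hm⟩, -⟩
    rw [mul_assoc] at hm
    omega

theorem topBlock_iff (hn : 4 ≤ n) {j : Whole} (hj : IsWhole n j) (ρ : Role) (x : Layer) :
    topBlock n j ρ x = true ↔
      2 * cycleLength n ∣ x.height - (2 * baseRow n j ρ + 2) ∧ ∀ s, x.top ≠ .single s := by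
  rw [topBlock, decide_eq_true_iff, rowBlock_iff hn, ← dvd_two_mul_sub_iff]
  rcases x.height_cases with ⟨h, h'⟩ | ⟨h, h'⟩
  · simp [h, h', hj, mul_sub, sub_sub, add_comm]
  · simp only [h, false_and, false_iff, h']
    rintro ⟨⟨m, hm⟩, -⟩
    rw [mul_assoc] at hm
    omega

theorem topHalf_iff (hn : 4 ≤ n) {j : Whole} (hj : IsWhole n j) (ρ : Role) (x : Layer) :
    topHalf n j ρ x = true ↔
      2 * cycleLength n ∣ x.height - (2 * baseRow n j ρ + 1) ∧ ∀ s, x.top ≠ .single s := by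
  rw [topHalf, decide_eq_true_iff, rowBlock_iff hn, ← dvd_two_mul_sub_iff]
  rcases x.height_cases with ⟨h, h'⟩ | ⟨h, h'⟩
  · simp only [h, reduceCtorEq, false_and, false_iff, h']
    rintro ⟨⟨m, hm⟩, -⟩
    rw [mul_assoc] at hm
    omega
  · rw [h', show 2 * x.row + 1 - (2 * baseRow n j ρ + 1) = 2 * x.row - 2 * baseRow n j ρ by ring]
    have : x.top = .half ↔ ∀ s, x.top ≠ .single s := by
      cases hx : x.top <;> simp_all
    rw [this]
    tauto

/-- Reflecting the cycle at a `01`-row exchanges supporting and covering positions. On heights, a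
block on top at height `g` corresponds to a slot of the other role at height `2 - g`. -/
theorem baseRow_swap (n : ℕ) (j : Whole) (ρ : Role) :
    ∃ m, baseRow n j ρ.swap = -baseRow n j ρ + cycleLength n * m := by
  rcases j with _ | i | _
  · exact ⟨0, by simp [baseRow]⟩
  · exact ⟨0, by cases ρ <;> simp [baseRow, Role.swap]⟩
  · exact ⟨1, by simp only [baseRow, cycleLength]; ring⟩

theorem dvd_sub_two_mul_baseRow_swap {j : Whole} {ρ : Role} (x : ℤ) :
    2 * cycleLength n ∣ x - 2 * baseRow n j ρ.swap ↔
      2 * cycleLength n ∣ x - (2 - (2 * baseRow n j ρ + 2)) := by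
  obtain ⟨m, hm⟩ := baseRow_swap n j ρ
  rw [hm, show x - 2 * (-baseRow n j ρ + cycleLength n * m) =
    x - (2 - (2 * baseRow n j ρ + 2)) - 2 * cycleLength n * m by ring]
  exact dvd_sub_left (Dvd.intro _ rfl)

/-! ### Codes of partially split pre-slices and of slices -/

/-- Codes of partially split pre-slices. `symm` counts: there are as many layers of an odd height
`h` as of height `2 - h`, since a splitting creates one half of each role. By `balance`, as many
layers of height `e + 1` precede the interval of single blocks as follow it; they are the upper and
the lower halves. -/
structure Code.IsSemi (n l : ℕ) (c : Code) : Prop extends c.Basic n l where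
  balance : ∀ s e, cycleLength n ∣ e → c.Q s e + c.Q s.swap e = c.a (e + 1) + c.a (e + 2)
  symm : ∀ h, Odd h → c.a h + c.a (3 - h) = c.a (h + 1) + c.a (3 - (h + 1))

/-- `disj` expresses that nothing can be split: layers of height `h` and of height `2 - h` do not
coexist. -/
structure Code.IsSliceCode (n l : ℕ) (c : Code) : Prop extends c.IsSemi n l where
  disj : ∀ h, Even h → c.a h = c.a (h + 1) ∨ c.a (2 - h) = c.a (2 - h + 1)

/-- For `k = 1` this is a splitting, from the first layer of height `g` to the last one of height `2
- g`; for `k = -1` it is the reverse. -/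
def Code.flip (n : ℕ) (c : Code) (g k : ℤ) : Code := (c.bumpA n g k).bumpA n (3 - g) (-k)

/-- The two bumps sit at points exchanged by `h ↦ 3 - h` and have opposite signs. Both axioms of
`Code.IsSemi` concern only such symmetric sums, so they survive. -/
theorem Code.flip_add (g k h : ℤ) : (c.flip n g k).a h + (c.flip n g k).a (3 - h) =
    c.a h + c.a (3 - h) := by
  simp only [flip, bumpA, bump]
  have e1 : 2 * cycleLength n ∣ 3 - h - g ↔ 2 * cycleLength n ∣ h - (3 - g) := by
    rw [dvd_sub_comm, sub_sub_eq_add_sub, sub_sub_eq_add_sub, add_comm]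
  have e2 : 2 * cycleLength n ∣ 3 - h - (3 - g) ↔ 2 * cycleLength n ∣ h - g := by
    rw [dvd_sub_comm, sub_sub_sub_cancel_left]
  simp only [e1, e2]
  split_ifs <;> ring

theorem Code.flip_flip (g k k' : ℤ) : (c.flip n g k).flip n g k' = c.flip n g (k + k') := by
  ext x
  · simp only [flip, bumpA, bump]
    split_ifs <;> ring
  · rfl

theorem Code.flip_zero (g : ℤ) : c.flip n g 0 = c := by
  ext x
  · simp [flip, bumpA, bump]
  · rfl

theorem Code.IsSemi.flip (hc : c.IsSemi n l) {g k : ℤ} (hb : (c.flip n g k).Basic n l) :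
    (c.flip n g k).IsSemi n l where
  toBasic := hb
  balance s e he := by
    obtain ⟨m, hm⟩ := he
    -- Since a cycle divides `e`, the numbers `e + 1` and `e + 2` are exchanged by `h ↦ 3 - h` up to
    -- the period, which makes the right side of `balance` a symmetric sum.
    have h1 : e + 2 = 3 - (e + 1) + 2 * cycleLength n * m := by linarith
    have h2 := hc.balance s e ⟨m, hm⟩
    rw [h1, hc.period.add_mul] at h2
    rw [h1, hb.period.add_mul]
    have h3 := Code.flip_add (c := c) (n := n) g k (e + 1)
    change c.Q s e + c.Q s.swap e = _
    linarith
  symm h hh := by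
    rw [Code.flip_add, Code.flip_add]
    exact hc.symm h hh

theorem not_dvd_of_odd {x : ℤ} (hx : Odd x) : ¬ cycleLength n ∣ x := fun h =>
  (Int.not_even_iff_odd.2 hx) (even_iff_two_dvd.2 ((even_iff_two_dvd.1 (cycleLength_even n)).trans h))

theorem not_two_mul_dvd_of_odd {x : ℤ} (hx : Odd x) : ¬ 2 * cycleLength n ∣ x := fun h =>
  not_dvd_of_odd hx ((Dvd.intro_left _ rfl).trans h)

/-- The period is a multiple of `4`, so residues modulo `4` separate neighbouring heights. -/
theorem not_two_mul_dvd_of_emod {x : ℤ} (hx : x % 4 ≠ 0) : ¬ 2 * cycleLength n ∣ x := by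
  rintro ⟨m, hm⟩
  obtain ⟨y, hy⟩ := cycleLength_even n
  rw [hy, show 2 * (y + y) * m = 4 * (y * m) by ring] at hm
  omega

/-- Moving a half from the first layer of height `g` to the last layer of height `2 - g`. -/
theorem Rep.flip_one (hn : 4 ≤ n) (hc : c.Basic n l) (hC : Rep n C c) {g : ℤ} (hg : Even g)
    (h1 : c.a g < c.a (g + 1)) (h2 : c.a (2 - g) < c.a (2 - g + 1)) {p q : Fin l} {m m' : ℤ}
    (hp : ((p : ℕ) : ℤ) = c.a g + l * m) (hq : ((q : ℕ) : ℤ) = c.a (2 - g + 1) + l * m' - 1) :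
    Rep n (putHalfAt (takeHalfAt C p) q) (c.flip n g 1) ∧
      (c.flip n g 1).Basic n l := by
  have v1 : cycleLength n ∣ g - 1 → ∀ s, c.a g < c.Q s (g - 1) :=
    fun h => (not_dvd_of_odd (hg.sub_odd odd_one) h).elim
  have r1 := hC.take_half hn hc h1 v1 hp
  have b1 := hc.raiseA h1 v1
  have e0 : 2 - g + 1 = 3 - g := by ring
  have e1 : (c.bumpA n g 1).a (3 - g) = c.a (3 - g) := bump_of_not_dvd
    (not_two_mul_dvd_of_odd (by rw [sub_sub]; exact Odd.sub_even (by decide) (hg.add hg)))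
  have e2 : (c.bumpA n g 1).a (2 - g) = c.a (2 - g) := bump_of_not_dvd
    (not_two_mul_dvd_of_emod (by obtain ⟨y, hy⟩ := hg; omega))
  rw [e0] at h2 hq
  have v2 : cycleLength n ∣ 3 - g - 2 → ∀ s, (c.bumpA n g 1).Q s (3 - g - 2) <
      (c.bumpA n g 1).a (3 - g) := fun h => (not_dvd_of_odd (by
    rw [show 3 - g - 2 = 1 - g by ring]; exact odd_one.sub_even hg) h).elim
  have h3 : (c.bumpA n g 1).a (3 - g - 1) < (c.bumpA n g 1).a (3 - g) := by
    rw [e1, show 3 - g - 1 = 2 - g by ring, e2]; exact h2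
  exact ⟨r1.put_half hn b1 h3 v2 (by rw [e1]; exact hq), b1.lowerA h3 v2⟩

theorem topBlock_isWhole (hn : 4 ≤ n) {j : Whole} {ρ : Role} {x : Layer}
    (h : topBlock n j ρ x = true) : IsWhole n j := by
  rw [topBlock, decide_eq_true_iff] at h
  exact h.2.1 ▸ isWhole_rowBlock hn _

theorem split_of_not_isWhole (hn : 4 ≤ n) {j : Whole} (hj : ¬ IsWhole n j) (ρ : Role) :
    split n j ρ C = none := by
  rw [split, foremostHighest_eq_none]
  exact fun p => Bool.eq_false_iff.2 fun h => hj (topBlock_isWhole hn h)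

theorem Rep.split_eq_some (hn : 4 ≤ n) (hl : 1 ≤ l) (hc : c.Basic n l) (hC : Rep n C c) {j : Whole}
    (hj : IsWhole n j) {ρ : Role} {g : ℤ} (hg : g = 2 * baseRow n j ρ + 2)
    (h1 : c.a g < c.a (g + 1)) (h2 : c.a (2 - g) < c.a (2 - g + 1)) :
    ∃ Y, split n j ρ C = some Y ∧ Rep n Y (c.flip n g 1) ∧ (c.flip n g 1).Basic n l := by
  have hge : Even g := hg ▸ (even_two_mul _).add even_two
  obtain ⟨p, m, h3, h4⟩ := hC.foremost_class hn hl hc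
    (S := fun p => topBlock n j ρ (C p)) (x := g)
    (fun p => by rw [topBlock_iff hn hj, hg]) h1
    fun h => (not_dvd_of_odd (hge.sub_odd odd_one) h).elim
  obtain ⟨q, m', h5, h6⟩ := hC.rearmost_class hn hl hc
    (S := fun p => topSlot n j ρ.swap (C p)) (x := 2 - g)
    (fun p => by rw [topSlot_iff hn hj, dvd_sub_two_mul_baseRow_swap, hg]) h2
    fun h => (not_dvd_of_odd ((even_two.sub hge).sub_odd odd_one) h).elim
  exact ⟨_, by rw [split, h3, h5], hC.flip_one hn hc hge h1 h2 h4 h6⟩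

theorem Rep.split_eq_none (hn : 4 ≤ n) (hc : c.Basic n l) (hC : Rep n C c) {j : Whole}
    (hj : IsWhole n j) {ρ : Role} {g : ℤ} (hg : g = 2 * baseRow n j ρ + 2)
    (h : c.a g = c.a (g + 1) ∨ c.a (2 - g) = c.a (2 - g + 1)) : split n j ρ C = none := by
  rcases h with h | h
  · rw [split, foremostHighest_eq_none]
    refine fun p => Bool.eq_false_iff.2 fun h' => hC.class_empty hc h p ?_
    rw [topBlock_iff hn hj, ← hg] at h'
    exact h'.1
  · rw [split, rearmostLowest_eq_none]
    · rcases foremostHighest (rows C) _ <;> rfl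
    refine fun p => Bool.eq_false_iff.2 fun h' => hC.class_empty hc h p ?_
    rw [topSlot_iff hn hj, dvd_sub_two_mul_baseRow_swap, ← hg] at h'
    exact h'.1

/-- Every even height is the height of a slot; this trades the condition for all `j` and `ρ` for a
condition on all even heights. -/
theorem exists_baseRow (hn : 4 ≤ n) {h : ℤ} (hh : Even h) :
    ∃ j ρ m, IsWhole n j ∧ 2 * baseRow n j ρ = h + 2 * cycleLength n * m := by
  obtain ⟨r, hr⟩ := hh
  have key : ∀ ρ, HasRole n r ρ → ∃ j ρ m, IsWhole n j ∧
      2 * baseRow n j ρ = h + 2 * cycleLength n * m := by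
    intro ρ hρ
    obtain ⟨hw, m, hm⟩ := (rowBlock_iff hn r _ ρ).1 ⟨rfl, hρ⟩
    exact ⟨_, ρ, -m, hw, by rw [hr]; linarith⟩
  rcases hasRole_or (n := n) r with h | h
  · exact key _ h
  · exact key _ h

theorem Code.Basic.step_iff (hc : c.Basic n l) (h m : ℤ) :
    c.a (h + 2 * cycleLength n * m) = c.a (h + 2 * cycleLength n * m + 1) ↔ c.a h = c.a (h + 1) := by
  rw [show h + 2 * cycleLength n * m + 1 = h + 1 + 2 * cycleLength n * m by ring,
    hc.period.add_mul, hc.period.add_mul]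
  omega

theorem Rep.forall_split_eq_none_iff (hn : 4 ≤ n) (hl : 1 ≤ l) (hc : c.Basic n l) (hC : Rep n C c) :
    (∀ j ρ, split n j ρ C = none) ↔
      ∀ h, Even h → c.a h = c.a (h + 1) ∨ c.a (2 - h) = c.a (2 - h + 1) := by
  constructor
  · intro H h hh
    obtain ⟨j, ρ, m, hj, hm⟩ := exists_baseRow hn (hh.sub even_two)
    by_contra! hcon
    have h1 := hc.step_iff h m
    have h2 := hc.step_iff (2 - h) (-m)
    rw [show h + 2 * cycleLength n * m = 2 * baseRow n j ρ + 2 by linarith] at h1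
    rw [show 2 - h + 2 * cycleLength n * -m = 2 - (2 * baseRow n j ρ + 2) by linarith] at h2
    obtain ⟨Y, hY, -⟩ := hC.split_eq_some hn hl hc hj (ρ := ρ) rfl
      (lt_of_le_of_ne (hc.mono _) (mt h1.1 hcon.1)) (lt_of_le_of_ne (hc.mono _) (mt h2.1 hcon.2))
    rw [H] at hY
    exact absurd hY (by simp)
  · intro H j ρ
    by_cases hj : IsWhole n j
    · exact hC.split_eq_none hn hc hj rfl (H _ ((even_two_mul _).add even_two))
    · exact split_of_not_isWhole hn hj ρ

theorem Rep.exists_of_split (hn : 4 ≤ n) (hl : 1 ≤ l) (hc : c.IsSemi n l) (hC : Rep n C c)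
    {j : Whole} {ρ : Role} {Y : Layers l} (hY : split n j ρ C = some Y) :
    ∃ c' : Code, c'.IsSemi n l ∧ Rep n Y c' := by
  by_cases hj : IsWhole n j
  · by_cases h : c.a (2 * baseRow n j ρ + 2) = c.a (2 * baseRow n j ρ + 2 + 1) ∨
      c.a (2 - (2 * baseRow n j ρ + 2)) = c.a (2 - (2 * baseRow n j ρ + 2) + 1)
    · rw [hC.split_eq_none hn hc.toBasic hj rfl h] at hY
      exact absurd hY (by simp)
    · push Not at h
      obtain ⟨Y', h1, h2, h3⟩ := hC.split_eq_some hn hl hc.toBasic hj (ρ := ρ) rfl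
        (lt_of_le_of_ne (hc.mono _) h.1) (lt_of_le_of_ne (hc.mono _) h.2)
      rw [hY, Option.some_inj] at h1
      exact ⟨_, hc.flip h3, h1 ▸ h2⟩
  · rw [split_of_not_isWhole hn hj] at hY
    exact absurd hY (by simp)

end

end YoungWall

namespace YoungWall

section
variable {n l : ℕ} {C : Layers l} {c : Code}

/-! ### Codes of pre-slices -/

theorem Layer.blocks_subset_iff {x y : Layer} (hx : x.top ≠ .half) :
    x.blocks ⊆ y.blocks ↔ x.row < y.row ∨ (x.row = y.row ∧ (x.top = .flat ∨ x.top = y.top)) := by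
  constructor
  · intro h
    have h1 : x.row ≤ y.row := by
      by_contra! hlt
      -- At most one of the two places in the top row of `y` is filled, so the other one witnesses
      -- that `x` is not contained in `y`.
      have : ∃ s, y.top ≠ .single s := by
        by_cases hy : y.top = .single .front
        · exact ⟨.back, by simp [hy]⟩
        · exact ⟨.front, hy⟩
      obtain ⟨s, hs⟩ := this
      have := @h (y.row, s) (.inl hlt)
      simp [blocks, hs] at this
    rcases h1.lt_or_eq with h1 | h1
    · exact .inl h1
    · refine .inr ⟨h1, ?_⟩
      rcases hxt : x.top with _ | s | _
      · exact .inl rfl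
      · have := @h (x.row, s) (.inr ⟨rfl, hxt⟩)
        simp only [blocks, Set.mem_ofPred_eq, h1, lt_irrefl, true_and, false_or] at this
        exact .inr this.symm
      · exact absurd hxt hx
  · rintro h ⟨r, s⟩ hr
    simp only [blocks, Set.mem_ofPred_eq] at hr ⊢
    rcases h with h | ⟨h, h' | h'⟩
    · left; rcases hr with hr | hr <;> omega
    · rcases hr with hr | hr
      · left; omega
      · simp [h'] at hr
    · rcases hr with hr | hr
      · left; omega
      · right; exact ⟨by omega, h' ▸ hr.2⟩

/-- Without halves, inclusion can differ from comparison of heights only for two single blocks in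
the same row on opposite sides. -/
theorem Layer.blocks_subset_iff_height {x y : Layer} (hx : x.top ≠ .half) (hy : y.top ≠ .half) :
    x.blocks ⊆ y.blocks ↔ x.height ≤ y.height ∧
      ∀ s s', x.top = .single s → y.top = .single s' → x.height = y.height → s = s' := by
  rw [blocks_subset_iff hx]
  rcases x with ⟨r, t⟩
  rcases y with ⟨r', t'⟩
  cases t <;> cases t' <;> simp [Layer.height] at hx hy ⊢ <;> try omega
  rename_i s s'
  by_cases h : s = s'
  · simp only [h, and_true, implies_true]; omega
  · simp only [h, and_false, or_false, imp_false]; omega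

theorem IsLevelOne.top_ne_half {x : Layer} (hx : IsLevelOne n x) : x.top ≠ .half := by
  rcases hx with h | ⟨s, h, -⟩ <;> simp [h]

theorem Layer.height_addDelta (x : Layer) :
    (x.addDelta n).height = x.height + 2 * cycleLength n := by
  rcases x with ⟨r, t⟩
  cases t <;> simp [Layer.height, Layer.addDelta, cycleLength] <;> ring

theorem isPreSlice_iff : IsPreSlice n C ↔ (∀ p, IsLevelOne n (C p)) ∧
    (∀ p q, p ≤ q → (C p).height ≤ (C q).height) ∧
    (∀ p q, (C q).height ≤ (C p).height + 2 * cycleLength n) ∧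
    ∀ p q s s', p ≤ q → (C p).top = .single s → (C q).top = .single s' →
      (C q).height = (C p).height ∨ (C q).height = (C p).height + 2 * cycleLength n → s = s' := by
  rw [IsPreSlice]
  refine and_congr_right fun h1 => ?_
  have hh := fun p => (h1 p).top_ne_half
  have hd : ∀ p, ((C p).addDelta n).top = (C p).top := fun p => rfl
  have e1 : ∀ p q, (C p).blocks ⊆ (C q).blocks ↔ _ :=
    fun p q => Layer.blocks_subset_iff_height (hh p) (hh q)
  have e2 : ∀ p q, (C q).blocks ⊆ ((C p).addDelta n).blocks ↔ _ :=
    fun p q => Layer.blocks_subset_iff_height (hh q) (y := (C p).addDelta n) (hh p)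
  simp only [e1, e2, hd, Layer.height_addDelta]
  constructor
  · rintro ⟨h2, h3⟩
    refine ⟨fun p q hpq => (h2 p q hpq).1, fun p q => (h3 p q).1, ?_⟩
    rintro p q s s' hpq hs hs' (h | h)
    · exact (h2 p q hpq).2 s s' hs hs' h.symm
    · exact ((h3 p q).2 s' s hs' hs h).symm
  · rintro ⟨h2, h3, h4⟩
    refine ⟨fun p q hpq => ⟨h2 p q hpq, fun s s' hs hs' h => h4 p q s s' hpq hs hs' (.inl h.symm)⟩,
      fun p q => ⟨h3 p q, fun s s' hs hs' h => ?_⟩⟩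
    rcases le_total p q with hpq | hpq
    · exact (h4 p q s' s hpq hs' hs (.inr h)).symm
    -- In this order the equality of heights forces the period to be zero, which is not excluded
    -- here as `n` is arbitrary; then the two heights agree.
    · exact h4 q p s s' hpq hs hs' (by
        have := h2 q p hpq
        have := h3 q p
        have := h3 p p
        left; omega)

/-- The index of the first layer of height at least `h`. -/
def firstIndex (n : ℕ) {l : ℕ} (C : Layers l) (h : ℤ) : ℤ :=
  ∑ p, -(((C p).height - h) / (2 * cycleLength n))

/-- The summand of the layer `q` is `⌈(h - height) / period⌉`, the signed number of its translates
on the relevant side of `h`. As all heights lie within one period of each other, the sum compares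
with the number of `q ≤ p`, respectively of `q < p`. -/
theorem firstIndex_le_iff (hn : 4 ≤ n) (h1 : ∀ p q, p ≤ q → (C p).height ≤ (C q).height)
    (h2 : ∀ p q, (C q).height ≤ (C p).height + 2 * cycleLength n) (p : Fin l) (h : ℤ) :
    firstIndex n C h ≤ (p : ℕ) ↔ h ≤ (C p).height := by
  have hT : 0 < 2 * cycleLength n := by have := cycleLength_pos hn; omega
  constructor
  · contrapose!
    intro hlt
    have : ∑ q : Fin l, (if q ≤ p then (1 : ℤ) else 0) ≤ firstIndex n C h := by
      refine Finset.sum_le_sum fun q _ => ?_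
      split_ifs with hq
      · have := h1 q p hq
        have : ((C q).height - h) / (2 * cycleLength n) < 0 := Int.ediv_neg_of_neg_of_pos (by omega) hT
        omega
      · have := h2 p q
        have : ((C q).height - h) / (2 * cycleLength n) < 1 :=
          Int.ediv_lt_of_lt_mul hT (by omega)
        omega
    rw [Finset.sum_boole] at this
    have h3 : (Finset.univ.filter fun q : Fin l => q ≤ p).card = (p : ℕ) + 1 := by
      rw [← Fin.card_Iic p]; congr 1; ext; simp
    rw [h3] at this
    push_cast at this
    omega
  · intro hle
    have : firstIndex n C h ≤ ∑ q : Fin l, (if q < p then (1 : ℤ) else 0) := by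
      refine Finset.sum_le_sum fun q _ => ?_
      split_ifs with hq
      · have := h2 q p
        have : -1 ≤ ((C q).height - h) / (2 * cycleLength n) :=
          (Int.le_ediv_iff_mul_le hT).2 (by omega)
        omega
      · have := h1 p q (not_lt.1 hq)
        have : 0 ≤ ((C q).height - h) / (2 * cycleLength n) := Int.ediv_nonneg (by omega) hT.le
        omega
    rw [Finset.sum_boole] at this
    have h3 : (Finset.univ.filter fun q : Fin l => q < p).card = (p : ℕ) := by
      rw [← Fin.card_Iio p]; congr 1; ext; simp
    rwa [h3] at this

theorem firstIndex_mono (hn : 4 ≤ n) {h h' : ℤ} (hh : h ≤ h') :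
    firstIndex n C h ≤ firstIndex n C h' := by
  have hT : 0 < 2 * cycleLength n := by have := cycleLength_pos hn; omega
  exact Finset.sum_le_sum fun q _ => neg_le_neg (Int.ediv_le_ediv hT (by omega))

theorem firstIndex_period (hn : 4 ≤ n) : QuasiPeriodic n l (firstIndex n C) := by
  have hT : 0 < 2 * cycleLength n := by have := cycleLength_pos hn; omega
  intro h
  have : ∀ p, -(((C p).height - (h + 2 * cycleLength n)) / (2 * cycleLength n)) =
      -(((C p).height - h) / (2 * cycleLength n)) + 1 := fun p => by
    rw [← sub_sub, Int.sub_ediv_of_dvd _ (dvd_refl _), Int.ediv_self hT.ne']; ring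
  simp only [firstIndex, this, Finset.sum_add_distrib]
  simp

open Classical in
/-- The code of a pre-slice. -/
noncomputable def preCode (n : ℕ) {l : ℕ} (C : Layers l) : Code where
  a := firstIndex n C
  Q s e := if ∃ p, 2 * cycleLength n ∣ (C p).height - (e + 1) ∧ (C p).top = .single s.swap then
    firstIndex n C (e + 2) else firstIndex n C (e + 1)

theorem Side.swap_swap (s : Side) : s.swap.swap = s := by cases s <;> rfl

theorem Side.eq_swap_of_ne {s t : Side} (h : s ≠ t) : s = t.swap := by
  cases s <;> cases t <;> simp_all [Side.swap]

theorem Side.swap_ne (s : Side) : s.swap ≠ s := by cases s <;> simp [Side.swap]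

theorem IsLevelOne.end_of_single (hn : 4 ≤ n) {x : Layer} (hx : IsLevelOne n x) {s : Side}
    (hs : x.top = .single s) : cycleLength n ∣ x.height - 1 := by
  rcases hx with h | ⟨s', -, h⟩
  · simp [h] at hs
  · rw [rowBlock_end_iff hn] at h
    rwa [Layer.height_of_ne_flat (by simp [hs]), add_sub_cancel_right]

/-- In a pre-slice all single blocks of one height class are on the same side, because the layers
and the translate by `δ` form a chain. They are also the only tops of odd height, so odd classes
away from the rows of half-unit depth blocks are empty. -/
theorem IsPreSlice.isSemi_preCode (hn : 4 ≤ n) (hC : IsPreSlice n C) :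
    (preCode n C).IsSemi n l ∧ Rep n C (preCode n C) := by
  obtain ⟨h0, h1, h2, h3⟩ := isPreSlice_iff.1 hC
  have hT := cycleLength_pos hn
  have hle := firstIndex_le_iff hn h1 h2
  have hside : ∀ p q s s', (C p).top = .single s → (C q).top = .single s' →
      2 * cycleLength n ∣ (C q).height - (C p).height → s = s' := by
    have key : ∀ p q s s', p ≤ q → (C p).top = .single s → (C q).top = .single s' →
        2 * cycleLength n ∣ (C q).height - (C p).height → s = s' := by
      intro p q s s' hpq hs hs' hd
      have := h1 p q hpq
      have := h2 p q
      refine h3 p q s s' hpq hs hs' ?_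
      by_cases h : (C q).height = (C p).height
      · exact .inl h
      · have := Int.le_of_dvd (by omega) hd
        right; omega
    intro p q s s' hs hs' hd
    rcases le_total p q with h | h
    · exact key p q s s' h hs hs' hd
    · exact (key q p s' s h hs' hs (dvd_sub_comm.1 hd)).symm
  have hflat : ∀ h, Odd h → (∀ p s, 2 * cycleLength n ∣ (C p).height - h → (C p).top ≠ .single s) →
      ∀ p, (C p).height ≠ h := by
    intro h hh hp p hH
    have h5 : ∀ s, (C p).top ≠ .single s := fun s => hp p s (by simp [hH])
    have h6 := (C p).height_cases
    have h7 := (h0 p).top_ne_half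
    rcases hx : (C p).top with _ | s | _
    · obtain ⟨y, hy⟩ := hh
      simp [hx] at h6
      omega
    · exact h5 s hx
    · exact h7 hx
  have hstep : ∀ h, Odd h → (∀ p s, 2 * cycleLength n ∣ (C p).height - h → (C p).top ≠ .single s) →
      firstIndex n C h = firstIndex n C (h + 1) := by
    intro h hh hp
    rcases (firstIndex_mono hn (C := C) (show h ≤ h + 1 by omega)).lt_or_eq with hlt | heq
    · exfalso
      have hl : 1 ≤ l := by
        by_contra! hl
        obtain rfl : l = 0 := by omega
        simp [firstIndex] at hlt
      obtain ⟨p, m, hpm⟩ := exists_index hl (firstIndex n C h)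
      refine hflat (h + 2 * cycleLength n * m)
        (hh.add_even ((even_two_mul (cycleLength n)).mul_right m))
        (fun q s hq => hp q s ?_) p ?_
      · rw [← sub_sub] at hq
        exact (dvd_sub_left (Dvd.intro _ rfl)).1 hq
      · have e1 := (firstIndex_period (C := C) hn).add_mul h m
        have e2 := (firstIndex_period (C := C) hn).add_mul (h + 1) m
        have e3 := hle p (h + 2 * cycleLength n * m)
        have e4 := hle p (h + 1 + 2 * cycleLength n * m)
        omega
    · exact heq
  have hrep : Rep n C (preCode n C) := by
    refine ⟨hle, fun p s => ?_⟩
    simp only [preCode, Side.swap_swap, sub_add_cancel]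
    constructor
    · intro hs
      refine ⟨(h0 p).end_of_single hn hs, ?_, ?_⟩
      · rw [if_neg, hle]
        rintro ⟨q, hq, hqs⟩
        exact Side.swap_ne s (hside p q _ _ hs hqs hq).symm
      · rw [if_pos ⟨p, by simp, hs⟩, ← not_le, hle]; omega
    · rintro ⟨hd, hs1, hs2⟩
      rcases hx : (C p).top with _ | t | _
      · exfalso
        rw [Layer.height_of_flat hx] at hd
        exact not_dvd_of_odd ⟨(C p).row - 1, by ring⟩ hd
      · by_cases hst : t = s
        · rw [hst]
        · obtain rfl := Side.eq_swap_of_ne hst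
          exfalso
          rw [if_pos ⟨p, by simp, hx⟩, hle] at hs1
          omega
      · exact absurd hx (h0 p).top_ne_half
  refine ⟨?_, hrep⟩
  have hex : ∀ s e, (∃ p, 2 * cycleLength n ∣ (C p).height - (e + 2 * cycleLength n + 1) ∧
      (C p).top = .single s) ↔ ∃ p, 2 * cycleLength n ∣ (C p).height - (e + 1) ∧
      (C p).top = .single s := by
    intro s e
    refine exists_congr fun p => and_congr_left fun _ => ?_
    rw [show (C p).height - (e + 2 * cycleLength n + 1) =
      (C p).height - (e + 1) - 2 * cycleLength n by ring]
    exact dvd_sub_left (dvd_refl _)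
  refine ⟨⟨fun h => firstIndex_mono hn (by omega), firstIndex_period hn, fun s e => ?_,
    fun s e he => ?_, fun s e he => ?_⟩, fun s e he => ?_, fun h hh => ?_⟩
  · simp only [preCode, hex]
    rw [show e + 2 * cycleLength n + 2 = e + 2 + 2 * cycleLength n by ring,
      show e + 2 * cycleLength n + 1 = e + 1 + 2 * cycleLength n by ring,
      firstIndex_period hn, firstIndex_period hn]
    split_ifs <;> rfl
  · have := firstIndex_mono hn (C := C) (show e + 1 ≤ e + 2 by omega)
    simp only [preCode]; split_ifs <;> omega
  · have := firstIndex_mono hn (C := C) (show e + 1 ≤ e + 2 by omega)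
    simp only [preCode]; split_ifs <;> omega
  · simp only [preCode, Side.swap_swap]
    split_ifs with ha hb hb
    · obtain ⟨p, hp1, hp2⟩ := ha
      obtain ⟨q, hq1, hq2⟩ := hb
      exact absurd (hside p q _ _ hp2 hq2 (by simpa using dvd_sub hq1 hp1)) (Side.swap_ne s)
    · ring
    · ring
    · rw [hstep (e + 1)]
      · ring_nf
      · obtain ⟨y, hy⟩ := cycleLength_even n
        obtain ⟨m, rfl⟩ := he
        exact ⟨y * m, by rw [hy]; ring⟩
      · intro p t hd ht
        by_cases hts : t = s
        · exact hb ⟨p, hd, hts ▸ ht⟩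
        · exact ha ⟨p, hd, Side.eq_swap_of_ne hts ▸ ht⟩
  · simp only [preCode]
    -- In a row of half-unit depth blocks `3 - h` is `h + 1` up to the period, and the symmetry
    -- holds trivially; elsewhere both classes are empty.
    by_cases hd : cycleLength n ∣ h - 1
    · obtain ⟨m, hm⟩ := hd
      have e1 := (firstIndex_period (C := C) hn).add_mul (3 - h) m
      have e2 := (firstIndex_period (C := C) hn).add_mul (3 - (h + 1)) m
      rw [show 3 - h + 2 * cycleLength n * m = h + 1 by linarith] at e1
      rw [show 3 - (h + 1) + 2 * cycleLength n * m = h by linarith] at e2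
      omega
    · have hns : ∀ p s, (C p).top = .single s → cycleLength n ∣ (C p).height - 1 :=
        fun p s hs => (h0 p).end_of_single hn hs
      rw [hstep h hh]
      · rw [show 3 - h = 3 - (h + 1) + 1 by ring, ← hstep (3 - (h + 1))]
        · obtain ⟨y, rfl⟩ := hh
          exact ⟨-y, by ring⟩
        · intro p s hp hs
          refine hd ?_
          have := dvd_sub (hns p s hs) ((Dvd.intro_left _ rfl).trans hp)
          rw [show (C p).height - 1 - ((C p).height - (3 - (h + 1))) = -(h - 1) by ring] at this
          exact (dvd_neg).1 this
      · intro p s hp hs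
        refine hd ?_
        have := dvd_sub (hns p s hs) ((Dvd.intro_left _ rfl).trans hp)
        rw [show (C p).height - 1 - ((C p).height - h) = h - 1 by ring] at this
        exact this

theorem Rep.height_mono (hC : Rep n C c) {p q : Fin l} (hpq : p ≤ q) :
    (C p).height ≤ (C q).height := by
  rw [← hC.le_iff]
  have := (hC.le_iff p _).2 le_rfl
  have h : (p : ℕ) ≤ q := hpq
  omega

theorem Rep.height_le_add (hc : c.Basic n l) (hC : Rep n C c) (p q : Fin l) :
    (C q).height ≤ (C p).height + 2 * cycleLength n := by
  have h1 := (hC.le_iff q _).2 le_rfl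
  have h2 := hc.period ((C q).height - 2 * cycleLength n)
  rw [sub_add_cancel] at h2
  have h3 := (hC.le_iff p ((C q).height - 2 * cycleLength n)).1 (by have := q.isLt; omega)
  omega

theorem Rep.isPreSlice (hn : 4 ≤ n) (hc : c.Basic n l) (hC : Rep n C c)
    (hh : ∀ p, (C p).top ≠ .half) : IsPreSlice n C := by
  refine isPreSlice_iff.2 ⟨fun p => ?_, fun p q => hC.height_mono, hC.height_le_add hc, ?_⟩
  · rcases hx : (C p).top with _ | s | _
    · exact .inl hx
    · refine .inr ⟨s, hx, ?_⟩
      rw [rowBlock_end_iff hn]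
      have := ((hC.single_iff p s).1 hx).1
      rwa [Layer.height_of_ne_flat (by simp [hx]), add_sub_cancel_right] at this
    · exact absurd hx (hh p)
  · intro p q s s' hpq hs hs' hH
    by_contra hne
    obtain rfl := Side.eq_swap_of_ne (Ne.symm hne)
    obtain ⟨h1, h2, h3⟩ := (hC.single_iff p s).1 hs
    obtain ⟨h4, h5, h6⟩ := (hC.single_iff q _).1 hs'
    have h7 : (p : ℕ) ≤ q := hpq
    rw [Side.swap_swap] at h6
    rcases hH with hH | hH <;> rw [hH] at h5 h6
    · omega
    · rw [add_sub_right_comm, hc.periodQ] at h5 h6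
      omega

end

end YoungWall

namespace YoungWall

section
variable {n l : ℕ} {C : Layers l} {c : Code}

/-! ### Reversing a splitting -/

theorem le_bump (f : ℤ → ℤ) (g : ℤ) {k : ℤ} (hk : 0 ≤ k) (x : ℤ) : f x ≤ bump n f g k x := by
  unfold bump; split_ifs <;> omega

theorem bump_le (f : ℤ → ℤ) (g : ℤ) {k : ℤ} (hk : k ≤ 0) (x : ℤ) : bump n f g k x ≤ f x := by
  unfold bump; split_ifs <;> omega

/-- By `balance` the interval of single blocks is centred in its height class, so a gap at the upper
end entails one at the lower end. -/
theorem Code.IsSemi.balance_add_mul (hc : c.IsSemi n l) {s : Side} {e : ℤ}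
    (he : cycleLength n ∣ e) (hQ : ∀ s, c.Q s e < c.a (e + 2)) :
    c.a (e + 1) < c.Q s e := by
  have := hc.balance s e he
  have := hQ s.swap
  omega

/-- The counterpart of the last half at height `g - 1` is the first layer of height `3 - g`, which
exists by `symm`. Moving that half back undoes a splitting. -/
theorem Rep.flip_neg (hn : 4 ≤ n) (hc : c.IsSemi n l) (hC : Rep n C c) {g : ℤ} (hg : Even g)
    (h1 : c.a (g - 1) < c.a g) (hQ : cycleLength n ∣ g - 2 → ∀ s, c.Q s (g - 2) < c.a g)
    {p q : Fin l} {m m' : ℤ}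
    (hp : ((p : ℕ) : ℤ) = c.a (3 - g) + l * m) (hq : ((q : ℕ) : ℤ) = c.a g + l * m' - 1) :
    Rep n (putHalfAt (takeHalfAt C p) q) (c.flip n g (-1)) ∧
      (c.flip n g (-1)).IsSemi n l := by
  have hQ' : cycleLength n ∣ g - 2 → ∀ s, c.a (g - 1) < c.Q s (g - 2) := fun hd s => by
    have := hc.balance_add_mul (s := s) hd (by rw [sub_add_cancel]; exact hQ hd)
    rwa [show g - 2 + 1 = g - 1 by ring] at this
  have h2 : c.a (3 - g) < c.a (3 - g + 1) := by
    have := hc.symm (g - 1) (hg.sub_odd odd_one)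
    rw [sub_add_cancel, show 3 - (g - 1) = 3 - g + 1 by ring] at this
    omega
  have v1 : cycleLength n ∣ 3 - g - 1 → ∀ s, c.a (3 - g) < c.Q s (3 - g - 1) := by
    rintro hd s
    have hd' : cycleLength n ∣ g - 2 := by
      rw [show g - 2 = -(3 - g - 1) by ring]; exact hd.neg_right
    have h3 := hQ' hd' s
    obtain ⟨m, hm⟩ := hd
    rw [show 3 - g = g - 1 + 2 * cycleLength n * m by linarith, hc.period.add_mul]
    rw [show g - 1 + 2 * cycleLength n * m - 1 = g - 2 + 2 * cycleLength n * m by ring,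
      (hc.periodQ s).add_mul]
    omega
  have r1 := hC.take_half hn hc.toBasic h2 v1 hp
  have b1 := hc.raiseA h2 v1
  have e1 : (c.bumpA n (3 - g) 1).a g = c.a g := bump_of_not_dvd
    (not_two_mul_dvd_of_odd (by
      rw [show g - (3 - g) = g + g - 3 by ring]; exact (hg.add hg).sub_odd (by decide)))
  have v2 : cycleLength n ∣ g - 2 → ∀ s, (c.bumpA n (3 - g) 1).Q s (g - 2) <
      (c.bumpA n (3 - g) 1).a g := by rw [e1]; exact hQ
  have h3 : (c.bumpA n (3 - g) 1).a (g - 1) < (c.bumpA n (3 - g) 1).a g := by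
    rw [e1]
    simp only [Code.bumpA, bump]
    split_ifs with hd
    -- Here both halves belong to the same height class; a value of `Q` strictly between `a (g - 1)`
    -- and `a g` shows that this class has at least two layers.
    · have hd' : cycleLength n ∣ g - 2 := by
        rw [show g - 1 - (3 - g) = 2 * (g - 2) by ring] at hd
        exact (mul_dvd_mul_iff_left two_ne_zero).1 hd
      have := hQ hd' .front
      have := hQ' hd' .front
      omega
    · omega
  have hcomm : (c.bumpA n (3 - g) 1).bumpA n g (-1) = c.flip n g (-1) := by
    ext x
    · simp only [Code.flip, Code.bumpA, bump]; split_ifs <;> ring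
    · rfl
  have b2 := b1.lowerA h3 v2
  have r2 := r1.put_half hn b1 h3 v2 (by rw [e1]; exact hq)
  rw [hcomm] at b2 r2
  exact ⟨r2, hc.flip b2⟩

/-- If the last layer of the class carried a single block, then by `balance` so would the first one,
and single blocks would fill the class, leaving no room for a half. -/
theorem Rep.half_spec (hc : c.IsSemi n l) (hC : Rep n C c) {p : Fin l} (hp : (C p).top = .half)
    {g m : ℤ} (hH : (C p).height = g - 1 + 2 * cycleLength n * m) :
    c.a (g - 1) < c.a g ∧ (cycleLength n ∣ g - 2 → ∀ s, c.Q s (g - 2) < c.a g) := by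
  have h1 := (hC.height_eq_iff p _).1 hH
  rw [show g - 1 + 2 * cycleLength n * m + 1 = g + 2 * cycleLength n * m by ring,
    hc.period.add_mul, hc.period.add_mul] at h1
  refine ⟨by omega, fun hd s => ?_⟩
  by_contra! hcon
  have h2 := hc.balance s _ hd
  rw [show g - 2 + 1 = g - 1 by ring, sub_add_cancel] at h2
  have h3 := hC.single_iff p s.swap
  rw [hp, hH, show g - 1 + 2 * cycleLength n * m - 1 = g - 2 + 2 * cycleLength n * m by ring,
    (hc.periodQ _).add_mul, (hc.periodQ _).add_mul, Side.swap_swap] at h3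
  simp only [reduceCtorEq, false_iff] at h3
  refine h3 ⟨dvd_add hd ⟨2 * m, by ring⟩, ?_, ?_⟩ <;> omega

/-- The half at hand only identifies a height class; the halves actually rejoined are the extreme
ones of that class and of its reflection, so that splitting the result returns exactly `C`. -/
theorem Rep.exists_unsplit (hn : 4 ≤ n) (hc : c.IsSemi n l) (hC : Rep n C c)
    {p : Fin l} (hp : (C p).top = .half) :
    ∃ (C' : Layers l) (c' : Code) (j : Whole) (ρ : Role), c'.IsSemi n l ∧ Rep n C' c' ∧
      split n j ρ C' = some C ∧
      (Finset.univ.filter fun q => (C' q).top = .half).card <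
        (Finset.univ.filter fun q => (C q).top = .half).card := by
  have hl : 1 ≤ l := by have := p.isLt; omega
  have hH : (C p).height = 2 * (C p).row + 1 := Layer.height_of_ne_flat (by simp [hp])
  obtain ⟨j, ρ, m, hj, hm⟩ := exists_baseRow hn (h := 2 * (C p).row) (even_two_mul _)
  set g := 2 * baseRow n j ρ + 2 with hg
  have hge : Even g := (even_two_mul _).add even_two
  obtain ⟨h1, h2⟩ := hC.half_spec hc hp (g := g) (m := -m) (by rw [hH]; linarith)
  obtain ⟨x, k, hx⟩ := exists_index hl (c.a (3 - g))
  obtain ⟨y, k', hy⟩ := exists_index hl (c.a g - 1)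
  have hy' : ((y : ℕ) : ℤ) = c.a g + l * k' - 1 := by linarith
  obtain ⟨r1, s1⟩ := hC.flip_neg hn hc hge h1 h2 hx hy'
  have ea : (c.flip n g (-1)).a g = c.a g - 1 := by
    simp only [Code.flip, Code.bumpA]
    rw [bump_of_not_dvd, bump_of_dvd (by simp)]
    · ring
    · refine not_two_mul_dvd_of_odd ?_
      rw [show g - (3 - g) = g + g - 3 by ring]; exact (hge.add hge).sub_odd (by decide)
  have t1 : (c.flip n g (-1)).a g < (c.flip n g (-1)).a (g + 1) := by
    rw [ea]
    have : c.a (g + 1) ≤ (c.flip n g (-1)).a (g + 1) := by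
      simp only [Code.flip, Code.bumpA]
      have : bump n c.a g (-1) (g + 1) = c.a (g + 1) := bump_of_not_dvd
        (not_two_mul_dvd_of_odd (by simp))
      rw [← this]
      exact le_bump _ _ (by norm_num) _
    have := hc.mono g
    omega
  have t2 : (c.flip n g (-1)).a (2 - g) < (c.flip n g (-1)).a (2 - g + 1) := by
    rw [show 2 - g + 1 = 3 - g by ring]
    have e3 : c.a (3 - g) + 1 = (c.flip n g (-1)).a (3 - g) := by
      simp only [Code.flip, Code.bumpA]
      rw [bump_of_dvd (by simp), bump_of_not_dvd]
      · ring
      · refine not_two_mul_dvd_of_odd ?_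
        rw [show 3 - g - g = 3 - (g + g) by ring]; exact Odd.sub_even (by decide) (hge.add hge)
    have e2 : (c.flip n g (-1)).a (2 - g) ≤ c.a (2 - g) := by
      simp only [Code.flip, Code.bumpA]
      rw [bump_of_not_dvd]
      · exact bump_le _ _ (by norm_num) _
      · exact not_two_mul_dvd_of_odd (by simp)
    have := hc.mono (2 - g)
    rw [show 2 - g + 1 = 3 - g by ring] at this
    omega
  obtain ⟨Y, hY, rY, -⟩ := r1.split_eq_some hn hl s1.toBasic hj hg t1 t2
  rw [Code.flip_flip, neg_add_cancel, Code.flip_zero] at rY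
  have hYC : Y = C := rY.unique hC
  refine ⟨_, _, j, ρ, s1, r1, by rw [hY, hYC], ?_⟩
  obtain ⟨hHy, hny⟩ := hC.last_spec hc.toBasic h1 h2 hy'
  -- On a single layer, taking and putting a half would leave `C` unchanged, whereas the new code
  -- makes this layer one half higher.
  have hxy : x ≠ y := by
    rintro rfl
    have h5 := (r1.le_iff x (g + 2 * cycleLength n * k')).1 (by
      rw [r1.le_iff, ← r1.le_iff, s1.period.add_mul, ea]; omega)
    have h6 : putHalfAt (takeHalfAt C x) x = C := by
      funext z
      by_cases hz : z = x
      · subst hz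
        simp only [putHalfAt, takeHalfAt, Function.update_self]
        rcases hcx : C z with ⟨r, t⟩
        cases t <;> simp [Layer.putHalf, Layer.takeHalf]
      · simp [putHalfAt, takeHalfAt, hz]
    rw [h6] at h5
    omega
  have h2x : (3 - g) - 1 = 2 - g := by ring
  obtain ⟨hHx, hnx⟩ := hC.first_spec hc.toBasic (g := 3 - g) (by
      have := hc.symm (g - 1) (hge.sub_odd odd_one)
      rw [sub_add_cancel, show 3 - (g - 1) = 3 - g + 1 by ring] at this
      omega) (by
      intro hd s
      rw [h2x] at hd ⊢
      have hd' : cycleLength n ∣ g - 2 := by rwa [dvd_sub_comm]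
      have h3 := hc.balance_add_mul (s := s) hd' (by rw [sub_add_cancel]; exact h2 hd')
      obtain ⟨m, hm⟩ := hd
      rw [show 3 - g = g - 2 + 1 + 2 * cycleLength n * m by linarith, hc.period.add_mul,
        show 2 - g = g - 2 + 2 * cycleLength n * m by linarith, (hc.periodQ s).add_mul]
      omega) hx
  have half_of : ∀ z : Layer, (∀ s, z.top ≠ .single s) → Odd z.height → z.top = .half := by
    intro z hz ho
    rcases hzt : z.top with _ | s | _
    · rw [Layer.height_of_flat hzt] at ho
      exact absurd ho (Int.not_odd_iff_even.2 (even_two_mul _))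
    · exact absurd hzt (hz s)
    · rfl
  have hcx : (C x).top = .half := half_of _ hnx (by
    rw [hHx]
    exact (Odd.sub_even (by decide) hge).add_even ((even_two_mul (cycleLength n)).mul_right k))
  have hcy : (C y).top = .half := half_of _ hny (by
    rw [hHy]
    exact (hge.add ((even_two_mul (cycleLength n)).mul_right k')).sub_odd odd_one)
  refine Finset.card_lt_card ⟨fun z hz => ?_, fun hsub => ?_⟩
  · simp only [Finset.mem_filter, Finset.mem_univ, true_and] at hz ⊢
    by_cases hzx : z = x
    · rwa [hzx]
    by_cases hzy : z = y
    · rwa [hzy]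
    simpa [putHalfAt, takeHalfAt, hzx, hzy] using hz
  · have := @hsub x (by simpa using hcx)
    simp [putHalfAt, takeHalfAt, hxy, Layer.takeHalf, hcx] at this

theorem Rep.exists_preSlice (hn : 4 ≤ n) : ∀ (N : ℕ) {C : Layers l} {c : Code}, c.IsSemi n l →
    Rep n C c → (Finset.univ.filter fun q => (C q).top = .half).card ≤ N →
    ∃ D, IsPreSlice n D ∧ Relation.ReflTransGen (fun X Y => ∃ j ρ, split n j ρ X = some Y) D C := by
  intro N
  induction N with
  | zero =>
    intro C c hc hC hN
    refine ⟨C, hC.isPreSlice hn hc.toBasic fun p hp => ?_, .refl⟩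
    have : p ∈ Finset.univ.filter fun q => (C q).top = .half := by simpa using hp
    rw [Finset.card_eq_zero.1 (Nat.le_zero.1 hN)] at this
    simp at this
  | succ N ih =>
    intro C c hc hC hN
    by_cases h : ∃ p, (C p).top = .half
    · obtain ⟨p, hp⟩ := h
      obtain ⟨C', c', j, ρ, h1, h2, h3, h4⟩ := hC.exists_unsplit hn hc hp
      obtain ⟨D, hD1, hD2⟩ := ih h1 h2 (by omega)
      exact ⟨D, hD1, hD2.tail ⟨j, ρ, h3⟩⟩
    · push Not at h
      exact ⟨C, hC.isPreSlice hn hc.toBasic h, .refl⟩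

/-- Pre-slices have semi-codes and splitting keeps them; conversely halves can be removed pair by
pair. Being unsplittable is the condition `disj`. -/
theorem isSlice_iff (hn : 4 ≤ n) (hl : 1 ≤ l) :
    IsSlice n C ↔ ∃ c : Code, c.IsSliceCode n l ∧ Rep n C c := by
  constructor
  · rintro ⟨⟨D, hD, hDC⟩, hC⟩
    have : ∃ c : Code, c.IsSemi n l ∧ Rep n C c := by
      clear hC
      induction hDC with
      | refl => exact ⟨_, hD.isSemi_preCode hn⟩
      | tail _ h ih =>
        obtain ⟨j, ρ, h⟩ := h
        obtain ⟨c, hc, hr⟩ := ih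
        exact hr.exists_of_split hn hl hc h
    obtain ⟨c, hc, hr⟩ := this
    exact ⟨c, ⟨hc, (hr.forall_split_eq_none_iff hn hl hc.toBasic).1 hC⟩, hr⟩
  · rintro ⟨c, hc, hr⟩
    exact ⟨Rep.exists_preSlice hn _ hc.toIsSemi hr le_rfl,
      (hr.forall_split_eq_none_iff hn hl hc.toBasic).2 hc.disj⟩

/-! ### Un-splitting and splitting all end blocks -/

/-- `01` and `(n-1)n`. -/
def Whole.IsEnd : Whole → Prop
  | .mid _ => False
  | _ => True

theorem Whole.IsEnd.isWhole {j : Whole} (hj : j.IsEnd) : IsWhole n j := by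
  cases j <;> simp_all [Whole.IsEnd, IsWhole]

theorem Whole.IsEnd.dvd {j : Whole} (hj : j.IsEnd) (ρ : Role) :
    cycleLength n ∣ 2 * baseRow n j ρ := by
  cases j
  · simp [baseRow]
  · exact hj.elim
  · exact ⟨1, by simp only [baseRow, cycleLength]; ring⟩

theorem even_of_dvd {e : ℤ} (he : cycleLength n ∣ e) : Even e :=
  even_iff_two_dvd.2 ((even_iff_two_dvd.1 (cycleLength_even n)).trans he)

/-- In a row of half-unit depth blocks `3 - (e + 2)` is `e + 1` up to the period: a splitting moves
both ends of the class `e + 1` outwards. -/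
theorem Code.flip_end (k : ℤ) {e : ℤ} (he : cycleLength n ∣ e) :
    (c.flip n (e + 2) k).a e = c.a e ∧ (c.flip n (e + 2) k).a (e + 1) = c.a (e + 1) - k ∧
      (c.flip n (e + 2) k).a (e + 2) = c.a (e + 2) + k ∧
      (c.flip n (e + 2) k).a (e + 3) = c.a (e + 3) := by
  obtain ⟨y, hy⟩ := even_of_dvd he
  have h2 : 2 * cycleLength n ∣ e + 1 - (3 - (e + 2)) := by
    rw [show e + 1 - (3 - (e + 2)) = 2 * e by ring]; exact mul_dvd_mul_left 2 he
  have h3 : ¬ 2 * cycleLength n ∣ e + 3 - (3 - (e + 2)) := by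
    rw [show e + 3 - (3 - (e + 2)) = 2 * e + 2 by ring]
    exact not_two_mul_dvd_of_emod (by omega)
  have odd : ∀ x : ℤ, x % 2 = 1 → ¬ 2 * cycleLength n ∣ x := fun x hx =>
    not_two_mul_dvd_of_odd (Int.odd_iff.2 hx)
  simp only [flip, bumpA]
  refine ⟨?_, ?_, ?_, ?_⟩
  · rw [bump_of_not_dvd (odd _ (by omega)), bump_of_not_dvd (not_two_mul_dvd_of_emod (by omega))]
  · rw [bump_of_dvd h2, bump_of_not_dvd (odd _ (by omega))]; ring
  · rw [bump_of_not_dvd (odd _ (by omega)), bump_of_dvd (by simp)]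
  · rw [bump_of_not_dvd h3, bump_of_not_dvd (odd _ (by omega))]

theorem Rep.unsplit_eq_some (hn : 4 ≤ n) (hl : 1 ≤ l) (hc : c.IsSemi n l) (hC : Rep n C c)
    {j : Whole} (hj : j.IsEnd) {e : ℤ} (he : e = 2 * baseRow n j .supporting)
    (hQ : ∀ s, c.Q s e < c.a (e + 2)) :
    ∃ Y, unsplit n j C = some Y ∧ Rep n Y (c.flip n (e + 2) (-1)) ∧
      (c.flip n (e + 2) (-1)).IsSemi n l := by
  have hT := cycleLength_pos hn
  have hd : cycleLength n ∣ e := he ▸ hj.dvd _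
  have h0 := fun s => hc.balance_add_mul (s := s) hd hQ
  have h1 : c.a (e + 1) < c.a (e + 1 + 1) := by
    have := hQ .front
    have := h0 .front
    rw [show e + 1 + 1 = e + 2 by ring]
    omega
  have hS : ∀ p, topHalf n j .supporting (C p) = true ↔
      2 * cycleLength n ∣ (C p).height - (e + 1) ∧ ∀ s, (C p).top ≠ .single s := fun p => by
    rw [topHalf_iff hn hj.isWhole, he]
  have v1 : cycleLength n ∣ e + 1 - 1 → ∀ s, c.a (e + 1) < c.Q s (e + 1 - 1) := fun _ s => by
    rw [add_sub_cancel_right]; exact h0 s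
  have v2 : cycleLength n ∣ e + 1 - 1 → ∀ s, c.Q s (e + 1 - 1) < c.a (e + 1 + 1) := fun _ s => by
    rw [add_sub_cancel_right, show e + 1 + 1 = e + 2 by ring]; exact hQ s
  obtain ⟨p, m, h3, h4⟩ := hC.foremost_class hn hl hc.toBasic hS h1 v1
  obtain ⟨q, m', h5, h6⟩ := hC.rearmost_class hn hl hc.toBasic hS h1 v2
  have hpq : p ≠ q := by
    rintro rfl
    have h7 := (hC.first_spec hc.toBasic h1 v1 h4).1
    have h8 := (hC.last_spec hc.toBasic (g := e + 1 + 1) (by rwa [add_sub_cancel_right])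
      (by rwa [show e + 1 + 1 - 2 = e + 1 - 1 by ring]) h6).1
    have h9 : m = m' := by
      have h10 : (2 * cycleLength n) * (m - m') = 0 := by linarith
      rcases mul_eq_zero.1 h10 with h | h <;> omega
    subst h9
    have := hQ .front
    have := h0 .front
    rw [show e + 1 + 1 = e + 2 by ring] at h6
    omega
  refine ⟨_, by rw [unsplit, h3, h5]; simp only [if_neg hpq]; rfl, ?_⟩
  obtain ⟨k, hk⟩ := hd
  refine hC.flip_neg hn hc (g := e + 2) ((even_of_dvd ⟨k, hk⟩).add even_two)
    (by rwa [show e + 2 - 1 = e + 1 by ring, show e + 2 = e + 1 + 1 by ring])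
    (fun _ s => by rw [add_sub_cancel_right]; exact hQ s) (m := k + m) ?_
    (by rw [h6, show e + 1 + 1 = e + 2 by ring])
  rw [h4, show e + 1 = 3 - (e + 2) + 2 * cycleLength n * k by linarith, hc.period.add_mul]
  ring

theorem Rep.unsplit_eq_none (hn : 4 ≤ n) (hc : c.IsSemi n l) (hC : Rep n C c)
    {j : Whole} (hj : j.IsEnd) {e : ℤ} (he : e = 2 * baseRow n j .supporting)
    (hQ : ∃ s, c.Q s e = c.a (e + 2)) : unsplit n j C = none := by
  obtain ⟨s, hQ⟩ := hQ
  have hd : cycleLength n ∣ e := he ▸ hj.dvd _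
  rw [unsplit, foremostHighest_eq_none]
  refine fun p => Bool.eq_false_iff.2 fun h => ?_
  rw [topHalf_iff hn hj.isWhole, ← he] at h
  obtain ⟨h1, h2⟩ := h
  obtain ⟨m, hm⟩ := exists_eq_add_mul_of_dvd h1
  have h3 := (hC.height_eq_iff p _).1 hm
  rw [show e + 1 + 2 * cycleLength n * m + 1 = e + 2 + 2 * cycleLength n * m by ring,
    hc.period.add_mul, hc.period.add_mul] at h3
  have h4 := hc.balance s e hd
  refine h2 s.swap ((hC.single_iff p _).2 ?_)
  rw [hm, show e + 1 + 2 * cycleLength n * m - 1 = e + 2 * cycleLength n * m by ring,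
    (hc.periodQ _).add_mul, (hc.periodQ _).add_mul, Side.swap_swap]
  exact ⟨dvd_add hd ⟨2 * m, by ring⟩, by omega, by omega⟩

theorem repeatStep_of_eq_none {α : Type*} {g : α → Option α} {x : α} (h : g x = none) (m : ℕ) :
    repeatStep g m x = x := by
  cases m <;> simp [repeatStep, h]

/-- Each un-splitting shortens the class `e + 1` by one index at either end, until only the single
blocks remain. The class has at most `l` members, so `l` steps suffice. -/
theorem Rep.rep_unsplitAll (hn : 4 ≤ n) (hl : 1 ≤ l) (hc : c.IsSemi n l) (hC : Rep n C c)
    {j : Whole} (hj : j.IsEnd) {e : ℤ} (he : e = 2 * baseRow n j .supporting) :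
    ∃ m, 0 ≤ m ∧ (c.flip n (e + 2) (-m)).IsSemi n l ∧
      Rep n (unsplitAll n j C) (c.flip n (e + 2) (-m)) ∧ ∃ s, c.Q s e = c.a (e + 2) - m := by
  have hd : cycleLength n ∣ e := he ▸ hj.dvd _
  have key : ∀ (N : ℕ) (C : Layers l) (c : Code), c.IsSemi n l → Rep n C c →
      c.a (e + 2) - c.a (e + 1) ≤ 2 * N → ∃ m, 0 ≤ m ∧ (c.flip n (e + 2) (-m)).IsSemi n l ∧
      Rep n (repeatStep (unsplit n j) N C) (c.flip n (e + 2) (-m)) ∧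
      ∃ s, c.Q s e = c.a (e + 2) - m := by
    intro N
    induction N with
    | zero =>
      intro C c hc hC hN
      refine ⟨0, le_rfl, ?_⟩
      rw [neg_zero, Code.flip_zero]
      refine ⟨hc, hC, .front, ?_⟩
      have := hc.lower .front e hd
      have := hc.upper .front e hd
      omega
    | succ N ih =>
      intro C c hc hC hN
      by_cases h : ∃ s, c.Q s e = c.a (e + 2)
      · refine ⟨0, le_rfl, ?_⟩
        rw [neg_zero, Code.flip_zero, repeatStep_of_eq_none (hC.unsplit_eq_none hn hc hj he h),
          sub_zero]
        exact ⟨hc, hC, h⟩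
      · push Not at h
        obtain ⟨Y, h1, h2, h3⟩ := hC.unsplit_eq_some hn hl hc hj he fun s =>
          lt_of_le_of_ne (hc.upper s e hd) (h s)
        have h4 := Code.flip_end (c := c) (-1) hd
        obtain ⟨m, h5, h6, h7, s, h8⟩ := ih Y _ h3 h2 (by push_cast at hN; omega)
        rw [Code.flip_flip, ← neg_add, add_comm 1 m] at h6 h7
        refine ⟨m + 1, by omega, h6, by simpa only [repeatStep, h1] using h7, s, ?_⟩
        change c.Q s e = _ at h8
        omega
  refine key l C c hc hC ?_
  have := hc.sub_le hn (show e + 2 ≤ e + 1 + 8 by omega)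
  omega

/-- Each splitting consumes one layer of height `e` and one of height `e + 2`, up to the period, and
the process stops when one of these classes is empty. -/
theorem Rep.rep_splitAll (hn : 4 ≤ n) (hl : 1 ≤ l) (hc : c.IsSemi n l) (hC : Rep n C c)
    {j : Whole} (hj : j.IsEnd) {e : ℤ} (he : e = 2 * baseRow n j .supporting) :
    ∃ m, 0 ≤ m ∧ (c.flip n (e + 2) m).IsSemi n l ∧
      Rep n (splitAll n j C) (c.flip n (e + 2) m) ∧
      (c.a e = c.a (e + 1) - m ∨ c.a (e + 3) = c.a (e + 2) + m) := by
  have hd : cycleLength n ∣ e := he ▸ hj.dvd _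
  have hstep : ∀ c : Code, c.IsSemi n l → (c.a (2 - (e + 2)) = c.a (2 - (e + 2) + 1) ↔
      c.a e = c.a (e + 1)) := fun c hc => by
    obtain ⟨k, hk⟩ := hd
    rw [← hc.step_iff (2 - (e + 2)) k,
      show 2 - (e + 2) + 2 * cycleLength n * k = e by linarith]
  have key : ∀ (N : ℕ) (C : Layers l) (c : Code), c.IsSemi n l → Rep n C c →
      c.a (e + 1) - c.a e ≤ N → ∃ m, 0 ≤ m ∧ (c.flip n (e + 2) m).IsSemi n l ∧
      Rep n (repeatStep (split n j .supporting) N C) (c.flip n (e + 2) m) ∧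
      (c.a e = c.a (e + 1) - m ∨ c.a (e + 3) = c.a (e + 2) + m) := by
    intro N
    induction N with
    | zero =>
      intro C c hc hC hN
      refine ⟨0, le_rfl, ?_⟩
      rw [Code.flip_zero]
      refine ⟨hc, hC, .inl ?_⟩
      have := hc.mono e
      push_cast at hN
      omega
    | succ N ih =>
      intro C c hc hC hN
      by_cases h : c.a e = c.a (e + 1) ∨ c.a (e + 3) = c.a (e + 2)
      · refine ⟨0, le_rfl, ?_⟩
        rw [Code.flip_zero, repeatStep_of_eq_none (hC.split_eq_none hn hc.toBasic hj.isWhole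
          (g := e + 2) (by rw [he]) ?_), sub_zero, add_zero]
        · exact ⟨hc, hC, h⟩
        · rw [hstep c hc, show e + 2 + 1 = e + 3 by ring]
          exact h.symm.imp_left Eq.symm
      · push Not at h
        have h0 := mt (hstep c hc).1 h.1
        obtain ⟨Y, h1, h2, h3⟩ := hC.split_eq_some hn hl hc.toBasic hj.isWhole
          (ρ := .supporting) (g := e + 2) (by rw [he])
          (lt_of_le_of_ne (hc.mono _) (by
            rw [show e + 2 + 1 = e + 3 by ring]; exact h.2.symm))
          (lt_of_le_of_ne (hc.mono _) h0)
        have h4 := Code.flip_end (c := c) 1 hd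
        obtain ⟨m, h5, h6, h7, h8⟩ := ih Y _ (hc.flip h3) h2 (by push_cast at hN; omega)
        rw [Code.flip_flip, add_comm 1 m] at h6 h7
        refine ⟨m + 1, by omega, h6, by simpa only [repeatStep, h1] using h7, ?_⟩
        omega
  refine key l C c hc hC ?_
  have := hc.sub_le hn (show e + 1 ≤ e + 8 by omega)
  omega

end

end YoungWall

namespace YoungWall

section
variable {n l : ℕ} {C : Layers l} {c : Code}

/-! ### The operators for `2 ≤ i ≤ n - 2` on codes -/

theorem not_two_mul_dvd_of {x : ℤ} (hx : x % 2 = 1 ∨ x % 4 = 2) : ¬ 2 * cycleLength n ∣ x := by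
  rcases hx with h | h
  · exact not_two_mul_dvd_of_odd (Int.odd_iff.2 h)
  · exact not_two_mul_dvd_of_emod (by omega)

theorem not_two_mul_dvd_sub {b e : ℤ} (hb : ¬ cycleLength n ∣ b) (he : cycleLength n ∣ e) :
    ¬ 2 * cycleLength n ∣ e - b := fun h =>
  hb ((dvd_sub_right he).1 ((Dvd.intro_left _ rfl).trans h))

theorem not_two_mul_dvd_two_mul {b : ℤ} (hb : ¬ cycleLength n ∣ b) :
    ¬ 2 * cycleLength n ∣ 2 * b := fun h => hb ((mul_dvd_mul_iff_left two_ne_zero).1 h)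

/-- There are not both layers of height `h` and layers of height `2 - h` modulo the period. -/
def Code.Disj (c : Code) : Prop :=
  ∀ h, Even h → c.a h = c.a (h + 1) ∨ c.a (2 - h) = c.a (2 - h + 1)

/-- The step moves a layer from height `x - 1` to height `x`. A new conflict can only arise at `x`,
if `x` is even, and then only with the class `2 - x`. -/
theorem Code.Disj.lower (hc : c.Basic n l) (hd : c.Disj) {x : ℤ}
    (hx : Even x → c.a (2 - x) = c.a (2 - x + 1)) (hc' : ∀ h, (c.bumpA n x (-1)).a h ≤ (c.bumpA n x (-1)).a (h + 1)) :
    (c.bumpA n x (-1)).Disj := by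
  intro h hh
  obtain ⟨y, hy⟩ := hh
  have m1 := hc' h
  have m2 := hc' (2 - h)
  have u1 : ∀ z, (c.bumpA n x (-1)).a z ≤ c.a z := bump_le _ _ (by norm_num)
  have k1 : ∀ z, ¬ 2 * cycleLength n ∣ z - x → (c.bumpA n x (-1)).a z = c.a z :=
    fun z hz => bump_of_not_dvd hz
  have e1 := u1 (h + 1)
  have e2 := u1 (2 - h + 1)
  by_cases h1 : 2 * cycleLength n ∣ h - x
  · obtain ⟨m, hm⟩ := exists_eq_add_mul_of_dvd h1
    have hxe : Even x := by rw [mul_assoc] at hm; exact ⟨y - cycleLength n * m, by omega⟩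
    have h3 := hx hxe
    have h4 := hc.step_iff (2 - x) (-m)
    rw [show 2 - x + 2 * cycleLength n * -m = 2 - h by rw [hm]; ring] at h4
    have h5 := h4.2 h3
    have h6 := k1 (2 - h) (by
      intro h7
      have := dvd_add h1 h7
      obtain ⟨z, hz⟩ := hxe
      exact not_two_mul_dvd_of (n := n) (x := h - x + (2 - h - x)) (by omega) this)
    right; omega
  · have h1' := k1 h h1
    by_cases h2 : 2 * cycleLength n ∣ 2 - h - x
    · obtain ⟨m, hm⟩ := exists_eq_add_mul_of_dvd h2
      have hxe : Even x := by rw [mul_assoc] at hm; exact ⟨1 - y - cycleLength n * m, by omega⟩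
      have h3 := hx hxe
      have h4 := hc.step_iff (2 - x) (-m)
      rw [show 2 - x + 2 * cycleLength n * -m = h by linarith] at h4
      have h5 := h4.2 h3
      left; omega
    · have h2' := k1 _ h2
      have := hd h ⟨y, hy⟩
      have := hc.mono h
      have := hc.mono (2 - h)
      omega

/-- `f̃ᵢ` on codes, where `b = 2 i - 2`. -/
def Code.midF (n : ℕ) (b : ℤ) (c : Code) : Code :=
  (c.bumpA n (if c.a b < c.a (b + 1) then b + 1 else 2 - b) (-1)).bumpA n
    (if c.a (-b) < c.a (-b + 1) then -b + 1 else 2 - -b) (-1)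

/-- `ẽᵢ` on codes, where `b = 2 i - 2`. -/
def Code.midE (n : ℕ) (b : ℤ) (c : Code) : Code :=
  (c.bumpA n (if c.a (b + 2) < c.a (b + 3) then b + 2 else 1 - b) 1).bumpA n
    (if c.a (-b + 2) < c.a (-b + 3) then -b + 2 else 1 - -b) 1

/-- Counts the supporting full slots, the supporting halves and the covering full slots; by `symm`
there are equally many covering halves. -/
def Code.midPhi (b : ℤ) (c : Code) : ℤ := c.a (b + 2) - c.a b + (c.a (-b + 1) - c.a (-b))

/-- Counts the supporting halves, the supporting blocks and the covering blocks. -/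
def Code.midEps (b : ℤ) (c : Code) : ℤ := c.a (b + 3) - c.a (b + 1) + (c.a (-b + 3) - c.a (-b + 2))

theorem Code.bumpA_comm (x y k k' : ℤ) :
    (c.bumpA n x k).bumpA n y k' = (c.bumpA n y k').bumpA n x k := by
  ext z
  · simp only [bumpA, bump]; ring
  · rfl

theorem Code.bumpA_bumpA (x k k' : ℤ) :
    (c.bumpA n x k).bumpA n x k' = c.bumpA n x (k + k') := by
  ext z
  · simp only [bumpA, bump]; split_ifs <;> ring
  · rfl

theorem Code.bumpA_zero (x : ℤ) : c.bumpA n x 0 = c := by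
  ext z
  · simp [bumpA, bump]
  · rfl

/-- The value of the indicator function of the multiples of the period. -/
def cls (n : ℕ) (x : ℤ) : ℤ := if 2 * cycleLength n ∣ x then 1 else 0

theorem bump_eq_cls (f : ℤ → ℤ) (g k x : ℤ) : bump n f g k x = f x + k * cls n (x - g) := by
  simp [bump, cls]

theorem cls_neg (x : ℤ) : cls n (-x) = cls n x := by simp [cls]

theorem cls_eq_zero {x : ℤ} (h : ¬ 2 * cycleLength n ∣ x) : cls n x = 0 := by simp [cls, h]

/-- The alternatives `b + 1` and `2 - b` are exchanged by `h ↦ 3 - h`. Putting a half into a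
supporting full slot or completing a covering half has the same effect on the difference between the
numbers of halves of the two roles. -/
theorem bump_add_reflect (f : ℤ → ℤ) {b x : ℤ} (k h : ℤ) (hx : x = b + 1 ∨ x = 2 - b) :
    bump n f x k h + bump n f x k (3 - h) =
      f h + f (3 - h) + k * (cls n (h - (b + 1)) + cls n (h - (2 - b))) := by
  rw [bump_eq_cls, bump_eq_cls, ← cls_neg (3 - h - x), show -(3 - h - x) = h - (3 - x) by ring]
  rcases hx with rfl | rfl
  · rw [show (3 : ℤ) - (b + 1) = 2 - b by ring]; ring
  · rw [show (3 : ℤ) - (2 - b) = b + 1 by ring]; ring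

theorem Code.IsSemi.bump_two (hc : c.IsSemi n l) {b x y k : ℤ} (hb : Even b)
    (hTb : ¬ cycleLength n ∣ b) (hx : x = b + 1 ∨ x = 2 - b) (hy : y = -b + 1 ∨ y = 2 - -b)
    (hc' : ((c.bumpA n x k).bumpA n y k).Basic n l) :
    ((c.bumpA n x k).bumpA n y k).IsSemi n l where
  toBasic := hc'
  balance s e he := by
    have hTb' : ¬ cycleLength n ∣ -b := by rwa [dvd_neg]
    obtain ⟨z, hz⟩ := hb
    obtain ⟨w, hw⟩ := even_of_dvd he
    have n1 := not_two_mul_dvd_sub hTb he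
    have n2 := not_two_mul_dvd_sub hTb' he
    have key : ∀ (f : ℤ → ℤ) (u v : ℤ), v = 1 ∨ v = 2 → (u = b + 1 ∨ u = 2 - b ∨ u = -b + 1 ∨
        u = 2 - -b) → bump n f u k (e + v) = f (e + v) := by
      intro f u v hv hu
      refine bump_of_not_dvd ?_
      by_cases h0 : e + v - u = e - b
      · rw [h0]; exact n1
      by_cases h0 : e + v - u = e - -b
      · rw [h0]; exact n2
      · exact not_two_mul_dvd_of (by omega)
    have h1 := hc.balance s e he
    simp only [bumpA]
    rw [key _ y 1 (by simp) (by tauto), key _ x 1 (by simp) (by tauto),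
      key _ y 2 (by simp) (by tauto), key _ x 2 (by simp) (by tauto)]
    exact h1
  symm h hh := by
    have h1 := hc.symm h hh
    have hev : ∀ z, Even z → cls n (h - z) = 0 := fun z hz =>
      cls_eq_zero (not_two_mul_dvd_of_odd (hh.sub_even hz))
    have hod : ∀ z, Odd z → cls n (h + 1 - z) = 0 := fun z hz =>
      cls_eq_zero (not_two_mul_dvd_of_odd (hh.add_one.sub_odd hz))
    simp only [bumpA]
    rw [bump_add_reflect _ k h hy, bump_add_reflect _ k h hx, bump_add_reflect _ k (h + 1) hy,
      bump_add_reflect _ k (h + 1) hx, hev _ (even_two.sub hb), hev _ (even_two.sub hb.neg),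
      hod _ hb.add_one, hod _ hb.neg.add_one, show h + 1 - (2 - b) = h - (-b + 1) by ring,
      show h + 1 - (2 - -b) = h - (b + 1) by ring]
    linarith

/-- Heights which occur in the operators for `b = 2 i - 2`. -/
theorem bump_of_ne {b : ℤ} (hTb : ¬ cycleLength n ∣ b) (f : ℤ → ℤ) (g k x : ℤ)
    (h : (x - g) % 2 = 1 ∨ (x - g) % 4 = 2 ∨ x - g = 2 * b ∨ x - g = -(2 * b)) :
    bump n f g k x = f x := by
  refine bump_of_not_dvd ?_
  rcases h with h | h | h | h
  · exact not_two_mul_dvd_of (.inl h)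
  · exact not_two_mul_dvd_of (.inr h)
  · rw [h]; exact not_two_mul_dvd_two_mul hTb
  · rw [h, dvd_neg]; exact not_two_mul_dvd_two_mul hTb

/-- The two bumps change that difference in opposite directions, which keeps `symm`. A full slot is
completed to height `2 - b` or `2 + b` only when the reflected class is empty, which keeps `disj`.
-/
theorem Code.IsSliceCode.midF (hc : c.IsSliceCode n l) {b : ℤ} (hb : Even b)
    (hTb : ¬ cycleLength n ∣ b) (hφ : 0 < c.midPhi b) : (c.midF n b).IsSliceCode n l := by
  obtain ⟨z, hz⟩ := hb
  have ne := bump_of_ne hTb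
  have odd_ne : ∀ {x : ℤ} {P : Prop}, x % 2 = 1 → cycleLength n ∣ x → P := fun hx h =>
    (not_dvd_of_odd (Int.odd_iff.2 hx) h).elim
  have hTm : ¬ cycleLength n ∣ -b := by rwa [dvd_neg]
  have s1 := hc.symm (b + 1) (Int.odd_iff.2 (by omega))
  rw [show 3 - (b + 1) = -b + 2 by ring, show 3 - (b + 1 + 1) = -b + 1 by ring,
    show b + 1 + 1 = b + 2 by ring] at s1
  have m1 := hc.mono b
  have m2 := hc.mono (-b)
  have m3 := hc.mono (b + 1)
  have m4 := hc.mono (-b + 1)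
  rw [show b + 1 + 1 = b + 2 by ring] at m3
  rw [show -b + 1 + 1 = -b + 2 by ring] at m4
  unfold Code.midPhi at hφ
  unfold Code.midF
  have hd : c.Disj := hc.disj
  -- the first step
  set x := if c.a b < c.a (b + 1) then b + 1 else 2 - b with hx
  set y := if c.a (-b) < c.a (-b + 1) then -b + 1 else 2 - -b with hy
  have fin : ∀ (hb1 : (c.bumpA n x (-1)).Basic n l)
      (hb2 : ((c.bumpA n x (-1)).bumpA n y (-1)).Basic n l),
      ((c.bumpA n x (-1)).bumpA n y (-1)).IsSliceCode n l := by
    intro hb1 hb2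
    have d1 : (c.bumpA n x (-1)).Disj := hd.lower hc.toBasic (fun hxe => by
      obtain ⟨w, hw⟩ := hxe
      rw [hx] at hw ⊢
      split_ifs at hw ⊢ with h
      · omega
      -- This alternative is only taken when the class `b` is empty, which is what the creation of a
      -- layer of height `2 - b` requires.
      · rw [show 2 - (2 - b) = b by ring]; omega) hb1.mono
    have d2 := d1.lower hb1 (x := y) (fun hye => by
      obtain ⟨w, hw⟩ := hye
      rw [hy] at hw ⊢
      split_ifs at hw ⊢ with h
      · omega
      · rw [show 2 - (2 - -b) = -b by ring]
        simp only [bumpA]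
        rw [ne _ _ _ (-b) (by rw [hx]; split_ifs <;> omega),
          ne _ _ _ (-b + 1) (by rw [hx]; split_ifs <;> omega)]
        omega) hb2.mono
    refine ⟨hc.toIsSemi.bump_two ⟨z, hz⟩ hTb ?_ ?_ hb2, d2⟩
    · rw [hx]; split_ifs <;> simp
    · rw [hy]; split_ifs <;> simp
  by_cases h1 : c.a b < c.a (b + 1)
  · have hx1 : x = b + 1 := by rw [hx, if_pos h1]
    have b1 : (c.bumpA n x (-1)).Basic n l := hc.lowerA (by rw [hx1, add_sub_cancel_right]; exact h1)
      (by rw [hx1]; exact odd_ne (by omega))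
    refine fin b1 (b1.lowerA ?_ ?_)
    · rw [hx1]
      simp only [bumpA]
      by_cases h2 : c.a (-b) < c.a (-b + 1)
      · rw [hy, if_pos h2, ne _ _ _ (-b + 1) (by omega), ne _ _ _ (-b + 1 - 1) (by omega),
          add_sub_cancel_right]
        exact h2
      -- The half placed by the first bump guarantees that the class `b + 1` is not empty, even if
      -- it was before.
      · rw [hy, if_neg h2, ne _ _ _ (2 - -b) (by omega), bump_of_dvd (by
          rw [show 2 - -b - 1 - (b + 1) = 0 by ring]; exact dvd_zero _),
          show 2 - -b = b + 2 by ring, show b + 2 - 1 = b + 1 by ring]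
        omega
    · rw [hy]
      split_ifs
      · exact odd_ne (by omega)
      · intro h; rw [show 2 - -b - 2 = b by ring] at h; exact (hTb h).elim
  · have hx1 : x = 2 - b := by rw [hx, if_neg h1]
    by_cases h2 : c.a (-b) < c.a (-b + 1)
    · have hy1 : y = -b + 1 := by rw [hy, if_pos h2]
      have b2 : (c.bumpA n y (-1)).Basic n l := hc.lowerA
        (by rw [hy1, add_sub_cancel_right]; exact h2) (by rw [hy1]; exact odd_ne (by omega))
      have b12 : ((c.bumpA n x (-1)).bumpA n y (-1)).Basic n l := by
        rw [bumpA_comm]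
        refine b2.lowerA ?_ ?_
        · rw [hx1, hy1]
          simp only [bumpA]
          rw [ne _ _ _ (2 - b) (by omega), bump_of_dvd (by
            rw [show 2 - b - 1 - (-b + 1) = 0 by ring]; exact dvd_zero _),
            show 2 - b = -b + 2 by ring, show -b + 2 - 1 = -b + 1 by ring]
          omega
        · rw [hx1]
          intro h; rw [show 2 - b - 2 = -b by ring] at h; exact (hTm h).elim
      -- the order of the steps is irrelevant
      have d1 : (c.bumpA n y (-1)).Disj := hd.lower hc.toBasic (fun hxe => by
        obtain ⟨w, hw⟩ := hxe; omega) b2.mono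
      rw [bumpA_comm] at b12
      have d2 := d1.lower b2 (x := x) (fun _ => by
        rw [hx1, show 2 - (2 - b) = b by ring]
        simp only [bumpA]
        rw [ne _ _ _ b (by omega), ne _ _ _ (b + 1) (by omega)]
        omega) b12.mono
      rw [bumpA_comm]
      refine ⟨?_, d2⟩
      rw [bumpA_comm] at b12 ⊢
      exact hc.toIsSemi.bump_two ⟨z, hz⟩ hTb (.inr hx1) (.inl hy1) b12
    · have hy1 : y = 2 - -b := by rw [hy, if_neg h2]
      have b1 : (c.bumpA n x (-1)).Basic n l := hc.lowerA
        (by rw [hx1, show 2 - b = -b + 2 by ring, show -b + 2 - 1 = -b + 1 by ring]; omega)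
        (by rw [hx1]; intro h; rw [show 2 - b - 2 = -b by ring] at h; exact (hTm h).elim)
      refine fin b1 (b1.lowerA ?_ ?_)
      · rw [hx1, hy1]
        simp only [bumpA]
        rw [ne _ _ _ (2 - -b) (by omega), ne _ _ _ (2 - -b - 1) (by omega),
          show 2 - -b = b + 2 by ring, show b + 2 - 1 = b + 1 by ring]
        omega
      · rw [hy1]
        intro h; rw [show 2 - -b - 2 = b by ring] at h; exact (hTb h).elim

end

end YoungWall

/-! ### Duality, and the inverse operators on codes -/

namespace YoungWall

section
variable {n l : ℕ} {C : Layers l} {c : Code}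

/-- Turning a slice upside down. -/
def Code.dual (c : Code) : Code := ⟨fun h => -c.a (3 - h), fun s e => -c.Q s (-e)⟩

theorem Code.dual_dual : c.dual.dual = c := by
  ext <;> simp [dual]

theorem Code.dual_bumpA (g k : ℤ) : (c.bumpA n g k).dual = c.dual.bumpA n (3 - g) (-k) := by
  ext x
  · simp only [dual, bumpA, bump]
    have : 2 * cycleLength n ∣ 3 - x - g ↔ 2 * cycleLength n ∣ x - (3 - g) := by
      rw [dvd_sub_comm, show g - (3 - x) = x - (3 - g) by ring]
    simp only [this]
    split_ifs <;> ring
  · rfl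

theorem Code.dual_bumpQ (s : Side) (e k : ℤ) :
    (c.bumpQ n s e k).dual = c.dual.bumpQ n s (-e) (-k) := by
  ext x y
  · rfl
  · simp only [dual, bumpQ]
    by_cases h : x = s
    · subst h
      have : 2 * cycleLength n ∣ -y - e ↔ 2 * cycleLength n ∣ y - -e := by
        rw [dvd_sub_comm, show e - -y = y - -e by ring]
      simp only [Function.update_self, bump, this]
      split_ifs <;> ring
    · simp [Function.update_of_ne h]

theorem Code.IsSliceCode.dual (hc : c.IsSliceCode n l) : c.dual.IsSliceCode n l where
  mono h := by
    have := hc.mono (2 - h)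
    rw [show 2 - h + 1 = 3 - h by ring] at this
    simp only [Code.dual, show 3 - (h + 1) = 2 - h by ring]
    omega
  period h := by
    have := hc.period (3 - (h + 2 * cycleLength n))
    rw [show 3 - (h + 2 * cycleLength n) + 2 * cycleLength n = 3 - h by ring] at this
    simp only [Code.dual]
    omega
  periodQ s h := by
    have := hc.periodQ s (-(h + 2 * cycleLength n))
    rw [show -(h + 2 * cycleLength n) + 2 * cycleLength n = -h by ring] at this
    simp only [Code.dual]
    omega
  lower s e he := by
    have := hc.upper s (-e) (he.neg_right)
    simp only [Code.dual, show 3 - (e + 1) = -e + 2 by ring]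
    omega
  upper s e he := by
    have := hc.lower s (-e) (he.neg_right)
    simp only [Code.dual, show 3 - (e + 2) = -e + 1 by ring]
    omega
  balance s e he := by
    have := hc.balance s (-e) (he.neg_right)
    simp only [Code.dual, show 3 - (e + 2) = -e + 1 by ring, show 3 - (e + 1) = -e + 2 by ring]
    omega
  symm h hh := by
    have := hc.symm h hh
    simp only [Code.dual, show 3 - (3 - h) = h by ring,
      show 3 - (3 - (h + 1)) = h + 1 by ring]
    omega
  disj h hh := by
    have := hc.disj h hh
    rw [show 2 - h + 1 = 3 - h by ring] at this
    simp only [Code.dual, show 3 - (h + 1) = 2 - h by ring, show 3 - (2 - h) = h + 1 by ring,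
      show 3 - (2 - h + 1) = h by ring]
    omega

/-- Turning upside down exchanges the two operators; the statements on `ẽᵢ` are deduced from those
on `f̃ᵢ` in this way. -/
theorem Code.dual_midE (b : ℤ) : (c.midE n b).dual = c.dual.midF n b := by
  have h1 : c.dual.a b < c.dual.a (b + 1) ↔ c.a (-b + 2) < c.a (-b + 3) := by
    simp only [dual, show 3 - b = -b + 3 by ring, show 3 - (b + 1) = -b + 2 by ring]
    omega
  have h2 : c.dual.a (-b) < c.dual.a (-b + 1) ↔ c.a (b + 2) < c.a (b + 3) := by
    simp only [dual, show 3 - -b = b + 3 by ring, show 3 - (-b + 1) = b + 2 by ring]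
    omega
  simp only [midE, midF, dual_bumpA, h1, h2]
  rw [bumpA_comm]
  congr 2
  · split_ifs <;> ring
  · split_ifs <;> ring

theorem Code.dual_midF (b : ℤ) : (c.midF n b).dual = c.dual.midE n b := by
  rw [← dual_dual (c := c.dual.midE n b), dual_midE, dual_dual]

theorem Code.IsSemi.midSymm (hc : c.IsSemi n l) {b : ℤ} (hb : Even b) :
    c.a (b + 1) + c.a (-b + 2) = c.a (b + 2) + c.a (-b + 1) := by
  have := hc.symm (b + 1) (hb.add_odd odd_one)
  rwa [show 3 - (b + 1) = -b + 2 by ring, show 3 - (b + 1 + 1) = -b + 1 by ring,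
    show b + 1 + 1 = b + 2 by ring] at this

theorem Code.IsSemi.midPhi_dual (hc : c.IsSemi n l) {b : ℤ} (hb : Even b) :
    c.dual.midPhi b = c.midEps b := by
  have := hc.midSymm hb
  simp only [midPhi, midEps, dual, show 3 - (b + 2) = -b + 1 by ring, show 3 - b = -b + 3 by ring,
    show 3 - (-b + 1) = b + 2 by ring, show 3 - -b = b + 3 by ring]
  omega

theorem Code.IsSliceCode.midE (hc : c.IsSliceCode n l) {b : ℤ} (hb : Even b)
    (hTb : ¬ cycleLength n ∣ b) (hε : 0 < c.midEps b) : (c.midE n b).IsSliceCode n l := by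
  have := (hc.dual.midF hb hTb (by rwa [hc.midPhi_dual hb])).dual
  rwa [dual_midF, dual_dual] at this

theorem Code.midPhi_midF {b : ℤ} (hb : Even b) (hTb : ¬ cycleLength n ∣ b) :
    (c.midF n b).midPhi b = c.midPhi b - 1 := by
  obtain ⟨z, hz⟩ := hb
  have ne := bump_of_ne hTb
  have eq : ∀ (f : ℤ → ℤ) (g k x : ℤ), x = g → bump n f g k x = f x + k :=
    fun f g k x h => bump_of_dvd (by simp [h])
  simp only [midPhi, midF, bumpA]
  by_cases h1 : c.a b < c.a (b + 1) <;> by_cases h2 : c.a (-b) < c.a (-b + 1) <;>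
    simp only [h1, h2, if_true, if_false]
  · rw [ne _ _ _ (b + 2) (by omega), ne _ _ _ (b + 2) (by omega), ne _ _ _ b (by omega),
      ne _ _ _ b (by omega), eq _ _ _ (-b + 1) (by omega), ne _ _ _ (-b + 1) (by omega),
      ne _ _ _ (-b) (by omega), ne _ _ _ (-b) (by omega)]
    ring
  · rw [eq _ _ _ (b + 2) (by omega), ne _ _ _ (b + 2) (by omega), ne _ _ _ b (by omega),
      ne _ _ _ b (by omega), ne _ _ _ (-b + 1) (by omega), ne _ _ _ (-b + 1) (by omega),
      ne _ _ _ (-b) (by omega), ne _ _ _ (-b) (by omega)]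
    ring
  · rw [ne _ _ _ (b + 2) (by omega), ne _ _ _ (b + 2) (by omega), ne _ _ _ b (by omega),
      ne _ _ _ b (by omega), eq _ _ _ (-b + 1) (by omega), ne _ _ _ (-b + 1) (by omega),
      ne _ _ _ (-b) (by omega), ne _ _ _ (-b) (by omega)]
    ring
  · rw [eq _ _ _ (b + 2) (by omega), ne _ _ _ (b + 2) (by omega), ne _ _ _ b (by omega),
      ne _ _ _ b (by omega), ne _ _ _ (-b + 1) (by omega), ne _ _ _ (-b + 1) (by omega),
      ne _ _ _ (-b) (by omega), ne _ _ _ (-b) (by omega)]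
    ring

theorem Code.midEps_midF {b : ℤ} (hb : Even b) (hTb : ¬ cycleLength n ∣ b) :
    (c.midF n b).midEps b = c.midEps b + 1 := by
  obtain ⟨z, hz⟩ := hb
  have ne := bump_of_ne hTb
  have eq : ∀ (f : ℤ → ℤ) (g k x : ℤ), x = g → bump n f g k x = f x + k :=
    fun f g k x h => bump_of_dvd (by simp [h])
  simp only [midEps, midF, bumpA]
  by_cases h1 : c.a b < c.a (b + 1) <;> by_cases h2 : c.a (-b) < c.a (-b + 1) <;>
    simp only [h1, h2, if_true, if_false]
  · rw [ne _ _ _ (b + 3) (by omega), ne _ _ _ (b + 3) (by omega), ne _ _ _ (b + 1) (by omega),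
      eq _ _ _ (b + 1) (by omega), ne _ _ _ (-b + 3) (by omega), ne _ _ _ (-b + 3) (by omega),
      ne _ _ _ (-b + 2) (by omega), ne _ _ _ (-b + 2) (by omega)]
    ring
  · rw [ne _ _ _ (b + 3) (by omega), ne _ _ _ (b + 3) (by omega), ne _ _ _ (b + 1) (by omega),
      eq _ _ _ (b + 1) (by omega), ne _ _ _ (-b + 3) (by omega), ne _ _ _ (-b + 3) (by omega),
      ne _ _ _ (-b + 2) (by omega), ne _ _ _ (-b + 2) (by omega)]
    ring
  · rw [ne _ _ _ (b + 3) (by omega), ne _ _ _ (b + 3) (by omega), ne _ _ _ (b + 1) (by omega),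
      ne _ _ _ (b + 1) (by omega), ne _ _ _ (-b + 3) (by omega), ne _ _ _ (-b + 3) (by omega),
      ne _ _ _ (-b + 2) (by omega), eq _ _ _ (-b + 2) (by omega)]
    ring
  · rw [ne _ _ _ (b + 3) (by omega), ne _ _ _ (b + 3) (by omega), ne _ _ _ (b + 1) (by omega),
      ne _ _ _ (b + 1) (by omega), ne _ _ _ (-b + 3) (by omega), ne _ _ _ (-b + 3) (by omega),
      ne _ _ _ (-b + 2) (by omega), eq _ _ _ (-b + 2) (by omega)]
    ring

/-- The choices of `ẽᵢ` recover those of `f̃ᵢ`: if the class `-b` was occupied, then `b + 2` was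
empty by `disj` and remains so; otherwise the step has put a layer there. Likewise with `b` and `-b`
exchanged. -/
theorem Code.IsSliceCode.midE_midF (hc : c.IsSliceCode n l) {b : ℤ} (hb : Even b)
    (hTb : ¬ cycleLength n ∣ b) : (c.midF n b).midE n b = c := by
  obtain ⟨z, hz⟩ := hb
  have ne := bump_of_ne hTb
  have d1 := hc.disj b ⟨z, hz⟩
  have d2 := hc.disj (-b) ⟨-z, by omega⟩
  have m1 := hc.mono (-b + 2)
  have m2 := hc.mono (b + 2)
  rw [show 2 - b = -b + 2 by ring, show -b + 2 + 1 = -b + 3 by ring] at d1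
  rw [show 2 - -b = b + 2 by ring, show b + 2 + 1 = b + 3 by ring] at d2
  rw [show -b + 2 + 1 = -b + 3 by ring] at m1
  rw [show b + 2 + 1 = b + 3 by ring] at m2
  set x := if c.a b < c.a (b + 1) then b + 1 else 2 - b with hx
  set y := if c.a (-b) < c.a (-b + 1) then -b + 1 else 2 - -b with hy
  have hF : c.midF n b = (c.bumpA n x (-1)).bumpA n y (-1) := rfl
  have v1 : (c.midF n b).a (b + 3) = c.a (b + 3) := by
    rw [hF]; simp only [bumpA]
    rw [ne _ _ _ _ (by rw [hy]; split_ifs <;> omega), ne _ _ _ _ (by rw [hx]; split_ifs <;> omega)]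
  have v2 : (c.midF n b).a (-b + 3) = c.a (-b + 3) := by
    rw [hF]; simp only [bumpA]
    rw [ne _ _ _ _ (by rw [hy]; split_ifs <;> omega), ne _ _ _ _ (by rw [hx]; split_ifs <;> omega)]
  have e1 : ((c.midF n b).a (b + 2) < (c.midF n b).a (b + 3)) ↔ ¬ c.a (-b) < c.a (-b + 1) := by
    rw [v1, hF]; simp only [bumpA]
    by_cases h : c.a (-b) < c.a (-b + 1)
    · rw [hy, if_pos h, ne _ _ _ _ (by omega), ne _ _ _ _ (by rw [hx]; split_ifs <;> omega)]
      omega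
    · rw [hy, if_neg h, bump_of_dvd (by rw [show b + 2 - (2 - -b) = 0 by ring]; exact dvd_zero _),
        ne _ _ _ _ (by rw [hx]; split_ifs <;> omega)]
      omega
  have e2 : ((c.midF n b).a (-b + 2) < (c.midF n b).a (-b + 3)) ↔ ¬ c.a b < c.a (b + 1) := by
    rw [v2, hF]; simp only [bumpA]
    by_cases h : c.a b < c.a (b + 1)
    · rw [hx, if_pos h, ne _ _ _ _ (by rw [hy]; split_ifs <;> omega), ne _ _ _ _ (by omega)]
      omega
    · rw [hx, if_neg h, ne _ _ _ _ (by rw [hy]; split_ifs <;> omega),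
        bump_of_dvd (by rw [show -b + 2 - (2 - b) = 0 by ring]; exact dvd_zero _)]
      omega
  have hE : (c.midF n b).midE n b = ((c.midF n b).bumpA n y 1).bumpA n x 1 := by
    have ey : (if (c.midF n b).a (b + 2) < (c.midF n b).a (b + 3) then b + 2 else 1 - b) = y := by
      simp only [hy, e1]; split_ifs <;> omega
    have ex : (if (c.midF n b).a (-b + 2) < (c.midF n b).a (-b + 3) then -b + 2 else 1 - -b) = x := by
      simp only [hx, e2]; split_ifs <;> omega
    rw [Code.midE, ey, ex]
  rw [hE, hF, bumpA_bumpA, neg_add_cancel, bumpA_zero, bumpA_bumpA, neg_add_cancel, bumpA_zero]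

theorem Code.IsSliceCode.midF_midE (hc : c.IsSliceCode n l) {b : ℤ} (hb : Even b)
    (hTb : ¬ cycleLength n ∣ b) : (c.midE n b).midF n b = c := by
  have := hc.dual.midE_midF hb hTb
  rw [← dual_midE, ← dual_midF] at this
  rw [← dual_dual (c := (c.midE n b).midF n b), this, dual_dual]

theorem Code.midPhi_nonneg (hc : c.Basic n l) (b : ℤ) : 0 ≤ c.midPhi b := by
  have := hc.monotone (show b ≤ b + 2 by omega)
  have := hc.monotone (show -b ≤ -b + 1 by omega)
  unfold midPhi; omega

theorem Code.midEps_nonneg (hc : c.Basic n l) (b : ℤ) : 0 ≤ c.midEps b := by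
  have := hc.monotone (show b + 1 ≤ b + 3 by omega)
  have := hc.monotone (show -b + 2 ≤ -b + 3 by omega)
  unfold midEps; omega

/-! ### The operators for `i = 0, 1, n - 1, n` on codes -/

/-- `f̃ᵢ` on codes, where `e` is the height at the bottom of a row of half-unit depth blocks and the
blocks of colour `i` are on the side `s`. -/
def Code.endF (n : ℕ) (s : Side) (e : ℤ) (c : Code) : Code :=
  (c.bumpA n (if c.a e < c.a (e + 1) then e + 1 else e + 2) (-1)).bumpQ n s e (-1)

/-- `ẽᵢ` on codes; see `Code.endF`. -/
def Code.endE (n : ℕ) (s : Side) (e : ℤ) (c : Code) : Code :=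
  (c.bumpA n (if c.a (e + 2) < c.a (e + 3) then e + 2 else e + 1) 1).bumpQ n s e 1

/-- After un-splitting, the layers with a free place on the side `s` have indices `[a e, Q s e)`:
flat layers of height `e`, followed by those with a single block on the other side if there are any.
-/
def Code.endPhi (s : Side) (e : ℤ) (c : Code) : ℤ := c.Q s e - c.a e

/-- After un-splitting, `[Q s e, a (e + 3))` consists of the layers with a removable block on the
side `s`. -/
def Code.endEps (s : Side) (e : ℤ) (c : Code) : ℤ := c.a (e + 3) - c.Q s e

theorem Code.bumpQ_self (s : Side) (e k : ℤ) : (c.bumpQ n s e k).Q s = bump n (c.Q s) e k := by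
  simp [bumpQ]

theorem Code.bumpQ_swap (s : Side) (e k : ℤ) : (c.bumpQ n s e k).Q s.swap = c.Q s.swap := by
  simp [bumpQ, Side.swap_ne]

theorem Code.bumpQ_bumpQ (s : Side) (x k k' : ℤ) :
    (c.bumpQ n s x k).bumpQ n s x k' = c.bumpQ n s x (k + k') := by
  ext y z
  · rfl
  · simp only [bumpQ, Function.update_self, Function.update_idem]
    by_cases h : y = s
    · subst h; simp only [Function.update_self, bump]; split_ifs <;> ring
    · simp [h]

theorem Code.bumpQ_zero (s : Side) (x : ℤ) : c.bumpQ n s x 0 = c := by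
  ext y z
  · rfl
  · by_cases h : y = s
    · subst h; simp [bumpQ, bump]
    · simp [bumpQ, h]

theorem Code.bumpA_bumpQ (s : Side) (x g k k' : ℤ) :
    (c.bumpQ n s x k).bumpA n g k' = (c.bumpA n g k').bumpQ n s x k := rfl

theorem forall_side {P : Side → Prop} (s : Side) (h1 : P s) (h2 : P s.swap) : ∀ t, P t := by
  intro t
  by_cases h : t = s
  · rwa [h]
  · rwa [Side.eq_swap_of_ne h]

theorem Code.Basic.lowerQ (hc : c.Basic n l) {s : Side} {e : ℤ} (h : c.a (e + 1) < c.Q s e) :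
    (c.bumpQ n s e (-1)).Basic n l where
  mono := hc.mono
  period := hc.period
  periodQ := forall_side s (by rw [bumpQ_self]; exact (hc.periodQ s).bump _ _)
    (by rw [bumpQ_swap]; exact hc.periodQ _)
  upper := forall_side s (fun x hx => by
      rw [bumpQ_self]; exact (bump_le _ _ (by norm_num) _).trans (hc.upper s x hx))
    (fun x hx => by rw [bumpQ_swap]; exact hc.upper _ x hx)
  lower := forall_side s (fun x hx => by
      rw [bumpQ_self]
      by_cases hd : 2 * cycleLength n ∣ x - e
      · rw [bump_of_dvd hd]
        obtain ⟨m, rfl⟩ := exists_eq_add_mul_of_dvd hd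
        rw [(hc.periodQ s).add_mul, show e + 2 * cycleLength n * m + 1 =
          e + 1 + 2 * cycleLength n * m by ring]
        change c.a _ ≤ _
        rw [hc.period.add_mul]
        omega
      · rw [bump_of_not_dvd hd]; exact hc.lower s x hx)
    (fun x hx => by rw [bumpQ_swap]; exact hc.lower _ x hx)

theorem Code.Basic.raiseQ (hc : c.Basic n l) {s : Side} {e : ℤ} (h : c.Q s e < c.a (e + 2)) :
    (c.bumpQ n s e 1).Basic n l where
  mono := hc.mono
  period := hc.period
  periodQ := forall_side s (by rw [bumpQ_self]; exact (hc.periodQ s).bump _ _)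
    (by rw [bumpQ_swap]; exact hc.periodQ _)
  lower := forall_side s (fun x hx => by
      rw [bumpQ_self]; exact (hc.lower s x hx).trans (le_bump _ _ (by norm_num) _))
    (fun x hx => by rw [bumpQ_swap]; exact hc.lower _ x hx)
  upper := forall_side s (fun x hx => by
      rw [bumpQ_self]
      by_cases hd : 2 * cycleLength n ∣ x - e
      · rw [bump_of_dvd hd]
        obtain ⟨m, rfl⟩ := exists_eq_add_mul_of_dvd hd
        rw [(hc.periodQ s).add_mul, show e + 2 * cycleLength n * m + 2 =
          e + 2 + 2 * cycleLength n * m by ring]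
        change _ ≤ c.a _
        rw [hc.period.add_mul]
        omega
      · rw [bump_of_not_dvd hd]; exact hc.upper s x hx)
    (fun x hx => by rw [bumpQ_swap]; exact hc.upper _ x hx)

theorem Code.Basic.end_lower_fst (hc : c.Basic n l) {s : Side} {e : ℤ} (he : cycleLength n ∣ e)
    (h : c.a e < c.a (e + 1)) : ((c.bumpA n (e + 1) (-1)).bumpQ n s e (-1)).Basic n l := by
  have b1 : (c.bumpA n (e + 1) (-1)).Basic n l := hc.lowerA (by rwa [add_sub_cancel_right])
    (fun hd => (not_dvd_of_odd (by
      rw [show e + 1 - 2 = e - 1 by ring]; exact (even_of_dvd he).sub_odd odd_one) hd).elim)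
  refine b1.lowerQ ?_
  have := hc.lower s e he
  simp only [bumpA]
  rw [bump_of_dvd (by simp)]
  omega

theorem Code.Basic.end_lower_snd (hc : c.Basic n l) {s : Side} {e : ℤ} (he : cycleLength n ∣ e)
    (h : c.a (e + 1) < c.Q s e) (h' : c.Q s.swap e < c.a (e + 2)) :
    ((c.bumpA n (e + 2) (-1)).bumpQ n s e (-1)).Basic n l := by
  have u1 := hc.upper s e he
  rw [← bumpA_bumpQ]
  have b1 : (c.bumpQ n s e (-1)).Basic n l := hc.lowerQ h
  refine b1.lowerA ?_ fun _ => ?_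
  · change c.a (e + 2 - 1) < c.a (e + 2)
    rw [show e + 2 - 1 = e + 1 by ring]
    omega
  · rw [add_sub_cancel_right]
    change ∀ t, _ < c.a (e + 2)
    refine forall_side s ?_ ?_
    · rw [bumpQ_self, bump_of_dvd (by simp)]
      omega
    · rw [bumpQ_swap]; omega

theorem Code.Basic.end_raise_snd (hc : c.Basic n l) {s : Side} {e : ℤ} (he : cycleLength n ∣ e)
    (h : c.a (e + 2) < c.a (e + 3)) : ((c.bumpA n (e + 2) 1).bumpQ n s e 1).Basic n l := by
  have b1 : (c.bumpA n (e + 2) 1).Basic n l := hc.raiseA (by rwa [show e + 2 + 1 = e + 3 by ring])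
    (fun hd => (not_dvd_of_odd (by
      rw [show e + 2 - 1 = e + 1 by ring]; exact (even_of_dvd he).add_one) hd).elim)
  refine b1.raiseQ ?_
  have := hc.upper s e he
  simp only [bumpA]
  rw [bump_of_dvd (by simp)]
  omega

theorem Code.Basic.end_raise_fst (hc : c.Basic n l) {s : Side} {e : ℤ} (he : cycleLength n ∣ e)
    (h : c.Q s e < c.a (e + 2)) (h' : c.a (e + 1) < c.Q s.swap e) :
    ((c.bumpA n (e + 1) 1).bumpQ n s e 1).Basic n l := by
  have u1 := hc.lower s e he
  rw [← bumpA_bumpQ]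
  have b1 : (c.bumpQ n s e 1).Basic n l := hc.raiseQ h
  refine b1.raiseA ?_ fun _ => ?_
  · change c.a (e + 1) < c.a (e + 1 + 1)
    rw [show e + 1 + 1 = e + 2 by ring]
    omega
  · rw [add_sub_cancel_right]
    change ∀ t, c.a (e + 1) < _
    refine forall_side s ?_ ?_
    · rw [bumpQ_self, bump_of_dvd (by simp)]
      omega
    · rw [bumpQ_swap]; omega

/-- The points `e + 1` and `e + 2` are exchanged by `h ↦ 3 - h` up to the period, so either bump
changes the right side of `balance` by `k`, and the bump of `Q` does the same on the left. -/
theorem Code.IsSemi.end_step (hc : c.IsSemi n l) {s : Side} {e x k : ℤ} (he : cycleLength n ∣ e)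
    (hx : x = e + 1 ∨ x = e + 2) (hb : ((c.bumpA n x k).bumpQ n s e k).Basic n l) :
    ((c.bumpA n x k).bumpQ n s e k).IsSemi n l := by
  have hee := even_of_dvd he
  have d2 : 2 * cycleLength n ∣ e + 2 - (2 - e) := by
    rw [show e + 2 - (2 - e) = 2 * e by ring]; exact mul_dvd_mul_left 2 he
  obtain ⟨m, hm⟩ := exists_eq_add_mul_of_dvd d2
  set c' := (c.bumpA n x k).bumpQ n s e k with hc'
  have key : ∀ h, c'.a h + c'.a (3 - h) = c.a h + c.a (3 - h) +
      k * (cls n (h - (e + 1)) + cls n (h - (2 - e))) := fun h => by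
    rcases hx with rfl | rfl
    · exact bump_add_reflect _ _ h (.inl rfl)
    · have := bump_add_reflect (n := n) c.a k h (b := e) (x := 2 - e) (.inr rfl)
      rw [← bump_add_mul c.a (2 - e) k m, ← hm] at this
      exact this
  have cls2 : ∀ z, cls n (z - (2 - e)) = cls n (z - (e + 2)) := fun z => by
    unfold cls
    congr 1
    rw [hm, ← sub_sub]
    exact propext (dvd_sub_left (Dvd.intro _ rfl)).symm
  refine ⟨hb, ?_, fun h hh => ?_⟩
  · have bal' : ∀ z, cycleLength n ∣ z → c'.Q s z + c'.Q s.swap z =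
        c'.a (z + 1) + c'.a (z + 2) := by
      intro z hz
      have h1 := key (z + 1)
      have h2 := hc.balance s z hz
      have h5 : cls n (z + 1 - (2 - e)) = 0 := cls_eq_zero (not_two_mul_dvd_of_odd
        ((even_of_dvd hz).add_one.sub_even (even_two.sub hee)))
      obtain ⟨y, hy⟩ := hz
      have e1 : (3 : ℤ) - (z + 1) + 2 * cycleLength n * y = z + 2 := by linarith
      have p1 := hc.period.add_mul (3 - (z + 1)) y
      have p2 := hb.period.add_mul (3 - (z + 1)) y
      rw [e1] at p1 p2
      have h3 : c'.Q s z = c.Q s z + k * cls n (z - e) := by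
        rw [hc', bumpQ_self, bump_eq_cls]; rfl
      have h4 : c'.Q s.swap z = c.Q s.swap z := by
        rw [hc', bumpQ_swap]; rfl
      rw [h5, show z + 1 - (e + 1) = z - e by ring, add_zero] at h1
      omega
    refine forall_side s bal' fun z hz => ?_
    rw [Side.swap_swap, add_comm]
    exact bal' z hz
  · rw [key, key, hc.symm h hh]
    have h1 : cls n (h - (2 - e)) = 0 := cls_eq_zero (not_two_mul_dvd_of_odd
      (hh.sub_even (even_two.sub hee)))
    have h2 : cls n (h + 1 - (e + 1)) = 0 := cls_eq_zero (not_two_mul_dvd_of_odd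
      (by rw [show h + 1 - (e + 1) = h - e by ring]; exact hh.sub_even hee))
    rw [h1, h2, cls2, show h + 1 - (e + 2) = h - (e + 1) by ring]
    ring

theorem Code.IsSliceCode.endF (hc : c.IsSliceCode n l) {s : Side} {e : ℤ}
    (he : cycleLength n ∣ e) (hφ : 0 < c.endPhi s e) : (c.endF n s e).IsSliceCode n l := by
  have m1 := hc.mono e
  have l1 := hc.lower s e he
  have bal := hc.balance s e he
  unfold endPhi at hφ
  have hb : (c.endF n s e).Basic n l := by
    rw [Code.endF]
    split_ifs with h
    · exact hc.end_lower_fst he h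
    · exact hc.end_lower_snd he (by omega) (by omega)
  refine ⟨hc.end_step he (by split_ifs <;> simp) hb, ?_⟩
  have hd : c.Disj := hc.disj
  refine hd.lower hc.toBasic (fun hxe => ?_) hb.mono
  obtain ⟨w, hw⟩ := hxe
  obtain ⟨z, hz⟩ := even_of_dvd he
  split_ifs at hw ⊢ with h
  · omega
  · obtain ⟨k, hk⟩ := he
    have := hc.step_iff (2 - (e + 2)) k
    rw [show 2 - (e + 2) + 2 * cycleLength n * k = e by linarith] at this
    omega

theorem Code.dual_endE {s : Side} {e : ℤ} :
    (c.endE n s e).dual = c.dual.endF n s (-e) := by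
  have h1 : c.dual.a (-e) < c.dual.a (-e + 1) ↔ c.a (e + 2) < c.a (e + 3) := by
    simp only [dual, show 3 - -e = e + 3 by ring, show 3 - (-e + 1) = e + 2 by ring]
    omega
  rw [Code.endE, Code.endF, dual_bumpQ, dual_bumpA]
  simp only [h1]
  congr 1
  split_ifs
  · congr 1; ring
  · congr 1; ring

theorem Code.dual_endF {s : Side} {e : ℤ} : (c.endF n s e).dual = c.dual.endE n s (-e) := by
  have := Code.dual_endE (n := n) (c := c.dual) (s := s) (e := -e)
  rw [dual_dual, neg_neg] at this
  rw [← this, dual_dual]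

theorem Code.endPhi_dual (s : Side) (e : ℤ) : c.dual.endPhi s (-e) = c.endEps s e := by
  simp only [endPhi, endEps, dual, neg_neg, sub_neg_eq_add]; ring_nf

theorem Code.IsSliceCode.endE (hc : c.IsSliceCode n l) {s : Side} {e : ℤ}
    (he : cycleLength n ∣ e) (hε : 0 < c.endEps s e) : (c.endE n s e).IsSliceCode n l := by
  have := (hc.dual.endF (s := s) he.neg_right (by rwa [endPhi_dual])).dual
  rwa [dual_endF, neg_neg, dual_dual] at this

/-- The heights around a row of half-unit depth blocks are pairwise incongruent. -/
theorem bump_of_ne_end (f : ℤ → ℤ) (g k x : ℤ) (h : (x - g) % 2 = 1 ∨ (x - g) % 4 = 2) :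
    bump n f g k x = f x := bump_of_not_dvd (not_two_mul_dvd_of h)

theorem Code.endPhi_endF (s : Side) (e : ℤ) :
    (c.endF n s e).endPhi s e = c.endPhi s e - 1 := by
  simp only [endPhi, Code.endF]
  rw [bumpQ_self, bump_of_dvd (by simp)]
  simp only [bumpQ, bumpA]
  rw [bump_of_ne_end _ _ _ e (by split_ifs <;> omega)]
  ring

theorem Code.endEps_endF (s : Side) (e : ℤ) :
    (c.endF n s e).endEps s e = c.endEps s e + 1 := by
  simp only [endEps, Code.endF]
  rw [bumpQ_self, bump_of_dvd (by simp)]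
  simp only [bumpQ, bumpA]
  rw [bump_of_ne_end _ _ _ (e + 3) (by split_ifs <;> omega)]
  ring

/-- By `disj` the classes `e` and `e + 2` are not both occupied, so after the step `e + 2` is
occupied precisely if `f̃ᵢ` chose the second alternative. -/
theorem Code.IsSliceCode.endE_endF (hc : c.IsSliceCode n l) {s : Side} {e : ℤ}
    (he : cycleLength n ∣ e) : (c.endF n s e).endE n s e = c := by
  have hd := hc.disj e (even_of_dvd he)
  have hm := hc.mono (e + 2)
  obtain ⟨k, hk⟩ := he
  have h1 := hc.step_iff (2 - e) k
  rw [show 2 - e + 2 * cycleLength n * k = e + 2 by linarith, show e + 2 + 1 = e + 3 by ring] at h1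
  rw [← h1] at hd
  rw [show e + 2 + 1 = e + 3 by ring] at hm
  have h2 : ((c.endF n s e).a (e + 2) < (c.endF n s e).a (e + 3)) ↔ ¬ c.a e < c.a (e + 1) := by
    simp only [Code.endF, bumpQ, bumpA]
    rw [bump_of_ne_end _ _ _ (e + 3) (by split_ifs <;> omega)]
    by_cases h : c.a e < c.a (e + 1)
    · rw [if_pos h, bump_of_ne_end _ _ _ (e + 2) (by omega)]; omega
    · rw [if_neg h, bump_of_dvd (by simp)]; omega
  have h3 : (c.endF n s e).endE n s e =
      ((c.endF n s e).bumpA n (if c.a e < c.a (e + 1) then e + 1 else e + 2) 1).bumpQ n s e 1 := by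
    simp only [Code.endE, h2]
    congr 2
    split_ifs <;> rfl
  rw [h3, Code.endF, bumpA_bumpQ, bumpA_bumpA, neg_add_cancel, bumpA_zero, bumpQ_bumpQ,
    neg_add_cancel, bumpQ_zero]

theorem Code.IsSliceCode.endF_endE (hc : c.IsSliceCode n l) {s : Side} {e : ℤ}
    (he : cycleLength n ∣ e) : (c.endE n s e).endF n s e = c := by
  have := hc.dual.endE_endF (s := s) he.neg_right
  rw [← dual_endE, ← neg_neg e, neg_neg (-e), ← dual_endF] at this
  rw [← dual_dual (c := (c.endE n s e).endF n s e)]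
  simpa [dual_dual] using congrArg Code.dual this

end

end YoungWall

namespace YoungWall

section
variable {n l : ℕ} {C : Layers l} {c : Code}

/-! ### The operators for `2 ≤ i ≤ n - 2` on slices -/

/-- The layer is selected in `C` but may receive its half after another layer has been changed. The
index stays correct for every `C'` whose boundary `a (x + 1)` is the same, hence the quantification.
-/
theorem Rep.rearmost_put (hn : 4 ≤ n) (hl : 1 ≤ l) (hc : c.Basic n l) (hC : Rep n C c)
    {S : Fin l → Bool} {x : ℤ}
    (hS : ∀ p, S p = true ↔ 2 * cycleLength n ∣ (C p).height - x ∧ ∀ s, (C p).top ≠ .single s)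
    (hT : ¬ cycleLength n ∣ x - 1) (hx : c.a x < c.a (x + 1)) :
    ∃ p, rearmostLowest (rows C) S = some p ∧ ∀ (C' : Layers l) (c' : Code), c'.Basic n l →
      Rep n C' c' → c'.a x < c'.a (x + 1) → c'.a (x + 1) = c.a (x + 1) →
      Rep n (putHalfAt C' p) (c'.bumpA n (x + 1) (-1)) ∧ (c'.bumpA n (x + 1) (-1)).Basic n l := by
  obtain ⟨p, m, h1, h2⟩ := hC.rearmost_class hn hl hc hS hx fun h => (hT h).elim
  refine ⟨p, h1, fun C' c' hc' hC' h3 h4 => ?_⟩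
  have h5 : cycleLength n ∣ x + 1 - 2 → ∀ s, c'.Q s (x + 1 - 2) < c'.a (x + 1) := by
    rw [show x + 1 - 2 = x - 1 by ring]; exact fun h => (hT h).elim
  rw [← add_sub_cancel_right x 1] at h3
  rw [add_sub_cancel_right] at h3
  exact ⟨hC'.put_half hn hc' (by rwa [add_sub_cancel_right]) h5 (by rw [h2, h4]),
    hc'.lowerA (by rwa [add_sub_cancel_right]) h5⟩

theorem Rep.foremost_take (hn : 4 ≤ n) (hl : 1 ≤ l) (hc : c.Basic n l) (hC : Rep n C c)
    {S : Fin l → Bool} {x : ℤ}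
    (hS : ∀ p, S p = true ↔ 2 * cycleLength n ∣ (C p).height - x ∧ ∀ s, (C p).top ≠ .single s)
    (hT : ¬ cycleLength n ∣ x - 1) (hx : c.a x < c.a (x + 1)) :
    ∃ p, foremostHighest (rows C) S = some p ∧ ∀ (C' : Layers l) (c' : Code), c'.Basic n l →
      Rep n C' c' → c'.a x < c'.a (x + 1) → c'.a x = c.a x →
      Rep n (takeHalfAt C' p) (c'.bumpA n x 1) ∧ (c'.bumpA n x 1).Basic n l := by
  obtain ⟨p, m, h1, h2⟩ := hC.foremost_class hn hl hc hS hx fun h => (hT h).elim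
  refine ⟨p, h1, fun C' c' hc' hC' h3 h4 => ?_⟩
  exact ⟨hC'.take_half hn hc' h3 (fun h => (hT h).elim) (by rw [h2, h4]),
    hc'.raiseA h3 fun h => (hT h).elim⟩

theorem Rep.rearmost_none (hc : c.Basic n l) (hC : Rep n C c) {S : Fin l → Bool} {x : ℤ}
    {h : Fin l → ℤ}
    (hS : ∀ p, S p = true ↔ 2 * cycleLength n ∣ (C p).height - x ∧ ∀ s, (C p).top ≠ .single s)
    (hx : ¬ c.a x < c.a (x + 1)) : rearmostLowest h S = none :=
  rearmostLowest_eq_none fun p => Bool.eq_false_iff.2 fun h =>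
    hC.class_empty hc (le_antisymm (hc.mono x) (not_lt.1 hx)) p ((hS p).1 h).1

theorem Rep.foremost_none (hc : c.Basic n l) (hC : Rep n C c) {S : Fin l → Bool} {x : ℤ}
    {h : Fin l → ℤ}
    (hS : ∀ p, S p = true ↔ 2 * cycleLength n ∣ (C p).height - x ∧ ∀ s, (C p).top ≠ .single s)
    (hx : ¬ c.a x < c.a (x + 1)) : foremostHighest h S = none :=
  foremostHighest_eq_none fun p => Bool.eq_false_iff.2 fun h =>
    hC.class_empty hc (le_antisymm (hc.mono x) (not_lt.1 hx)) p ((hS p).1 h).1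

theorem not_cycleLength_dvd {i : ℕ} (hi : 2 ≤ i ∧ i + 2 ≤ n) :
    ¬ cycleLength n ∣ 2 * (i : ℤ) - 2 := fun h => by
  have := Int.le_of_dvd (by omega) h
  unfold cycleLength at this
  omega

/-- The cases of the definition correspond to the two independent alternatives in `Code.midF`. When
a second half goes on a half-slot of the same role, its class contains the half just placed. Without
full slots, `midSymm` ensures that halves of both roles exist or neither. -/
theorem Rep.fMid (hn : 4 ≤ n) (hl : 1 ≤ l) (hc : c.IsSliceCode n l) (hC : Rep n C c) {i : ℕ}
    (hi : 2 ≤ i ∧ i + 2 ≤ n) {b : ℤ} (hb : b = 2 * i - 2) :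
    (c.midPhi b = 0 → fMid n i C = none) ∧
      (0 < c.midPhi b → ∃ C', fMid n i C = some C' ∧ Rep n C' (c.midF n b)) := by
  have hbz : b = (i - 1) + (i - 1) := by rw [hb]; ring
  have hTb : ¬ cycleLength n ∣ b := hb ▸ not_cycleLength_dvd hi
  have hTb' : ¬ cycleLength n ∣ -b := by rwa [dvd_neg]
  have ne := bump_of_ne hTb
  have eq : ∀ (f : ℤ → ℤ) (g k x : ℤ), x = g → bump n f g k x = f x + k :=
    fun f g k x h => bump_of_dvd (by simp [h])
  have b1 : 2 * baseRow n (.mid i) .supporting = b := by simp only [baseRow]; omega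
  have b2 : 2 * baseRow n (.mid i) .covering = -b := by simp only [baseRow]; omega
  have hS1 := fun (C : Layers l) p => topSlot_iff hn (j := .mid i) hi .supporting (C p)
  have hS2 := fun (C : Layers l) p => topSlot_iff hn (j := .mid i) hi .covering (C p)
  have hH1 := fun (C : Layers l) p => topHalf_iff hn (j := .mid i) hi .supporting (C p)
  have hH2 := fun (C : Layers l) p => topHalf_iff hn (j := .mid i) hi .covering (C p)
  simp only [b1, b2] at hS1 hS2 hH1 hH2
  have t0 : ∀ x, Even x → ¬ cycleLength n ∣ x - 1 := fun x hx =>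
    not_dvd_of_odd (hx.sub_odd odd_one)
  have hbe : Even b := ⟨_, hbz⟩
  have t1 := t0 _ hbe
  have t2 := t0 _ hbe.neg
  have t3 : ¬ cycleLength n ∣ b + 1 - 1 := by rwa [add_sub_cancel_right]
  have t4 : ¬ cycleLength n ∣ -b + 1 - 1 := by rwa [add_sub_cancel_right]
  have s1 := hc.midSymm hbe
  have m1 := hc.mono b
  have m2 := hc.mono (-b)
  have m3 := hc.mono (b + 1)
  have m4 := hc.mono (-b + 1)
  have a2 : b + 1 + 1 = b + 2 := by ring
  have a2' : -b + 1 + 1 = -b + 2 := by ring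
  rw [a2] at m3
  rw [a2'] at m4
  have hcb := hc.toBasic
  unfold Code.midPhi
  by_cases h1 : c.a b < c.a (b + 1)
  · refine ⟨fun h => by omega, fun _ => ?_⟩
    obtain ⟨p, hp, hp'⟩ := hC.rearmost_put hn hl hcb (hS1 C) t1 h1
    obtain ⟨r1, B1⟩ := hp' C c hcb hC h1 rfl
    by_cases h2 : c.a (-b) < c.a (-b + 1)
    · obtain ⟨q, hq, hq'⟩ := hC.rearmost_put hn hl hcb (hS2 C) t2 h2
      obtain ⟨r2, -⟩ := hq' _ _ B1 r1
        (by simp only [Code.bumpA]; rwa [ne _ _ _ (-b) (by omega), ne _ _ _ (-b + 1) (by omega)])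
        (by simp only [Code.bumpA]; rw [ne _ _ _ (-b + 1) (by omega)])
      refine ⟨_, by simp only [YoungWall.fMid, hp, hq]; rfl, ?_⟩
      rw [Code.midF, if_pos h1, if_pos h2]
      exact r2
    · have hq := hC.rearmost_none (h := rows C) hcb (hS2 C) h2
      have h3 : (c.bumpA n (b + 1) (-1)).a (b + 1) < (c.bumpA n (b + 1) (-1)).a (b + 1 + 1) := by
        simp only [Code.bumpA]
        rw [eq _ _ _ _ rfl, ne _ _ _ (b + 1 + 1) (by omega), a2]; omega
      obtain ⟨q', hq', hq''⟩ := r1.rearmost_put hn hl B1 (hH1 _) t3 h3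
      obtain ⟨r2, -⟩ := hq'' _ _ B1 r1 h3 rfl
      refine ⟨_, by simp only [YoungWall.fMid, hp, hq, hq', Option.map_some]; rfl, ?_⟩
      rw [Code.midF, if_pos h1, if_neg h2, show 2 - -b = b + 1 + 1 by ring]
      exact r2
  · have hp := hC.rearmost_none (h := rows C) hcb (hS1 C) h1
    by_cases h2 : c.a (-b) < c.a (-b + 1)
    · refine ⟨fun h => by omega, fun _ => ?_⟩
      obtain ⟨q, hq, hq'⟩ := hC.rearmost_put hn hl hcb (hS2 C) t2 h2
      obtain ⟨r1, B1⟩ := hq' C c hcb hC h2 rfl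
      have h3 : (c.bumpA n (-b + 1) (-1)).a (-b + 1) <
          (c.bumpA n (-b + 1) (-1)).a (-b + 1 + 1) := by
        simp only [Code.bumpA]
        rw [eq _ _ _ _ rfl, ne _ _ _ (-b + 1 + 1) (by omega), a2']; omega
      obtain ⟨q', hq', hq''⟩ := r1.rearmost_put hn hl B1 (hH2 _) t4 h3
      obtain ⟨r2, -⟩ := hq'' _ _ B1 r1 h3 rfl
      refine ⟨_, by simp only [YoungWall.fMid, hp, hq, hq', Option.map_some]; rfl, ?_⟩
      rw [Code.midF, if_neg h1, if_pos h2, show 2 - b = -b + 1 + 1 by ring, Code.bumpA_comm]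
      exact r2
    · have hq := hC.rearmost_none (h := rows C) hcb (hS2 C) h2
      constructor
      · intro h
        have hp' := hC.rearmost_none (h := rows C) hcb (hH1 C) (by rw [a2]; omega)
        simp only [YoungWall.fMid, hp, hq, hp']
      · intro h
        have h3 : c.a (b + 1) < c.a (b + 1 + 1) := by rw [a2]; omega
        have h4 : c.a (-b + 1) < c.a (-b + 1 + 1) := by rw [a2']; omega
        obtain ⟨p', hp', hp''⟩ := hC.rearmost_put hn hl hcb (hH1 _) t3 h3
        obtain ⟨q', hq', hq''⟩ := hC.rearmost_put hn hl hcb (hH2 _) t4 h4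
        obtain ⟨r1, B1⟩ := hp'' _ _ hcb hC h3 rfl
        obtain ⟨r2, -⟩ := hq'' _ _ B1 r1
          (by
            simp only [Code.bumpA]
            rwa [ne _ _ _ (-b + 1) (by omega), ne _ _ _ (-b + 1 + 1) (by omega)])
          (by simp only [Code.bumpA]; rw [ne _ _ _ (-b + 1 + 1) (by omega)])
        refine ⟨_, by simp only [YoungWall.fMid, hp, hq, hp', hq']; rfl, ?_⟩
        rw [Code.midF, if_neg h1, if_neg h2, show 2 - b = -b + 1 + 1 by ring,
          show 2 - -b = b + 1 + 1 by ring, Code.bumpA_comm]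
        exact r2

theorem Rep.eMid (hn : 4 ≤ n) (hl : 1 ≤ l) (hc : c.IsSliceCode n l) (hC : Rep n C c) {i : ℕ}
    (hi : 2 ≤ i ∧ i + 2 ≤ n) {b : ℤ} (hb : b = 2 * i - 2) :
    (c.midEps b = 0 → eMid n i C = none) ∧
      (0 < c.midEps b → ∃ C', eMid n i C = some C' ∧ Rep n C' (c.midE n b)) := by
  have hbz : b = (i - 1) + (i - 1) := by rw [hb]; ring
  have hTb : ¬ cycleLength n ∣ b := hb ▸ not_cycleLength_dvd hi
  have hTb' : ¬ cycleLength n ∣ -b := by rwa [dvd_neg]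
  have ne := bump_of_ne hTb
  have eq : ∀ (f : ℤ → ℤ) (g k x : ℤ), x = g → bump n f g k x = f x + k :=
    fun f g k x h => bump_of_dvd (by simp [h])
  have b1 : 2 * baseRow n (.mid i) .supporting = b := by simp only [baseRow]; omega
  have b2 : 2 * baseRow n (.mid i) .covering = -b := by simp only [baseRow]; omega
  have hS1 := fun (C : Layers l) p => topBlock_iff hn (j := .mid i) hi .supporting (C p)
  have hS2 := fun (C : Layers l) p => topBlock_iff hn (j := .mid i) hi .covering (C p)
  have hH1 := fun (C : Layers l) p => topHalf_iff hn (j := .mid i) hi .supporting (C p)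
  have hH2 := fun (C : Layers l) p => topHalf_iff hn (j := .mid i) hi .covering (C p)
  simp only [b1, b2] at hS1 hS2 hH1 hH2
  have t0 : ∀ x, Even x → ¬ cycleLength n ∣ x - 1 := fun x hx =>
    not_dvd_of_odd (hx.sub_odd odd_one)
  have hbe : Even b := ⟨_, hbz⟩
  have t1 := t0 _ (hbe.add even_two)
  have t2 := t0 _ (hbe.neg.add even_two)
  have t3 : ¬ cycleLength n ∣ b + 1 - 1 := by rwa [add_sub_cancel_right]
  have t4 : ¬ cycleLength n ∣ -b + 1 - 1 := by rwa [add_sub_cancel_right]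
  have s1 := hc.midSymm hbe
  have m1 := hc.mono (b + 2)
  have m2 := hc.mono (-b + 2)
  have m3 := hc.mono (b + 1)
  have m4 := hc.mono (-b + 1)
  have a2 : b + 1 + 1 = b + 2 := by ring
  have a2' : -b + 1 + 1 = -b + 2 := by ring
  have a3 : b + 2 + 1 = b + 3 := by ring
  have a3' : -b + 2 + 1 = -b + 3 := by ring
  rw [a2] at m3
  rw [a2'] at m4
  rw [a3] at m1
  rw [a3'] at m2
  have hcb := hc.toBasic
  unfold Code.midEps
  by_cases h1 : c.a (b + 2) < c.a (b + 3)
  · refine ⟨fun h => by omega, fun _ => ?_⟩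
    obtain ⟨p, hp, hp'⟩ := hC.foremost_take hn hl hcb (hS1 C) t1 (by rwa [a3])
    obtain ⟨r1, B1⟩ := hp' C c hcb hC (by rwa [a3]) rfl
    by_cases h2 : c.a (-b + 2) < c.a (-b + 3)
    · obtain ⟨q, hq, hq'⟩ := hC.foremost_take hn hl hcb (hS2 C) t2 (by rwa [a3'])
      obtain ⟨r2, -⟩ := hq' _ _ B1 r1
        (by
          simp only [Code.bumpA]
          rwa [ne _ _ _ (-b + 2) (by omega), ne _ _ _ (-b + 2 + 1) (by omega), a3'])
        (by simp only [Code.bumpA]; rw [ne _ _ _ (-b + 2) (by omega)])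
      refine ⟨_, by simp only [YoungWall.eMid, hp, hq]; rfl, ?_⟩
      rw [Code.midE, if_pos h1, if_pos h2]
      exact r2
    · have hq := hC.foremost_none (h := rows C) hcb (hS2 C) (by rwa [a3'])
      have h3 : (c.bumpA n (b + 2) 1).a (b + 1) < (c.bumpA n (b + 2) 1).a (b + 1 + 1) := by
        simp only [Code.bumpA]
        rw [ne _ _ _ _ (by omega), eq _ _ _ (b + 1 + 1) a2, a2]; omega
      obtain ⟨q', hq', hq''⟩ := r1.foremost_take hn hl B1 (hH1 _) t3 h3
      obtain ⟨r2, -⟩ := hq'' _ _ B1 r1 h3 rfl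
      refine ⟨_, by simp only [YoungWall.eMid, hp, hq, hq', Option.map_some]; rfl, ?_⟩
      rw [Code.midE, if_pos h1, if_neg h2, show 1 - -b = b + 1 by ring]
      exact r2
  · have hp := hC.foremost_none (h := rows C) hcb (hS1 C) (by rwa [a3])
    by_cases h2 : c.a (-b + 2) < c.a (-b + 3)
    · refine ⟨fun h => by omega, fun _ => ?_⟩
      obtain ⟨q, hq, hq'⟩ := hC.foremost_take hn hl hcb (hS2 C) t2 (by rwa [a3'])
      obtain ⟨r1, B1⟩ := hq' C c hcb hC (by rwa [a3']) rfl
      have h3 : (c.bumpA n (-b + 2) 1).a (-b + 1) <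
          (c.bumpA n (-b + 2) 1).a (-b + 1 + 1) := by
        simp only [Code.bumpA]
        rw [ne _ _ _ _ (by omega), eq _ _ _ (-b + 1 + 1) a2', a2']; omega
      obtain ⟨q', hq', hq''⟩ := r1.foremost_take hn hl B1 (hH2 _) t4 h3
      obtain ⟨r2, -⟩ := hq'' _ _ B1 r1 h3 rfl
      refine ⟨_, by simp only [YoungWall.eMid, hp, hq, hq', Option.map_some]; rfl, ?_⟩
      rw [Code.midE, if_neg h1, if_pos h2, show 1 - b = -b + 1 by ring, Code.bumpA_comm]
      exact r2
    · have hq := hC.foremost_none (h := rows C) hcb (hS2 C) (by rwa [a3'])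
      constructor
      · intro h
        have hp' := hC.foremost_none (h := rows C) hcb (hH1 C) (by rw [a2]; omega)
        simp only [YoungWall.eMid, hp, hq, hp']
      · intro h
        have h3 : c.a (b + 1) < c.a (b + 1 + 1) := by rw [a2]; omega
        have h4 : c.a (-b + 1) < c.a (-b + 1 + 1) := by rw [a2']; omega
        obtain ⟨p', hp', hp''⟩ := hC.foremost_take hn hl hcb (hH1 _) t3 h3
        obtain ⟨q', hq', hq''⟩ := hC.foremost_take hn hl hcb (hH2 _) t4 h4
        obtain ⟨r1, B1⟩ := hp'' _ _ hcb hC h3 rfl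
        obtain ⟨r2, -⟩ := hq'' _ _ B1 r1
          (by
            simp only [Code.bumpA]
            rwa [ne _ _ _ (-b + 1) (by omega), ne _ _ _ (-b + 1 + 1) (by omega)])
          (by simp only [Code.bumpA]; rw [ne _ _ _ (-b + 1) (by omega)])
        refine ⟨_, by simp only [YoungWall.eMid, hp, hq, hp', hq']; rfl, ?_⟩
        rw [Code.midE, if_neg h1, if_neg h2, show 1 - b = -b + 1 by ring,
          show 1 - -b = b + 1 by ring, Code.bumpA_comm]
        exact r2

end

end YoungWall

namespace YoungWall

section
variable {n l : ℕ} {C : Layers l} {c : Code}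

/-! ### Half-unit depth blocks -/

theorem Layer.height_single (r : ℤ) (s : Side) : (Layer.mk r (.single s)).height = 2 * r + 1 :=
  Layer.height_of_ne_flat (by simp)

theorem Layer.height_flat (r : ℤ) : (Layer.mk r .flat).height = 2 * r :=
  Layer.height_of_flat rfl

theorem Code.bumpA_add_mul (g k m : ℤ) : c.bumpA n (g + 2 * cycleLength n * m) k = c.bumpA n g k := by
  rw [bumpA, bumpA, bump_add_mul]

theorem Code.bumpQ_add_mul (s : Side) (e k m : ℤ) :
    c.bumpQ n s (e + 2 * cycleLength n * m) k = c.bumpQ n s e k := by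
  rw [bumpQ, bumpQ, bump_add_mul]

theorem Rep.bumpQ_le_iff (hc : c.Basic n l) {s : Side} {e : ℤ} {p q : Fin l} {k : ℤ}
    (hp : ((p : ℕ) : ℤ) = c.Q s e - 1 ∧ k = -1 ∨ ((p : ℕ) : ℤ) = c.Q s e ∧ k = 1) (hq : q ≠ p)
    (t : Side) (x : ℤ) :
    (c.bumpQ n s e k).Q t x ≤ (q : ℕ) ↔ c.Q t x ≤ (q : ℕ) := by
  refine forall_side (P := fun t => (c.bumpQ n s e k).Q t x ≤ (q : ℕ) ↔ c.Q t x ≤ (q : ℕ)) s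
    ?_ ?_ t
  · rw [Code.bumpQ_self]
    rcases hp with ⟨hp, rfl⟩ | ⟨hp, rfl⟩
    · exact bump_neg_le_iff (hc.periodQ s) hp hq x
    · exact bump_one_le_iff (hc.periodQ s) hp hq x
  · rw [Code.bumpQ_swap]

theorem single_inj_swap (s : Side) : (Top.single s ≠ Top.single s.swap) ∧
    (Top.single s.swap ≠ Top.single s) := by cases s <;> simp [Side.swap]

/-- The case in which the last free place on the side `s` is above a flat layer; in `Rep.put_snd` it
is next to a single block. -/
theorem Rep.put_fst (hn : 4 ≤ n) (hc : c.Basic n l) (hC : Rep n C c) {s : Side} {e : ℤ}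
    (he : cycleLength n ∣ e) (h : c.a e < c.a (e + 1)) (hQ : c.Q s e = c.a (e + 1)) {p : Fin l}
    (hp : ((p : ℕ) : ℤ) = c.a (e + 1) - 1) :
    (C p).height = e ∧ (C p).top = .flat ∧ Rep n (Function.update C p ⟨(C p).row, .single s⟩)
      ((c.bumpA n (e + 1) (-1)).bumpQ n s e (-1)) := by
  have h1 : (C p).height = e := by rw [hC.height_eq_iff]; omega
  obtain ⟨z, hz⟩ := even_of_dvd he
  have h2 : (C p).top = .flat := by
    have := (C p).height_cases
    by_contra h; have := Layer.height_of_ne_flat h; omega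
  have h3 : 2 * (C p).row = e := by rw [← Layer.height_of_flat h2, h1]
  refine ⟨h1, h2, hC.update (fun q hq => ?_) (fun q hq => ?_) (fun x => ?_) ?_⟩
  · exact fun x => bump_neg_le_iff hc.period hp hq x
  · exact bumpQ_le_iff hc (Or.inl ⟨by omega, rfl⟩) hq
  · rw [Layer.height_single, h3]
    exact bump_neg_le_self_iff hn hc.period hc.monotone hp (by rwa [add_sub_cancel_right]) x
  · rw [Layer.height_single, h3, add_sub_cancel_right]
    have h4 := hc.lower s.swap e he
    refine forall_side s ?_ ?_
    · rw [Code.bumpQ_self, Code.bumpQ_swap, bump_of_dvd (by simp)]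
      simp only [true_iff]
      exact ⟨he, by simp only [Code.bumpA]; omega, by simp only [Code.bumpA]; omega⟩
    · rw [Code.bumpQ_swap]
      simp only [(single_inj_swap s).1, false_iff, Code.bumpA]
      omega

theorem Rep.put_snd (hn : 4 ≤ n) (hc : c.Basic n l) (hC : Rep n C c) {s : Side} {e : ℤ}
    (he : cycleLength n ∣ e) (h : c.Q s.swap e < c.a (e + 2)) (hQ : c.Q s e = c.a (e + 2))
    {p : Fin l} (hp : ((p : ℕ) : ℤ) = c.a (e + 2) - 1) :
    (C p).height = e + 1 ∧ (C p).top = .single s.swap ∧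
      Rep n (Function.update C p ⟨(C p).row + 1, .flat⟩)
        ((c.bumpA n (e + 2) (-1)).bumpQ n s e (-1)) := by
  have h0 := hc.lower s.swap e he
  have h1 : (C p).height = e + 1 := by
    rw [hC.height_eq_iff, add_assoc, one_add_one_eq_two]; omega
  have h2 : (C p).top = .single s.swap := by
    rw [hC.single_iff, h1, add_sub_cancel_right, Side.swap_swap]
    exact ⟨he, by omega, by omega⟩
  have h3 : 2 * (C p).row = e := by
    have := Layer.height_of_ne_flat (c := C p) (by simp [h2]); omega
  refine ⟨h1, h2, hC.update (fun q hq => ?_) (fun q hq => ?_) (fun x => ?_) fun t => ?_⟩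
  · exact fun x => bump_neg_le_iff hc.period hp hq x
  · exact bumpQ_le_iff hc (Or.inl ⟨by omega, rfl⟩) hq
  · rw [Layer.height_flat, mul_add, h3]
    exact bump_neg_le_self_iff hn hc.period hc.monotone hp
      (by rw [show e + 2 - 1 = e + 1 by ring]; omega) x
  · rw [Layer.height_flat, mul_add, h3]
    simp only [reduceCtorEq, false_iff, not_and]
    rw [show e + 2 * 1 - 1 = e + 1 by ring]
    exact fun h => (not_dvd_of_odd (even_of_dvd he).add_one h).elim

theorem Rep.take_fst (hn : 4 ≤ n) (hc : c.Basic n l) (hC : Rep n C c) {s : Side} {e : ℤ}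
    (he : cycleLength n ∣ e) (h : c.a (e + 1) < c.Q s.swap e) (hQ : c.Q s e = c.a (e + 1))
    {p : Fin l} (hp : ((p : ℕ) : ℤ) = c.a (e + 1)) :
    (C p).height = e + 1 ∧ (C p).top = .single s ∧
      Rep n (Function.update C p ⟨(C p).row, .flat⟩)
        ((c.bumpA n (e + 1) 1).bumpQ n s e 1) := by
  have h0 := hc.upper s.swap e he
  have h1 : (C p).height = e + 1 := by
    rw [hC.height_eq_iff, add_assoc, one_add_one_eq_two]; omega
  have h2 : (C p).top = .single s := by
    rw [hC.single_iff, h1, add_sub_cancel_right]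
    exact ⟨he, by omega, by omega⟩
  have h3 : 2 * (C p).row = e := by
    have := Layer.height_of_ne_flat (c := C p) (by simp [h2]); omega
  refine ⟨h1, h2, hC.update (fun q hq => ?_) (fun q hq => ?_) (fun x => ?_) fun t => ?_⟩
  · exact fun x => bump_one_le_iff hc.period hp hq x
  · exact bumpQ_le_iff hc (Or.inr ⟨by omega, rfl⟩) hq
  · rw [Layer.height_flat, h3]
    have := bump_one_le_self_iff hn hc.period hc.monotone hp
      (by rw [show e + 1 + 1 = e + 2 by ring]; omega) x
    rwa [add_sub_cancel_right] at this
  · rw [Layer.height_flat, h3]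
    simp only [reduceCtorEq, false_iff, not_and]
    exact fun h => (not_dvd_of_odd ((even_of_dvd he).sub_odd odd_one) h).elim

theorem Rep.take_snd (hn : 4 ≤ n) (hc : c.Basic n l) (hC : Rep n C c) {s : Side} {e : ℤ}
    (he : cycleLength n ∣ e) (h : c.a (e + 2) < c.a (e + 3)) (hQ : c.Q s e = c.a (e + 2))
    {p : Fin l} (hp : ((p : ℕ) : ℤ) = c.a (e + 2)) :
    (C p).height = e + 2 ∧ (C p).top = .flat ∧
      Rep n (Function.update C p ⟨(C p).row - 1, .single s.swap⟩)
        ((c.bumpA n (e + 2) 1).bumpQ n s e 1) := by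
  have h1 : (C p).height = e + 2 := by
    rw [hC.height_eq_iff, add_assoc, show (2 : ℤ) + 1 = 3 by norm_num]; omega
  obtain ⟨z, hz⟩ := even_of_dvd he
  have h2 : (C p).top = .flat := by
    have := (C p).height_cases
    by_contra h; have := Layer.height_of_ne_flat h; omega
  have h3 : 2 * (C p).row = e + 2 := by rw [← Layer.height_of_flat h2, h1]
  have h4 : 2 * ((C p).row - 1) = e := by linarith
  refine ⟨h1, h2, hC.update (fun q hq => ?_) (fun q hq => ?_) (fun x => ?_) ?_⟩
  · exact fun x => bump_one_le_iff hc.period hp hq x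
  · exact bumpQ_le_iff hc (Or.inr ⟨by omega, rfl⟩) hq
  · rw [Layer.height_single, h4]
    have := bump_one_le_self_iff hn hc.period hc.monotone hp
      (by rwa [show e + 2 + 1 = e + 3 by ring]) x
    rwa [show e + 2 - 1 = e + 1 by ring] at this
  · rw [Layer.height_single, h4, add_sub_cancel_right]
    have h5 := hc.upper s.swap e he
    refine forall_side s ?_ ?_
    · rw [Code.bumpQ_self, bump_of_dvd (by simp)]
      simp only [(single_inj_swap s).2, false_iff, Code.bumpA]
      omega
    · rw [Code.bumpQ_swap, Side.swap_swap, Code.bumpQ_self, bump_of_dvd (by simp)]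
      simp only [true_iff]
      exact ⟨he, by simp only [Code.bumpA]; omega, by simp only [Code.bumpA]; omega⟩

/-- The place of the half-unit depth `i`-block in the `k`-th column of the pattern. -/
def endSide (n k i : ℕ) : Side :=
  if i = 0 ∨ i + 1 = n then (if Even k then .back else .front)
  else if Even k then .front else .back

/-- Reflects the alternation of the pattern; because of it, sides are swapped when `φᵢ` and `εᵢ` of
neighbouring columns are compared. -/
theorem endSide_succ (n k i : ℕ) : endSide n (k + 1) i = (endSide n k i).swap := by
  unfold endSide
  by_cases h : Even k <;> simp only [Nat.even_add_one, h] <;> split_ifs <;> simp_all [Side.swap]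

theorem color_eq_iff (hn : 4 ≤ n) {i : ℕ} (hi : ¬(2 ≤ i ∧ i + 2 ≤ n)) (hin : i ≤ n) (k : ℕ) {r : ℤ}
    (hr : rowBlock n r = .zo ∨ rowBlock n r = .nn) (t : Side) :
    color n k r t = i ↔ rowBlock n r = wholeOf i ∧ t = endSide n k i := by
  have h : i = 0 ∨ i = 1 ∨ i = n - 1 ∨ i = n := by omega
  have f1 : (0 : ℕ) ≠ n - 1 ∧ 0 ≠ n ∧ 1 ≠ n - 1 ∧ 1 ≠ n ∧ n - 1 ≠ n := by omega
  have f2 : ¬ n - 1 ≤ 1 ∧ ¬ n ≤ 1 ∧ n - 1 + 1 = n := by omega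
  have f3 : n - 1 ≠ 0 ∧ n - 1 ≠ 1 ∧ n ≠ 0 ∧ n ≠ 1 ∧ n ≠ n - 1 ∧ n + 1 ≠ n ∧ 1 + 1 ≠ n := by omega
  unfold color wholeOf endSide
  by_cases hk : Even k <;> rcases hr with hr | hr <;> rcases h with rfl | rfl | rfl | rfl <;>
    cases t <;> simp [hr, hk, f1, f2, f3]

theorem wholeOf_isEnd (i : ℕ) : (wholeOf i).IsEnd := by
  unfold wholeOf; split_ifs <;> trivial

theorem wholeOf_cases (i : ℕ) : wholeOf i = .zo ∨ wholeOf i = .nn := by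
  unfold wholeOf; split_ifs <;> simp

theorem rowBlock_wholeOf_iff (hn : 4 ≤ n) (i : ℕ) {e : ℤ}
    (he : e = 2 * baseRow n (wholeOf i) .supporting) (r : ℤ) :
    rowBlock n r = wholeOf i ↔ 2 * cycleLength n ∣ 2 * r - e := by
  rw [he, dvd_two_mul_sub_iff]
  rcases wholeOf_cases i with h | h <;> rw [h, baseRow]
  · rw [rowBlock_zo_iff hn, sub_zero]
  · rw [rowBlock_nn_iff hn]

theorem Layer.putBlock_eq_some_iff (hn : 4 ≤ n) {i : ℕ} (hi : ¬(2 ≤ i ∧ i + 2 ≤ n)) (hin : i ≤ n)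
    (k : ℕ) {e : ℤ} (he : e = 2 * baseRow n (wholeOf i) .supporting) (x y : Layer) :
    x.putBlock n k i = some y ↔ 2 * cycleLength n ∣ 2 * x.row - e ∧
      ((x.top = .flat ∧ y = ⟨x.row, .single (endSide n k i)⟩) ∨
        (x.top = .single (endSide n k i).swap ∧ y = ⟨x.row + 1, .flat⟩)) := by
  rw [← rowBlock_wholeOf_iff hn i he]
  unfold putBlock
  by_cases hr : rowBlock n x.row = .zo ∨ rowBlock n x.row = .nn
  · rw [if_pos hr]
    simp only [color_eq_iff hn hi hin k hr]
    rcases x with ⟨r, t⟩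
    generalize endSide n k i = s
    by_cases h : rowBlock n r = wholeOf i
    · rcases t with _ | t | _
      · cases s <;> simp [h, eq_comm]
      · cases s <;> cases t <;> simp [h, eq_comm, Side.swap]
      · simp [h]
    · rcases t with _ | t | _ <;> simp [h]
  · rw [if_neg hr]
    have : rowBlock n x.row ≠ wholeOf i := fun h => hr (h ▸ wholeOf_cases i)
    simp [this]

/-- For a single top `takeBlock` does not test the kind of row, so this information is supplied by
`hx`. -/
theorem Layer.takeBlock_eq_some_iff (hn : 4 ≤ n) {i : ℕ} (hi : ¬(2 ≤ i ∧ i + 2 ≤ n)) (hin : i ≤ n)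
    (k : ℕ) {e : ℤ} (he : e = 2 * baseRow n (wholeOf i) .supporting) (x y : Layer)
    (hx : ∀ s, x.top = .single s → rowBlock n x.row = .zo ∨ rowBlock n x.row = .nn) :
    x.takeBlock n k i = some y ↔ 2 * cycleLength n ∣ 2 * x.topRow - e ∧
      ((x.top = .flat ∧ y = ⟨x.row - 1, .single (endSide n k i).swap⟩) ∨
        (x.top = .single (endSide n k i) ∧ y = ⟨x.row, .flat⟩)) := by
  rw [← rowBlock_wholeOf_iff hn i he]
  rcases x with ⟨r, t⟩
  rcases t with _ | t | _
  · simp only [takeBlock, topRow]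
    by_cases hr : rowBlock n (r - 1) = .zo ∨ rowBlock n (r - 1) = .nn
    · rw [if_pos hr]
      simp only [color_eq_iff hn hi hin k hr]
      generalize endSide n k i = s
      by_cases h : rowBlock n (r - 1) = wholeOf i
      · cases s <;> simp [h, eq_comm, Side.swap]
      · simp [h]
    · rw [if_neg hr]
      have : rowBlock n (r - 1) ≠ wholeOf i := fun h => hr (h ▸ wholeOf_cases i)
      simp [this]
  · simp only [takeBlock, topRow, color_eq_iff hn hi hin k (hx t rfl)]
    generalize endSide n k i = s
    by_cases h : rowBlock n r = wholeOf i <;> cases s <;> cases t <;> simp [h, eq_comm]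
  · simp [takeBlock]

end
end YoungWall

namespace YoungWall

section
variable {n l : ℕ} {C : Layers l} {c : Code}

/-! ### The operators for `i = 0, 1, n - 1, n` on slices -/

theorem Code.flip_end_eq (k : ℤ) {e : ℤ} (he : cycleLength n ∣ e) :
    c.flip n (e + 2) k = (c.bumpA n (e + 2) k).bumpA n (e + 1) (-k) := by
  obtain ⟨m, rfl⟩ := he
  rw [flip, show 3 - (cycleLength n * m + 2) = cycleLength n * m + 1 + 2 * cycleLength n * (-m) by
    ring, bumpA_add_mul]

/-- Un-splitting `m` times, moving one block and splitting `m'` times only shifts the two ends of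
the class `e + 1`, besides one value of `Q`. -/
theorem Code.flip_step {s : Side} {e x m m' κ k1 k2 : ℤ} (he : cycleLength n ∣ e)
    (hx : x = e + 1 ∧ k1 = m' - m ∧ k2 = m - m' + κ ∨ x = e + 2 ∧ k1 = m' - m + κ ∧ k2 = m - m') :
    (((c.flip n (e + 2) (-m)).bumpA n x κ).bumpQ n s e κ).flip n (e + 2) m' =
      ((c.bumpA n (e + 2) k1).bumpA n (e + 1) k2).bumpQ n s e κ := by
  rw [flip_end_eq _ he, flip_end_eq _ he]
  refine Code.ext (funext fun z => ?_) rfl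
  simp only [bumpA, bumpQ, bump_eq_cls]
  rcases hx with ⟨rfl, rfl, rfl⟩ | ⟨rfl, rfl, rfl⟩ <;> ring

theorem Code.IsSliceCode.disj_end (hc : c.IsSliceCode n l) {e : ℤ} (he : cycleLength n ∣ e) :
    c.a e = c.a (e + 1) ∨ c.a (e + 2) = c.a (e + 3) := by
  have h1 := hc.disj e (even_of_dvd he)
  obtain ⟨k, hk⟩ := he
  have h2 := hc.step_iff (2 - e) k
  rw [show 2 - e + 2 * cycleLength n * k = e + 2 by rw [hk]; ring, add_assoc,
    show (2 : ℤ) + 1 = 3 by norm_num] at h2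
  rwa [h2]

theorem row_eq_of_even {p : Fin l} {e m : ℤ} (he : Even e)
    (h : 2 * (C p).row = e + 2 * cycleLength n * m) :
    (C p).row = e / 2 + cycleLength n * m := by
  obtain ⟨z, rfl⟩ := he
  rw [mul_assoc] at h
  omega

theorem Rep.exists_put (hn : 4 ≤ n) (hl : 1 ≤ l) (hc : c.IsSemi n l) (hC : Rep n C c) {i : ℕ}
    (hi : ¬(2 ≤ i ∧ i + 2 ≤ n)) (hin : i ≤ n) (k : ℕ) {s : Side} (hs : s = endSide n k i)
    {e : ℤ} (he : e = 2 * baseRow n (wholeOf i) .supporting) (hQ : ∃ t, c.Q t e = c.a (e + 2)) :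
    (c.Q s e = c.a e → ∀ p, ((C p).putBlock n k i).isSome = false) ∧
    (c.a e < c.Q s e → ∃ p y x, (rearmostLowest (rows C) fun p => ((C p).putBlock n k i).isSome) =
      some p ∧ (C p).putBlock n k i = some y ∧ (x = e + 1 ∨ x = e + 2) ∧
      Rep n (Function.update C p y) ((c.bumpA n x (-1)).bumpQ n s e (-1)) ∧
      ((c.bumpA n x (-1)).bumpQ n s e (-1)).IsSemi n l) := by
  have hT := cycleLength_pos hn
  have hTe : cycleLength n ∣ e := he ▸ (wholeOf_isEnd i).dvd _
  have hee := even_of_dvd hTe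
  have bal := hc.balance s e hTe
  have m1 := hc.mono e
  have m2 := hc.lower s e hTe
  have m3 := hc.lower s.swap e hTe
  have hQ' : c.Q s e = c.a (e + 2) ∨ c.Q s.swap e = c.a (e + 2) := by
    obtain ⟨t, ht⟩ := hQ
    exact forall_side (P := fun t => c.Q t e = c.a (e + 2) → _) s Or.inl Or.inr t ht
  have hput := fun p => (C p).putBlock_eq_some_iff hn hi hin k he
  rw [← hs] at hput
  have hS : ∀ p, ((C p).putBlock n k i).isSome = true → ∃ m : ℤ, ((C p).row = e / 2 + cycleLength n * m) ∧
      ((C p).height = e + 2 * cycleLength n * m ∨ ((C p).height = e + 2 * cycleLength n * m + 1 ∧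
        c.Q s.swap e < c.Q s e)) := by
    intro p hp
    obtain ⟨y, hy⟩ := Option.isSome_iff_exists.1 hp
    obtain ⟨hd, h⟩ := (hput p y).1 hy
    obtain ⟨m, hm⟩ := exists_eq_add_mul_of_dvd hd
    refine ⟨m, row_eq_of_even hee hm, ?_⟩
    rcases h with ⟨h, -⟩ | ⟨h, -⟩
    · exact Or.inl (by rw [Layer.height_of_flat h, hm])
    · have hH : (C p).height = e + 2 * cycleLength n * m + 1 := by
        rw [Layer.height_of_ne_flat (by simp [h]), hm]
      refine Or.inr ⟨hH, ?_⟩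
      obtain ⟨-, h1, h2⟩ := (hC.single_iff p s.swap).1 h
      rw [Side.swap_swap, hH, add_sub_cancel_right, (hc.periodQ _).add_mul] at h2
      rw [hH, add_sub_cancel_right, (hc.periodQ _).add_mul] at h1
      omega
  constructor
  · refine fun h0 p => Bool.eq_false_iff.2 fun hp => ?_
    obtain ⟨m, -, h | ⟨-, h⟩⟩ := hS p hp
    · exact hC.class_empty hc.toBasic (x := e) (by omega) p (by rw [h]; simp)
    · omega
  · intro hφ
    -- The last index of `[a e, Q s e)`, the interval of free places.
    obtain ⟨p, m, hp⟩ := exists_index hl (c.Q s e - 1)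
    have hEd : cycleLength n ∣ e + 2 * cycleLength n * m :=
      hTe.add ((Dvd.intro_left 2 rfl).trans (Dvd.intro _ rfl))
    have p0 := hc.period.add_mul e m
    have p1 := hc.period.add_mul (e + 1) m
    have p2 := hc.period.add_mul (e + 2) m
    have q1 := (hc.periodQ s).add_mul e m
    have q2 := (hc.periodQ s.swap).add_mul e m
    rw [add_right_comm] at p1 p2
    by_cases hlt : c.Q s.swap e < c.Q s e
    · obtain ⟨h1, h2, h3⟩ := hC.put_snd hn hc.toBasic (s := s) hEd (by omega) (by omega)
        (p := p) (by omega)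
      rw [add_right_comm, Code.bumpA_add_mul, Code.bumpQ_add_mul] at h3
      have hy := (hput p ⟨(C p).row + 1, .flat⟩).2 ⟨by
        rw [← add_sub_cancel_right (2 * (C p).row) 1, ← Layer.height_of_ne_flat (by simp [h2]), h1]
        exact ⟨m, by ring⟩, Or.inr ⟨h2, rfl⟩⟩
      -- Flat layers and layers with a single block compete in the same row, so the window covers
      -- both heights `e` and `e + 1`.
      refine ⟨p, _, e + 2, hC.rearmostLowest_eq hn hc.toBasic (lo := e) (hi := e + 2) (κ := e / 2)
        (m := m) (by omega) (fun q hq => ?_) (by omega) (by rw [hy]; rfl), hy, Or.inr rfl, h3,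
        hc.end_step hTe (Or.inr rfl) (hc.end_lower_snd hTe (by omega) (by omega))⟩
      obtain ⟨m', h, h'⟩ := hS q hq
      exact ⟨m', by omega, by omega, h⟩
    · obtain ⟨h1, h2, h3⟩ := hC.put_fst hn hc.toBasic (s := s) hEd (by omega) (by omega)
        (p := p) (by omega)
      rw [add_right_comm, Code.bumpA_add_mul, Code.bumpQ_add_mul] at h3
      have hy := (hput p ⟨(C p).row, .single s⟩).2 ⟨by
        rw [← Layer.height_of_flat h2, h1]
        exact ⟨m, by ring⟩, Or.inl ⟨h2, rfl⟩⟩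
      refine ⟨p, _, e + 1, hC.rearmostLowest_eq hn hc.toBasic (lo := e) (hi := e + 1) (κ := e / 2)
        (m := m) (by omega) (fun q hq => ?_) (by omega) (by rw [hy]; rfl), hy, Or.inl rfl, h3,
        hc.end_step hTe (Or.inl rfl) (hc.end_lower_fst hTe (by omega))⟩
      obtain ⟨m', h, h'⟩ := hS q hq
      exact ⟨m', by omega, by omega, h⟩

theorem Rep.exists_take (hn : 4 ≤ n) (hl : 1 ≤ l) (hc : c.IsSemi n l) (hC : Rep n C c) {i : ℕ}
    (hi : ¬(2 ≤ i ∧ i + 2 ≤ n)) (hin : i ≤ n) (k : ℕ) {s : Side} (hs : s = endSide n k i)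
    {e : ℤ} (he : e = 2 * baseRow n (wholeOf i) .supporting) (hQ : ∃ t, c.Q t e = c.a (e + 2)) :
    (c.Q s e = c.a (e + 3) → ∀ p, ((C p).takeBlock n k i).isSome = false) ∧
    (c.Q s e < c.a (e + 3) → ∃ p y x,
      (foremostHighest (fun p => (C p).topRow) fun p => ((C p).takeBlock n k i).isSome) =
      some p ∧ (C p).takeBlock n k i = some y ∧ (x = e + 1 ∨ x = e + 2) ∧
      Rep n (Function.update C p y) ((c.bumpA n x 1).bumpQ n s e 1) ∧
      ((c.bumpA n x 1).bumpQ n s e 1).IsSemi n l) := by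
  have hT := cycleLength_pos hn
  have hTe : cycleLength n ∣ e := he ▸ (wholeOf_isEnd i).dvd _
  have hee := even_of_dvd hTe
  have bal := hc.balance s e hTe
  have m1 := hc.mono (e + 2)
  rw [add_assoc, show (2 : ℤ) + 1 = 3 by norm_num] at m1
  have m2 := hc.upper s e hTe
  have m3 := hc.upper s.swap e hTe
  have hQ' : c.Q s e = c.a (e + 2) ∨ c.Q s.swap e = c.a (e + 2) := by
    obtain ⟨t, ht⟩ := hQ
    exact forall_side (P := fun t => c.Q t e = c.a (e + 2) → _) s Or.inl Or.inr t ht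
  have htake := fun p y => (C p).takeBlock_eq_some_iff hn hi hin k he y (fun t ht => by
    rw [rowBlock_end_iff hn]
    have := ((hC.single_iff p t).1 ht).1
    rwa [Layer.height_of_ne_flat (by simp [ht]), add_sub_cancel_right] at this)
  rw [← hs] at htake
  have hS : ∀ p, ((C p).takeBlock n k i).isSome = true → ∃ m : ℤ,
      ((C p).topRow = e / 2 + cycleLength n * m) ∧
      ((C p).height = e + 2 * cycleLength n * m + 2 ∨ ((C p).height = e + 2 * cycleLength n * m + 1 ∧
        c.Q s e < c.Q s.swap e)) := by
    intro p hp
    obtain ⟨y, hy⟩ := Option.isSome_iff_exists.1 hp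
    obtain ⟨hd, h⟩ := (htake p y).1 hy
    obtain ⟨m, hm⟩ := exists_eq_add_mul_of_dvd hd
    refine ⟨m, ?_, ?_⟩
    · obtain ⟨z, hz⟩ := hee
      rw [mul_assoc] at hm
      omega
    rcases h with ⟨h, -⟩ | ⟨h, -⟩
    · refine Or.inl ?_
      rw [Layer.height_of_flat h]
      simp only [Layer.topRow, h] at hm
      linarith
    · have hH : (C p).height = e + 2 * cycleLength n * m + 1 := by
        simp only [Layer.topRow, h] at hm
        rw [Layer.height_of_ne_flat (by simp [h]), hm]
      refine Or.inr ⟨hH, ?_⟩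
      obtain ⟨-, h1, h2⟩ := (hC.single_iff p s).1 h
      rw [hH, add_sub_cancel_right, (hc.periodQ _).add_mul] at h1 h2
      omega
  constructor
  · refine fun h0 p => Bool.eq_false_iff.2 fun hp => ?_
    obtain ⟨m, -, h | ⟨-, h⟩⟩ := hS p hp
    · refine hC.class_empty hc.toBasic (x := e + 2) ?_ p ?_
      · rw [add_assoc, show (2 : ℤ) + 1 = 3 by norm_num]; omega
      · rw [h]; exact ⟨m, by ring⟩
    · omega
  · intro hφ
    obtain ⟨p, m, hp⟩ := exists_index hl (c.Q s e)
    have hEd : cycleLength n ∣ e + 2 * cycleLength n * m :=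
      hTe.add ((Dvd.intro_left 2 rfl).trans (Dvd.intro _ rfl))
    have p1 := hc.period.add_mul (e + 1) m
    have p2 := hc.period.add_mul (e + 2) m
    have p3 := hc.period.add_mul (e + 3) m
    have q1 := (hc.periodQ s).add_mul e m
    have q2 := (hc.periodQ s.swap).add_mul e m
    rw [add_right_comm] at p1 p2 p3
    by_cases hlt : c.Q s e < c.Q s.swap e
    · obtain ⟨h1, h2, h3⟩ := hC.take_fst hn hc.toBasic (s := s) hEd (by omega) (by omega)
        (p := p) (by omega)
      rw [add_right_comm, Code.bumpA_add_mul, Code.bumpQ_add_mul] at h3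
      have hy := (htake p ⟨(C p).row, .flat⟩).2 ⟨by
        simp only [Layer.topRow, h2]
        rw [← add_sub_cancel_right (2 * (C p).row) 1, ← Layer.height_of_ne_flat (by simp [h2]), h1]
        exact ⟨m, by ring⟩, Or.inr ⟨h2, rfl⟩⟩
      refine ⟨p, _, e + 1, hC.foremostHighest_eq hn hc.toBasic (lo := e + 1) (hi := e + 3)
        (κ := e / 2) (m := m) (by omega) (fun q hq => ?_) (by omega) (by rw [hy]; rfl), hy,
        Or.inl rfl, h3, hc.end_step hTe (Or.inl rfl) (hc.end_raise_fst hTe (by omega) (by omega))⟩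
      obtain ⟨m', h, h'⟩ := hS q hq
      exact ⟨m', by omega, by omega, h⟩
    · obtain ⟨h1, h2, h3⟩ := hC.take_snd hn hc.toBasic (s := s) hEd (by omega) (by omega)
        (p := p) (by omega)
      rw [add_right_comm, Code.bumpA_add_mul, Code.bumpQ_add_mul] at h3
      have hy := (htake p ⟨(C p).row - 1, .single s.swap⟩).2 ⟨by
        simp only [Layer.topRow, h2]
        rw [mul_sub, ← Layer.height_of_flat h2, h1]
        exact ⟨m, by ring⟩, Or.inl ⟨h2, rfl⟩⟩
      refine ⟨p, _, e + 2, hC.foremostHighest_eq hn hc.toBasic (lo := e + 2) (hi := e + 3)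
        (κ := e / 2) (m := m) (by omega) (fun q hq => ?_) (by omega) (by rw [hy]; rfl), hy,
        Or.inr rfl, h3, hc.end_step hTe (Or.inr rfl) (hc.end_raise_snd hTe (by omega))⟩
      obtain ⟨m', h, h'⟩ := hS q hq
      exact ⟨m', by omega, by omega, h⟩

/-- The number `m'` is not computed directly: splitting ends with the class `e` or `e + 2` empty,
and one of them was empty in `c` too. These conditions leave only a net bump by `κ` at one end of
the class `e + 1`, namely at the end selected by `endF` or `endE`. -/
theorem Code.IsSliceCode.flip_step_eq (hc : c.IsSliceCode n l) {s : Side} {e x m m' κ : ℤ}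
    (hTe : cycleLength n ∣ e) (hx : x = e + 1 ∨ x = e + 2) (hκ : κ = -1 ∨ κ = 1) {d : Code}
    (hd : d = ((c.flip n (e + 2) (-m)).bumpA n x κ).bumpQ n s e κ)
    (hb : (d.flip n (e + 2) m').Basic n l)
    (h : d.a e = d.a (e + 1) - m' ∨ d.a (e + 3) = d.a (e + 2) + m') :
    d.flip n (e + 2) m' = if κ = -1 then c.endF n s e else c.endE n s e := by
  have hdj := hc.disj_end hTe
  have v0 := hb.mono e
  have v2 := hb.mono (e + 2)
  have u0 := hc.mono e
  have u2 := hc.mono (e + 2)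
  rw [add_assoc, show (2 : ℤ) + 1 = 3 by norm_num] at v2 u2
  have eq : ∀ (f : ℤ → ℤ) (g k x : ℤ), x = g → bump n f g k x = f x + k :=
    fun f g k x h => bump_of_dvd (by simp [h])
  have ne := @bump_of_ne_end n
  have w : ∀ h, d.a h = bump n (c.flip n (e + 2) (-m)).a x κ h := fun _ => hd ▸ rfl
  obtain ⟨r0, r1, r2, r3⟩ := d.flip_end (n := n) m' hTe
  obtain ⟨f0, f1, f2, f3⟩ := c.flip_end (n := n) (-m) hTe
  have fin : ∀ k1 k2 : ℤ, k1 = m' - m + (if x = e + 2 then κ else 0) →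
      k2 = m - m' + (if x = e + 2 then 0 else κ) →
      d.flip n (e + 2) m' = ((c.bumpA n (e + 2) k1).bumpA n (e + 1) k2).bumpQ n s e κ := by
    intro k1 k2 h1 h2
    rw [hd]
    refine flip_step hTe ?_
    rcases hx with rfl | rfl
    · left; simpa using And.intro h1 h2
    · right; simpa using And.intro h1 h2
  have w0 : d.a e = c.a e := by
    rw [w, ne _ _ _ _ (by omega), f0]
  have w3 : d.a (e + 3) = c.a (e + 3) := by
    rw [w, ne _ _ _ _ (by omega), f3]
  have w12 : d.a (e + 1) = c.a (e + 1) + m + (if x = e + 2 then 0 else κ) ∧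
      d.a (e + 2) = c.a (e + 2) - m + (if x = e + 2 then κ else 0) := by
    rw [w, w]
    rcases hx with rfl | rfl
    · rw [eq _ _ _ (e + 1) rfl, ne _ _ _ (e + 2) (by omega), f1, f2]
      constructor <;> (simp; try ring)
    · rw [eq _ _ _ (e + 2) rfl, ne _ _ _ (e + 1) (by omega), f1, f2]
      constructor <;> (simp; try ring)
  obtain ⟨w1, w2⟩ := w12
  rw [r0, r1, w0, w1] at v0
  rw [r2, r3, w2, w3] at v2
  rw [w0, w1, w2, w3] at h
  clear r0 r1 r2 r3 f0 f1 f2 f3 w w0 w1 w2 w3 eq ne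
  rcases hκ with rfl | rfl
  · rw [if_pos rfl, Code.endF]
    by_cases hF : c.a e < c.a (e + 1)
    · rw [if_pos hF, fin 0 (-1) (by split_ifs at * <;> omega) (by split_ifs at * <;> omega),
        bumpA_zero]
    · rw [if_neg hF, fin (-1) 0 (by split_ifs at * <;> omega) (by split_ifs at * <;> omega),
        bumpA_zero]
  · rw [if_neg (by norm_num), Code.endE]
    by_cases hF : c.a (e + 2) < c.a (e + 3)
    · rw [if_pos hF, fin 1 0 (by split_ifs at * <;> omega) (by split_ifs at * <;> omega),
        bumpA_zero]
    · rw [if_neg hF, fin 0 1 (by split_ifs at * <;> omega) (by split_ifs at * <;> omega),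
        bumpA_zero]

theorem Rep.fEnd (hn : 4 ≤ n) (hl : 1 ≤ l) (hc : c.IsSliceCode n l) (hC : Rep n C c) {i : ℕ}
    (hi : ¬(2 ≤ i ∧ i + 2 ≤ n)) (hin : i ≤ n) (k : ℕ) {s : Side} (hs : s = endSide n k i)
    {e : ℤ} (he : e = 2 * baseRow n (wholeOf i) .supporting) :
    (c.endPhi s e = 0 → fEnd n k i C = none) ∧
      (0 < c.endPhi s e → ∃ C', fEnd n k i C = some C' ∧ Rep n C' (c.endF n s e)) := by
  have hTe : cycleLength n ∣ e := he ▸ (wholeOf_isEnd i).dvd _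
  obtain ⟨m, -, hd, hD, t, ht⟩ := hC.rep_unsplitAll hn hl hc.toIsSemi (wholeOf_isEnd i) he
  obtain ⟨f0, f1, f2, f3⟩ := c.flip_end (n := n) (-m) hTe
  obtain ⟨g1, g2⟩ := hD.exists_put hn hl hd hi hin k hs he ⟨t, by rw [f2, ← sub_eq_add_neg]; exact ht⟩
  have hQs : (c.flip n (e + 2) (-m)).Q s e = c.Q s e := rfl
  unfold Code.endPhi
  constructor
  · intro h
    simp only [YoungWall.fEnd]
    rw [rearmostLowest_eq_none (g1 (by rw [hQs, f0]; omega))]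
    rfl
  · intro h
    obtain ⟨p, y, x, h1, h2, hx, h3, h4⟩ := g2 (by rw [hQs, f0]; omega)
    obtain ⟨m', -, h5, h6, h7⟩ := h3.rep_splitAll hn hl h4 (wholeOf_isEnd i) he
    refine ⟨_, by simp only [YoungWall.fEnd, h1, Option.bind_some, h2, Option.map_some]; rfl, ?_⟩
    convert h6 using 1
    rw [hc.flip_step_eq hTe hx (Or.inl rfl) rfl h5.toBasic h7, if_pos rfl]

theorem Rep.eEnd (hn : 4 ≤ n) (hl : 1 ≤ l) (hc : c.IsSliceCode n l) (hC : Rep n C c) {i : ℕ}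
    (hi : ¬(2 ≤ i ∧ i + 2 ≤ n)) (hin : i ≤ n) (k : ℕ) {s : Side} (hs : s = endSide n k i)
    {e : ℤ} (he : e = 2 * baseRow n (wholeOf i) .supporting) :
    (c.endEps s e = 0 → eEnd n k i C = none) ∧
      (0 < c.endEps s e → ∃ C', eEnd n k i C = some C' ∧ Rep n C' (c.endE n s e)) := by
  have hTe : cycleLength n ∣ e := he ▸ (wholeOf_isEnd i).dvd _
  obtain ⟨m, -, hd, hD, t, ht⟩ := hC.rep_unsplitAll hn hl hc.toIsSemi (wholeOf_isEnd i) he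
  obtain ⟨f0, f1, f2, f3⟩ := c.flip_end (n := n) (-m) hTe
  obtain ⟨g1, g2⟩ := hD.exists_take hn hl hd hi hin k hs he ⟨t, by rw [f2, ← sub_eq_add_neg]; exact ht⟩
  have hQs : (c.flip n (e + 2) (-m)).Q s e = c.Q s e := rfl
  unfold Code.endEps
  constructor
  · intro h
    simp only [YoungWall.eEnd]
    rw [foremostHighest_eq_none (g1 (by rw [hQs, f3]; omega))]
    rfl
  · intro h
    obtain ⟨p, y, x, h1, h2, hx, h3, h4⟩ := g2 (by rw [hQs, f3]; omega)
    obtain ⟨m', -, h5, h6, h7⟩ := h3.rep_splitAll hn hl h4 (wholeOf_isEnd i) he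
    refine ⟨_, by simp only [YoungWall.eEnd, h1, Option.bind_some, h2, Option.map_some]; rfl, ?_⟩
    convert h6 using 1
    rw [hc.flip_step_eq hTe hx (Or.inr rfl) rfl h5.toBasic h7, if_neg (by norm_num)]

end
end YoungWall

namespace YoungWall

section
variable {n l : ℕ} {C : Layers l} {c : Code}

/-! ### The operators on slices -/

def endBase (n i : ℕ) : ℤ := 2 * baseRow n (wholeOf i) .supporting

theorem endBase_dvd (i : ℕ) : cycleLength n ∣ endBase n i := (wholeOf_isEnd i).dvd _

theorem endBase_eq (n i : ℕ) : endBase n i = if i ≤ 1 then 0 else 2 * (n : ℤ) - 4 := by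
  unfold endBase wholeOf
  split_ifs <;> simp [baseRow]
  ring

def Code.phi (n k i : ℕ) (c : Code) : ℤ :=
  if 2 ≤ i ∧ i + 2 ≤ n then c.midPhi (2 * i - 2) else c.endPhi (endSide n k i) (endBase n i)

def Code.eps (n k i : ℕ) (c : Code) : ℤ :=
  if 2 ≤ i ∧ i + 2 ≤ n then c.midEps (2 * i - 2) else c.endEps (endSide n k i) (endBase n i)

def Code.f (n k i : ℕ) (c : Code) : Code :=
  if 2 ≤ i ∧ i + 2 ≤ n then c.midF n (2 * i - 2) else c.endF n (endSide n k i) (endBase n i)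

def Code.e (n k i : ℕ) (c : Code) : Code :=
  if 2 ≤ i ∧ i + 2 ≤ n then c.midE n (2 * i - 2) else c.endE n (endSide n k i) (endBase n i)

theorem even_two_mul_sub_two (i : ℤ) : Even (2 * i - 2) := ⟨i - 1, by ring⟩

theorem Rep.fSlice (hn : 4 ≤ n) (hl : 1 ≤ l) (hc : c.IsSliceCode n l) (hC : Rep n C c) {i : ℕ}
    (hin : i ≤ n) (k : ℕ) :
    (c.phi n k i = 0 → fSlice n k i C = none) ∧
      (0 < c.phi n k i → ∃ C', fSlice n k i C = some C' ∧ Rep n C' (c.f n k i)) := by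
  unfold Code.phi YoungWall.fSlice Code.f
  split_ifs with hi
  · exact hC.fMid hn hl hc hi rfl
  · exact hC.fEnd hn hl hc hi hin k rfl rfl

theorem Rep.eSlice (hn : 4 ≤ n) (hl : 1 ≤ l) (hc : c.IsSliceCode n l) (hC : Rep n C c) {i : ℕ}
    (hin : i ≤ n) (k : ℕ) :
    (c.eps n k i = 0 → eSlice n k i C = none) ∧
      (0 < c.eps n k i → ∃ C', eSlice n k i C = some C' ∧ Rep n C' (c.e n k i)) := by
  unfold Code.eps YoungWall.eSlice Code.e
  split_ifs with hi
  · exact hC.eMid hn hl hc hi rfl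
  · exact hC.eEnd hn hl hc hi hin k rfl rfl

theorem Code.phi_nonneg (hc : c.IsSliceCode n l) (k i : ℕ) : 0 ≤ c.phi n k i := by
  unfold phi
  split_ifs
  · exact midPhi_nonneg hc.toBasic _
  · have := hc.mono (endBase n i)
    have := hc.lower (endSide n k i) _ (endBase_dvd i)
    unfold endPhi; omega

theorem Code.eps_nonneg (hc : c.IsSliceCode n l) (k i : ℕ) : 0 ≤ c.eps n k i := by
  unfold eps
  split_ifs
  · exact midEps_nonneg hc.toBasic _
  · have := hc.mono (endBase n i + 2)
    rw [add_assoc, show (2 : ℤ) + 1 = 3 by norm_num] at this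
    have := hc.upper (endSide n k i) _ (endBase_dvd i)
    unfold endEps; omega

theorem Code.IsSliceCode.f (hc : c.IsSliceCode n l) {k i : ℕ} (h : 0 < c.phi n k i) :
    (c.f n k i).IsSliceCode n l := by
  unfold phi at h
  unfold Code.f
  split_ifs at * with hi
  · exact hc.midF (even_two_mul_sub_two _) (not_cycleLength_dvd hi) h
  · exact hc.endF (endBase_dvd i) h

theorem Code.IsSliceCode.e (hc : c.IsSliceCode n l) {k i : ℕ} (h : 0 < c.eps n k i) :
    (c.e n k i).IsSliceCode n l := by
  unfold eps at h
  unfold Code.e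
  split_ifs at * with hi
  · exact hc.midE (even_two_mul_sub_two _) (not_cycleLength_dvd hi) h
  · exact hc.endE (endBase_dvd i) h

theorem Code.phi_f (c : Code) (k i : ℕ) : (c.f n k i).phi n k i = c.phi n k i - 1 := by
  unfold phi Code.f
  split_ifs with hi
  · exact midPhi_midF (even_two_mul_sub_two _) (not_cycleLength_dvd hi)
  · exact endPhi_endF _ _

theorem Code.eps_f (c : Code) (k i : ℕ) : (c.f n k i).eps n k i = c.eps n k i + 1 := by
  unfold eps Code.f
  split_ifs with hi
  · exact midEps_midF (even_two_mul_sub_two _) (not_cycleLength_dvd hi)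
  · exact endEps_endF _ _

theorem Code.IsSliceCode.e_f (hc : c.IsSliceCode n l) (k i : ℕ) : (c.f n k i).e n k i = c := by
  unfold Code.e Code.f
  split_ifs with hi
  · exact hc.midE_midF (even_two_mul_sub_two _) (not_cycleLength_dvd hi)
  · exact hc.endE_endF (endBase_dvd i)

theorem Code.IsSliceCode.f_e (hc : c.IsSliceCode n l) (k i : ℕ) : (c.e n k i).f n k i = c := by
  unfold Code.e Code.f
  split_ifs with hi
  · exact hc.midF_midE (even_two_mul_sub_two _) (not_cycleLength_dvd hi)
  · exact hc.endF_endE (endBase_dvd i)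

theorem Code.IsSliceCode.eps_e (hc : c.IsSliceCode n l) (k i : ℕ) :
    (c.e n k i).eps n k i = c.eps n k i - 1 := by
  have := Code.eps_f (n := n) (c.e n k i) k i
  rw [hc.f_e] at this
  omega

theorem Code.IsSliceCode.phi_e (hc : c.IsSliceCode n l) (k i : ℕ) :
    (c.e n k i).phi n k i = c.phi n k i + 1 := by
  have := Code.phi_f (n := n) (c.e n k i) k i
  rw [hc.f_e] at this
  omega

/-- `P x μ` says that exactly `μ` steps remain; it is a counter which drops by one at each step. -/
theorem powersDefined_eq {α : Type*} {g : α → Option α} {P : α → ℕ → Prop}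
    (h0 : ∀ x, P x 0 → g x = none)
    (h1 : ∀ x μ, P x (μ + 1) → ∃ y, g x = some y ∧ P y μ) {x : α} {μ : ℕ} (hx : P x μ) :
    powersDefined g x = Set.Iic μ := by
  have key : ∀ m x μ, P x μ → ((fun y : Option α => y.bind g)^[m] (some x) ≠ none ↔ m ≤ μ) := by
    intro m
    induction m with
    | zero => simp
    | succ m ih =>
      intro x μ hx
      rw [Function.iterate_succ_apply, Option.bind_some]
      cases μ with
      | zero =>
        rw [h0 x hx, Function.iterate_fixed (by rfl)]
        simp
      | succ μ =>
        obtain ⟨y, h2, h3⟩ := h1 x μ hx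
        rw [h2, ih y μ h3]
        omega
  ext m
  exact key m x μ hx

theorem Rep.powersDefined_f (hn : 4 ≤ n) (hl : 1 ≤ l) (hc : c.IsSliceCode n l) (hC : Rep n C c)
    {i : ℕ} (hin : i ≤ n) (k : ℕ) :
    powersDefined (YoungWall.fSlice n k i) C = Set.Iic (c.phi n k i).toNat := by
  refine powersDefined_eq (P := fun x μ => ∃ c : Code, c.IsSliceCode n l ∧ Rep n x c ∧
    c.phi n k i = μ) ?_ ?_ ⟨c, hc, hC, (Int.toNat_of_nonneg (Code.phi_nonneg hc k i)).symm⟩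
  · rintro x ⟨c, hc, hC, h⟩
    exact (hC.fSlice hn hl hc hin k).1 h
  · rintro x μ ⟨c, hc, hC, h⟩
    obtain ⟨y, h2, h3⟩ := (hC.fSlice hn hl hc hin k).2 (by omega)
    exact ⟨y, h2, c.f n k i, hc.f (by omega), h3, by rw [Code.phi_f]; omega⟩

theorem Rep.powersDefined_e (hn : 4 ≤ n) (hl : 1 ≤ l) (hc : c.IsSliceCode n l) (hC : Rep n C c)
    {i : ℕ} (hin : i ≤ n) (k : ℕ) :
    powersDefined (YoungWall.eSlice n k i) C = Set.Iic (c.eps n k i).toNat := by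
  refine powersDefined_eq (P := fun x μ => ∃ c : Code, c.IsSliceCode n l ∧ Rep n x c ∧
    c.eps n k i = μ) ?_ ?_ ⟨c, hc, hC, (Int.toNat_of_nonneg (Code.eps_nonneg hc k i)).symm⟩
  · rintro x ⟨c, hc, hC, h⟩
    exact (hC.eSlice hn hl hc hin k).1 h
  · rintro x μ ⟨c, hc, hC, h⟩
    obtain ⟨y, h2, h3⟩ := (hC.eSlice hn hl hc hin k).2 (by omega)
    exact ⟨y, h2, c.e n k i, hc.e (by omega), h3, by rw [hc.eps_e]; omega⟩

theorem Rep.phiSlice (hn : 4 ≤ n) (hl : 1 ≤ l) (hc : c.IsSliceCode n l) (hC : Rep n C c)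
    {i : ℕ} (hin : i ≤ n) (k : ℕ) : (phiSlice n k i C : ℤ) = c.phi n k i := by
  rw [YoungWall.phiSlice, hC.powersDefined_f hn hl hc hin, csSup_Iic,
    Int.toNat_of_nonneg (Code.phi_nonneg hc k i)]

theorem Rep.epsSlice (hn : 4 ≤ n) (hl : 1 ≤ l) (hc : c.IsSliceCode n l) (hC : Rep n C c)
    {i : ℕ} (hin : i ≤ n) (k : ℕ) : (epsSlice n k i C : ℤ) = c.eps n k i := by
  rw [YoungWall.epsSlice, hC.powersDefined_e hn hl hc hin, csSup_Iic,
    Int.toNat_of_nonneg (Code.eps_nonneg hc k i)]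

/-! ### Weights of slices -/

/-- The period is `4 * n - 8`. All differences of heights that occur are less than two periods in
absolute value, so only three multiples have to be excluded. -/
theorem cls_eq_zero_of (x : ℤ) (h : x ≠ 0) (h1 : x ≠ 4 * n - 8) (h2 : x ≠ 8 - 4 * n)
    (h3 : x < 8 * n - 16) (h4 : 16 - 8 * n < x) : cls n x = 0 := by
  refine cls_eq_zero fun h => ?_
  obtain ⟨m, hm⟩ := h
  have hT : 2 * cycleLength n = 4 * n - 8 := by unfold cycleLength; ring
  rw [hT] at hm
  have : -2 < m := by by_contra! h5; nlinarith
  have : m < 2 := by by_contra! h5; nlinarith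
  obtain rfl | rfl | rfl : m = -1 ∨ m = 0 ∨ m = 1 := by omega
  all_goals omega

theorem cls_eq_one_of (x : ℤ) (h : x = 0 ∨ x = 4 * n - 8 ∨ x = 8 - 4 * n) : cls n x = 1 := by
  refine if_pos ?_
  have hT : 2 * cycleLength n = 4 * n - 8 := by unfold cycleLength; ring
  rw [hT]
  rcases h with rfl | rfl | rfl
  · simp
  · simp
  · exact ⟨-1, by ring⟩

theorem affineCartanD_apply (i j : Fin (n + 1)) : affineCartanD n i j =
    if (i : ℕ) = j then 2 else if ((i : ℕ) = 0 ∧ (j : ℕ) = 2) ∨ (1 ≤ (i : ℕ) ∧ (j : ℕ) = i + 1 ∧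
      (j : ℕ) + 1 ≤ n) ∨ ((i : ℕ) + 2 = n ∧ (j : ℕ) = n) ∨ ((j : ℕ) = 0 ∧ (i : ℕ) = 2) ∨
      (1 ≤ (j : ℕ) ∧ (i : ℕ) = j + 1 ∧ (i : ℕ) + 1 ≤ n) ∨ ((j : ℕ) + 2 = n ∧ (i : ℕ) = n)
      then -1 else 0 := by
  simp only [affineCartanD, Matrix.of_apply, Fin.ext_iff, or_assoc]

/-- The coefficient of the class `x` in `φ - ε`, which is linear in `a`. -/
def midPairing (n : ℕ) (b x : ℤ) : ℤ :=
  cls n (b + 1 - x) + cls n (b + 2 - x) - cls n (b - x) - cls n (b + 3 - x) +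
    (cls n (-b + 1 - x) + cls n (-b + 2 - x) - cls n (-b - x) - cls n (-b + 3 - x))

theorem Code.midWt_bumpA (c : Code) (b x k : ℤ) :
    (c.bumpA n x k).midPhi b - (c.bumpA n x k).midEps b =
      c.midPhi b - c.midEps b + k * midPairing n b x := by
  simp only [midPhi, midEps, bumpA, bump_eq_cls, midPairing]
  ring

/-- The part coming from `a`; `φ - ε` contains `Q` with the factor `2`, which accounts for the
diagonal of the Cartan matrix. -/
def endPairing (n : ℕ) (e x : ℤ) : ℤ := -cls n (e - x) - cls n (e + 3 - x)

theorem Code.endWt_bumpA (c : Code) (s : Side) (e x k : ℤ) :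
    (c.bumpA n x k).endPhi s e - (c.bumpA n x k).endEps s e =
      c.endPhi s e - c.endEps s e + k * endPairing n e x := by
  simp only [endPhi, endEps, bumpA, bump_eq_cls, endPairing]
  ring

theorem Code.endWt_bumpQ (c : Code) (s t : Side) (e x k : ℤ) :
    (c.bumpQ n t x k).endPhi s e - (c.bumpQ n t x k).endEps s e =
      c.endPhi s e - c.endEps s e + 2 * k * (if s = t then cls n (e - x) else 0) := by
  by_cases h : s = t
  · subst h
    simp only [endPhi, endEps, bumpQ_self, bump_eq_cls, if_true]
    simp only [bumpQ]
    ring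
  · obtain rfl := Side.eq_swap_of_ne h
    simp only [endPhi, endEps, bumpQ_swap, if_neg h]
    simp only [bumpQ]
    ring

theorem midPairing_fst {i j : ℕ} (mi : 2 ≤ i ∧ i + 2 ≤ n) (mj : 2 ≤ j ∧ j + 2 ≤ n) {x : ℤ}
    (hx : x = 2 * i - 2 + 1 ∨ x = 2 - (2 * i - 2)) : midPairing n (2 * j - 2) x =
      if j = i then 1 else if i = j + 1 then -1 else 0 := by
  unfold midPairing
  rcases hx with rfl | rfl <;> split_ifs <;>
    simp (disch := omega) only [cls_eq_zero_of, cls_eq_one_of] <;> norm_num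

theorem midPairing_snd {i j : ℕ} (mi : 2 ≤ i ∧ i + 2 ≤ n) (mj : 2 ≤ j ∧ j + 2 ≤ n) {x : ℤ}
    (hx : x = -(2 * i - 2) + 1 ∨ x = 2 - -(2 * i - 2)) : midPairing n (2 * j - 2) x =
      if j = i then 1 else if j = i + 1 then -1 else 0 := by
  unfold midPairing
  rcases hx with rfl | rfl <;> split_ifs <;>
    simp (disch := omega) only [cls_eq_zero_of, cls_eq_one_of] <;> norm_num

theorem midPairing_end (hn : 4 ≤ n) (i : ℕ) {j : ℕ} (mj : 2 ≤ j ∧ j + 2 ≤ n) {x : ℤ}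
    (hx : x = endBase n i + 1 ∨ x = endBase n i + 2) : midPairing n (2 * j - 2) x =
      if i ≤ 1 then (if j = 2 then -1 else 0) else if j + 2 = n then -1 else 0 := by
  rw [endBase_eq] at hx
  unfold midPairing
  rcases hx with rfl | rfl <;> split_ifs <;>
    simp (disch := omega) only [cls_eq_zero_of, cls_eq_one_of] <;> norm_num

theorem endPairing_fst {i : ℕ} (mi : 2 ≤ i ∧ i + 2 ≤ n) (j : ℕ) {x : ℤ}
    (hx : x = 2 * i - 2 + 1 ∨ x = 2 - (2 * i - 2)) : endPairing n (endBase n j) x =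
      if j ≤ 1 then (if i = 2 then -1 else 0) else 0 := by
  rw [endBase_eq]
  unfold endPairing
  rcases hx with rfl | rfl <;> split_ifs <;>
    simp (disch := omega) only [cls_eq_zero_of, cls_eq_one_of] <;> norm_num

theorem endPairing_snd {i : ℕ} (mi : 2 ≤ i ∧ i + 2 ≤ n) (j : ℕ) {x : ℤ}
    (hx : x = -(2 * i - 2) + 1 ∨ x = 2 - -(2 * i - 2)) : endPairing n (endBase n j) x =
      if j ≤ 1 then 0 else if i + 2 = n then -1 else 0 := by
  rw [endBase_eq]
  unfold endPairing
  rcases hx with rfl | rfl <;> split_ifs <;>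
    simp (disch := omega) only [cls_eq_zero_of, cls_eq_one_of] <;> norm_num

theorem endPairing_end (hn : 4 ≤ n) (i j : ℕ) {x : ℤ}
    (hx : x = endBase n i + 1 ∨ x = endBase n i + 2) : endPairing n (endBase n j) x = 0 := by
  rw [endBase_eq] at *
  unfold endPairing
  rcases hx with rfl | rfl <;> split_ifs <;>
    simp (disch := omega) only [cls_eq_zero_of] <;> norm_num

theorem cls_endBase (hn : 4 ≤ n) (k : ℕ) {i j : ℕ} (mi : ¬(2 ≤ i ∧ i + 2 ≤ n))
    (mj : ¬(2 ≤ j ∧ j + 2 ≤ n)) (hi : i ≤ n) (hj : j ≤ n) :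
    (if endSide n k j = endSide n k i then cls n (endBase n j - endBase n i) else 0) =
      if j = i then 1 else 0 := by
  have h : endSide n k j = endSide n k i ↔ ((j = 0 ∨ j + 1 = n) ↔ (i = 0 ∨ i + 1 = n)) := by
    unfold endSide
    split_ifs <;> simp_all
  simp only [h, endBase_eq]
  split_ifs <;> first | omega | (simp (disch := omega) only [cls_eq_zero_of, cls_eq_one_of])

/-- Both alternatives in each bump of `f̃ᵢ` have the same pairing with the colour `j`, so the change
of `φⱼ - εⱼ` does not depend on the slice. -/
theorem Code.wt_f (hn : 4 ≤ n) (c : Code) (k : ℕ) (i j : Fin (n + 1)) :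
    (c.f n k i).phi n k j - (c.f n k i).eps n k j =
      c.phi n k j - c.eps n k j - affineCartanD n j i := by
  rw [affineCartanD_apply]
  have hi := i.isLt
  have hj := j.isLt
  generalize (i : ℕ) = i at *
  generalize (j : ℕ) = j at *
  unfold Code.f phi eps
  by_cases mi : 2 ≤ i ∧ i + 2 ≤ n <;> by_cases mj : 2 ≤ j ∧ j + 2 ≤ n
  · rw [if_pos mi, if_pos mj, if_pos mj, if_pos mj, if_pos mj, midF, midWt_bumpA, midWt_bumpA,
      midPairing_fst mi mj (by split_ifs <;> simp), midPairing_snd mi mj (by split_ifs <;> simp)]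
    split_ifs <;> omega
  · rw [if_pos mi, if_neg mj, if_neg mj, if_neg mj, if_neg mj, midF, endWt_bumpA, endWt_bumpA,
      endPairing_fst mi j (by split_ifs <;> simp), endPairing_snd mi j (by split_ifs <;> simp)]
    split_ifs <;> omega
  · rw [if_neg mi, if_pos mj, if_pos mj, if_pos mj, if_pos mj, endF,
      show ∀ (c : Code) s e k b, (c.bumpQ n s e k).midPhi b = c.midPhi b from
      fun _ _ _ _ _ => rfl, show ∀ (c : Code) s e k b, (c.bumpQ n s e k).midEps b = c.midEps b from
      fun _ _ _ _ _ => rfl, midWt_bumpA, midPairing_end hn i mj (by split_ifs <;> simp)]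
    split_ifs <;> omega
  · rw [if_neg mi, if_neg mj, if_neg mj, if_neg mj, if_neg mj, endF, endWt_bumpQ, endWt_bumpA,
      endPairing_end hn i j (by split_ifs <;> simp), cls_endBase hn k mi mj (by omega) (by omega)]
    split_ifs <;> omega

end
end YoungWall

namespace YoungWall

/-! ### Signatures -/

section
variable (e f : ℕ → ℕ)

/-- The number of `1`s in the signature of the rightmost `K` columns, where the `k`-th column has
`e k` many `1`s and `f k` many `0`s. -/
def sigOnes : ℕ → ℕ
  | 0 => 0
  | K + 1 => e K + (sigOnes K - f K)

/-- The `0`s of a column cancel only against `1`s to their right, so `sigOnes e f k` of them at most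
disappear, whatever stands to the left. -/
def IsLeftmostZero (k : ℕ) : Prop := sigOnes e f k < f k ∧ ∀ m, k < m → f m ≤ sigOnes e f m

/-- The `0`s of the column `k` absorb all `1`s to its right, and no later column absorbs all `1`s
present; so a `1` of the column `k` survives. That `e k` is positive follows from the condition at
`k + 1`. -/
def IsRightmostOne (k : ℕ) : Prop := sigOnes e f k ≤ f k ∧ ∀ m, k < m → f m < sigOnes e f m

/-- The columns of the `1`s in the signature of the rightmost `K` columns. -/
def sigOneList : ℕ → List ℕ
  | 0 => []
  | K + 1 => List.replicate (e K) K ++ (sigOneList K).drop (f K)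

/-- The columns of the `0`s in the signature of the rightmost `K` columns. -/
def sigZeroList : ℕ → List ℕ
  | 0 => []
  | K + 1 => List.replicate (f K - sigOnes e f K) K ++ sigZeroList K

end

section
variable {e f : ℕ → ℕ}

theorem length_sigOneList (K : ℕ) : (sigOneList e f K).length = sigOnes e f K := by
  induction K with
  | zero => rfl
  | succ K ih => simp [sigOneList, sigOnes, ih]

theorem foldr_cancelStep_one (k m : ℕ) (w : List (Sign × ℕ)) :
    (List.replicate m (Sign.one, k)).foldr cancelStep w = List.replicate m (.one, k) ++ w := by
  induction m with
  | zero => rfl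
  | succ m ih => rw [List.replicate_succ, List.foldr_cons, ih]; rfl

theorem foldr_cancelStep_zero (k m : ℕ) (O Z : List ℕ) :
    (List.replicate m (Sign.zero, k)).foldr cancelStep (O.map (Sign.one, ·) ++ Z.map (Sign.zero, ·)) =
      (O.drop m).map (Sign.one, ·) ++
        (List.replicate (m - O.length) k ++ Z).map (Sign.zero, ·) := by
  induction m with
  | zero => simp
  | succ m ih =>
    rw [List.replicate_succ, List.foldr_cons, ih]
    rcases lt_or_ge m O.length with h | h
    · rw [List.drop_eq_getElem_cons h, Nat.sub_eq_zero_of_le h.le, Nat.sub_eq_zero_of_le h]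
      rfl
    · rw [List.drop_eq_nil_of_le h, List.drop_eq_nil_of_le (by omega), Nat.sub_add_comm h]
      simp only [List.map_nil, List.nil_append, List.replicate_succ, List.cons_append, List.map_cons]
      rcases h : (List.replicate (m - O.length) k ++ Z) with _ | ⟨x, v⟩ <;> rfl

/-- A reduced word consists of `1`s followed by `0`s; the `0`s of a new column on the left remove
the leftmost `1`s first. -/
theorem cancel_columns (e f : ℕ → ℕ) {W : ℕ → List (Sign × ℕ)} (h0 : W 0 = [])
    (hW : ∀ K, W (K + 1) =
      (List.replicate (e K) (.one, K) ++ List.replicate (f K) (.zero, K)) ++ W K) (K : ℕ) :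
    cancel (W K) = (sigOneList e f K).map (Sign.one, ·) ++ (sigZeroList e f K).map (Sign.zero, ·) := by
  induction K with
  | zero => rw [h0]; rfl
  | succ K ih =>
    rw [cancel] at ih
    rw [hW, cancel, List.foldr_append, List.foldr_append, ih, foldr_cancelStep_zero,
      foldr_cancelStep_one, sigOneList, sigZeroList, length_sigOneList]
    simp

theorem count_sigZeroList {k K : ℕ} (h : k < K) :
    (sigZeroList e f K).count k = f k - sigOnes e f k := by
  have h0 : ∀ K, K ≤ k → (sigZeroList e f K).count k = 0 := by
    intro K hK
    induction K with
    | zero => rfl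
    | succ K ih =>
      rw [sigZeroList, List.count_append, ih (by omega), List.count_replicate]
      simp; omega
  induction K with
  | zero => omega
  | succ K ih =>
    rw [sigZeroList, List.count_append, List.count_replicate]
    rcases Nat.lt_succ_iff_lt_or_eq.1 h with h | rfl
    · rw [ih h]; simp; omega
    · rw [h0 _ le_rfl]; simp

/-- The number of `1`s to the right of the column `k` in the signature of the rightmost `K`
columns. -/
def sigOnesBelow (e f : ℕ → ℕ) (k K : ℕ) : ℕ := (sigOneList e f K).countP (· < k)

theorem sigOneList_lt (K : ℕ) : ∀ x ∈ sigOneList e f K, x < K := by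
  induction K with
  | zero => simp [sigOneList]
  | succ K ih =>
    intro x hx
    rw [sigOneList, List.mem_append] at hx
    rcases hx with hx | hx
    · rw [List.eq_of_mem_replicate hx]; omega
    · have := ih x (List.mem_of_mem_drop hx); omega

/-- Once `p` holds it holds for the rest of the list, so dropping from the front removes entries
satisfying `p` only after all others. -/
theorem countP_drop_of_pairwise (p : ℕ → Bool) :
    ∀ (L : List ℕ) (m : ℕ), (L.Pairwise fun a b => p a = true → p b = true) →
      (L.drop m).countP p = min (L.countP p) (L.length - m)
  | [], m, _ => by simp
  | x :: L, 0, _ => by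
    rw [List.drop_zero, Nat.sub_zero, min_eq_left List.countP_le_length]
  | x :: L, m + 1, h => by
    rw [List.pairwise_cons] at h
    rw [List.drop_succ_cons, countP_drop_of_pairwise p L m h.2, List.countP_cons, List.length_cons,
      Nat.add_sub_add_right]
    split_ifs with hx
    · have : L.countP p = L.length := List.countP_eq_length.2 fun b hb => h.1 b hb hx
      omega
    · rfl

theorem sigOneList_pairwise (K : ℕ) : (sigOneList e f K).Pairwise fun a b => b ≤ a := by
  induction K with
  | zero => simp [sigOneList]
  | succ K ih =>
    rw [sigOneList, List.pairwise_append]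
    refine ⟨?_, ih.drop, fun a ha b hb => ?_⟩
    · rw [List.pairwise_replicate]; simp
    · rw [List.eq_of_mem_replicate ha]
      exact (sigOneList_lt K b (List.mem_of_mem_drop hb)).le

theorem sigOnesBelow_self (k : ℕ) : sigOnesBelow e f k k = sigOnes e f k := by
  rw [sigOnesBelow, List.countP_eq_length.2 (by simpa using sigOneList_lt k), length_sigOneList]

theorem sigOnesBelow_succ {k K : ℕ} (h : k ≤ K) :
    sigOnesBelow e f k (K + 1) = min (sigOnesBelow e f k K) (sigOnes e f K - f K) := by
  rw [sigOnesBelow, sigOneList, List.countP_append, countP_drop_of_pairwise, length_sigOneList,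
    List.countP_replicate]
  · simp only [decide_eq_true_eq, if_neg (show ¬ K < k by omega)]
    rw [zero_add]; rfl
  · exact (sigOneList_pairwise K).imp fun h => by simp only [decide_eq_true_eq]; omega

theorem sigOnesBelow_zero (K : ℕ) : sigOnesBelow e f 0 K = 0 := by simp [sigOnesBelow]

theorem count_sigOneList (k K : ℕ) :
    (sigOneList e f K).count k + sigOnesBelow e f k K = sigOnesBelow e f (k + 1) K := by
  unfold sigOnesBelow
  induction sigOneList e f K with
  | nil => simp
  | cons x L ih =>
    rw [List.count_cons, List.countP_cons, List.countP_cons]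
    simp only [decide_eq_true_eq, beq_iff_eq]
    split_ifs <;> omega

end
end YoungWall

/-! ### Words with a cancelling tail, and changing one letter -/

namespace YoungWall

section
variable {e f : ℕ → ℕ}

theorem count_sigOneList_succ_le {k K : ℕ} (h : k < K) :
    (sigOneList e f (K + 1)).count k ≤ (sigOneList e f K).count k := by
  rw [sigOneList, List.count_append, List.count_replicate]
  have := ((sigOneList e f K).drop_sublist (f K)).count_le k
  simp only [beq_iff_eq, if_neg h.ne']
  omega

/-- The `1`s to the right of `k` are the last to be cancelled, hence they vanish precisely when some
column from `k` on cancels all `1`s present. -/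
theorem sigOnesBelow_eq_zero_iff {k K : ℕ} (h : k < K) :
    sigOnesBelow e f k K = 0 ↔ ∃ j, k ≤ j ∧ j < K ∧ sigOnes e f j ≤ f j := by
  induction K with
  | zero => omega
  | succ K ih =>
    rw [sigOnesBelow_succ (by omega)]
    rcases Nat.lt_succ_iff_lt_or_eq.1 h with h | rfl
    · constructor
      · intro h'
        by_cases h0 : sigOnesBelow e f k K = 0
        · obtain ⟨j, h1, h2, h3⟩ := (ih h).1 h0
          exact ⟨j, h1, by omega, h3⟩
        · exact ⟨K, by omega, by omega, by omega⟩
      · rintro ⟨j, h1, h2, h3⟩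
        rcases Nat.lt_succ_iff_lt_or_eq.1 h2 with h2 | rfl
        · rw [(ih h).2 ⟨j, h1, h2, h3⟩]; simp
        · omega
    · rw [sigOnesBelow_self]
      constructor
      · exact fun h => ⟨k, le_rfl, by omega, by omega⟩
      · rintro ⟨j, h1, h2, h3⟩
        obtain rfl : j = k := by omega
        omega

variable {N : ℕ}

/-- In the tail the `1`s of a column are cancelled by equally many `0`s of its left neighbour, so
the surplus is constant. -/
theorem sub_eq_of_tail (ht : ∀ K, N ≤ K → f (K + 1) = e K) {K : ℕ} (h : N ≤ K) :
    sigOnes e f K - f K = sigOnes e f N - f N := by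
  induction K, h using Nat.le_induction with
  | base => rfl
  | succ K h ih => rw [sigOnes, ht K h]; omega

theorem sigOnesBelow_of_tail (ht : ∀ K, N ≤ K → f (K + 1) = e K) {k K K' : ℕ} (h : N < K)
    (h' : k < K) (hK : K ≤ K') : sigOnesBelow e f k K' = sigOnesBelow e f k K := by
  have hle : sigOnesBelow e f k K ≤ sigOnes e f N - f N := by
    obtain ⟨K, rfl⟩ := Nat.exists_eq_add_one_of_ne_zero (show K ≠ 0 by omega)
    rw [sigOnesBelow_succ (by omega), sub_eq_of_tail ht (show N ≤ K by omega)]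
    exact min_le_right _ _
  induction K', hK using Nat.le_induction with
  | base => rfl
  | succ K' h1 ih =>
    rw [sigOnesBelow_succ (by omega), sub_eq_of_tail ht (by omega), ih]
    omega

theorem sigOnesBelow_of_tail_of_lt (ht : ∀ K, N ≤ K → f (K + 1) = e K) {k K : ℕ} (h : N < k)
    (h' : k < K) : sigOnesBelow e f k K = sigOnes e f N - f N := by
  rw [sigOnesBelow_of_tail ht (K := k + 1) (by omega) (by omega) (by omega),
    sigOnesBelow_succ le_rfl, sub_eq_of_tail ht h.le, sigOnesBelow_self]
  obtain ⟨k, rfl⟩ := Nat.exists_eq_add_one_of_ne_zero (show k ≠ 0 by omega)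
  rw [sigOnes, sub_eq_of_tail ht (show N ≤ k by omega)]
  omega

theorem isRightmostOne_iff_of_tail (ht : ∀ K, N ≤ K → f (K + 1) = e K) {c : ℕ → ℕ}
    (hc : ∀ k K, k + N + 2 ≤ K → c k = (sigOneList e f K).count k) (k : ℕ) :
    (c k ≠ 0 ∧ ∀ m, m < k → c m = 0) ↔ IsRightmostOne e f k := by
  have sum : ∀ k, (∀ m, m < k → c m = 0) ↔ ∀ K, k + N + 1 ≤ K → sigOnesBelow e f k K = 0 := by
    intro k
    induction k with
    | zero => simp [sigOnesBelow_zero]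
    | succ k ih =>
      constructor
      · intro h K hK
        have h1 := ih.1 (fun m hm => h m (by omega)) K (by omega)
        have h2 := hc k K (by omega)
        have h3 := count_sigOneList (e := e) (f := f) k K
        have h4 := h k (by omega)
        omega
      · intro h
        have h1 : ∀ K, k + N + 2 ≤ K → sigOnesBelow e f k K = 0 ∧ c k = 0 := fun K hK => by
          have h2 := hc k K (by omega)
          have h3 := count_sigOneList (e := e) (f := f) k K
          have h4 := h K (by omega)
          omega
        intro m hm
        rcases Nat.lt_succ_iff_lt_or_eq.1 hm with hm | rfl
        · refine ih.2 (fun K hK => ?_) m hm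
          rw [← sigOnesBelow_of_tail ht (K' := K + 1) (by omega) (by omega) (by omega)]
          exact (h1 (K + 1) (by omega)).1
        · exact (h1 _ le_rfl).2
  rw [sum]
  have step : ∀ K, k + N + 2 ≤ K → c k + sigOnesBelow e f k K = sigOnesBelow e f (k + 1) K :=
    fun K hK => by rw [hc k K hK, count_sigOneList]
  constructor
  · rintro ⟨h1, h2⟩
    have h3 : ∀ m, k < m → f m < sigOnes e f m := fun m hm => by
      have h4 := step (k + N + 2 + m) (by omega)
      rw [h2 _ (by omega)] at h4
      have h5 : ¬ sigOnesBelow e f (k + 1) (k + N + 2 + m) = 0 := by omega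
      rw [sigOnesBelow_eq_zero_iff (by omega)] at h5
      by_contra! h6
      exact h5 ⟨m, by omega, by omega, h6⟩
    refine ⟨?_, h3⟩
    obtain ⟨j, h4, h5, h6⟩ := (sigOnesBelow_eq_zero_iff (show k < k + N + 1 by omega)).1
      (h2 _ le_rfl)
    rcases h4.eq_or_lt with rfl | h4
    · exact h6
    · have := h3 j h4
      omega
  · rintro ⟨h1, h2⟩
    have h3 : ∀ K, k + N + 1 ≤ K → sigOnesBelow e f k K = 0 := fun K hK =>
      (sigOnesBelow_eq_zero_iff (by omega)).2 ⟨k, le_rfl, by omega, h1⟩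
    refine ⟨fun h0 => ?_, h3⟩
    have h4 := step _ le_rfl
    rw [h0, h3 _ (by omega)] at h4
    obtain ⟨j, h5, h6, h7⟩ := (sigOnesBelow_eq_zero_iff (by omega)).1 h4.symm
    have := h2 j (by omega)
    omega

theorem sum_count_of_tail (ht : ∀ K, N ≤ K → f (K + 1) = e K) {c : ℕ → ℕ}
    (hc : ∀ k K, k + N + 2 ≤ K → c k = (sigOneList e f K).count k) :
    (∀ k, N < k → c k = 0) ∧ ∑ k ∈ Finset.range (N + 1), c k = sigOnes e f N - f N := by
  have sum : ∀ k K, k + N + 1 ≤ K → ∑ j ∈ Finset.range k, c j = sigOnesBelow e f k K := by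
    intro k K hK
    induction k with
    | zero => simp [sigOnesBelow_zero]
    | succ k ih =>
      rw [Finset.sum_range_succ, ih (by omega), hc k K (by omega), add_comm, count_sigOneList]
  refine ⟨fun k hk => ?_, ?_⟩
  · have h1 := count_sigOneList (e := e) (f := f) k (k + N + 2)
    rw [← hc k _ le_rfl, sigOnesBelow_of_tail_of_lt ht hk (by omega),
      sigOnesBelow_of_tail_of_lt ht (by omega) (by omega)] at h1
    omega
  · rw [sum (N + 1) (N + 1 + N + 1) le_rfl, sigOnesBelow_of_tail_of_lt ht (by omega) (by omega)]

theorem zero_of_tail (ht : ∀ K, N ≤ K → f (K + 1) = e K) {k : ℕ} (h : N < k) :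
    f k - sigOnes e f k = 0 := by
  obtain ⟨k, rfl⟩ := Nat.exists_eq_add_one_of_ne_zero (show k ≠ 0 by omega)
  rw [sigOnes, ht k (by omega)]
  omega

/-- Cancellation removes as many `0`s as `1`s. The word is cut between the `0`s and the `1`s of the
column `N`, which explains the last summand. -/
theorem sum_zero_sub (N : ℕ) :
    (∑ k ∈ Finset.range (N + 1), (f k - sigOnes e f k) : ℕ) - ((sigOnes e f N - f N : ℕ) : ℤ) =
      ∑ k ∈ Finset.range N, ((f k : ℤ) - e k) + f N := by
  induction N with
  | zero => simp [sigOnes]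
  | succ N ih =>
    rw [Finset.sum_range_succ _ (N + 1), Finset.sum_range_succ (fun k => (f k : ℤ) - e k), sigOnes]
    push_cast at ih ⊢
    omega

theorem exists_isRightmostOne (ht : ∀ K, N ≤ K → f (K + 1) = e K)
    (h : sigOnes e f N - f N ≠ 0) : ∃ k, IsRightmostOne e f k := by
  have h1 : ∀ m, N ≤ m → f m < sigOnes e f m := fun m hm => by
    have := sub_eq_of_tail ht hm; omega
  have h2 : ∀ M, (∀ m, M ≤ m → f m < sigOnes e f m) → ∃ k, IsRightmostOne e f k := by
    intro M
    induction M with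
    | zero => intro h; have := h 0 le_rfl; simp [sigOnes] at this
    | succ M ih =>
      intro h
      by_cases hM : f M < sigOnes e f M
      · refine ih fun m hm => ?_
        rcases hm.eq_or_lt with rfl | hm
        · exact hM
        · exact h m hm
      · exact ⟨M, not_lt.1 hM, fun m hm => h m hm⟩
  exact h2 N h1

theorem exists_isLeftmostZero (ht : ∀ K, N ≤ K → f (K + 1) = e K)
    (h : ∑ k ∈ Finset.range (N + 1), (f k - sigOnes e f k) ≠ 0) : ∃ k, IsLeftmostZero e f k := by
  have h2 : ∀ M, (∀ m, M ≤ m → f m ≤ sigOnes e f m) →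
      ∑ k ∈ Finset.range M, (f k - sigOnes e f k) ≠ 0 → ∃ k, IsLeftmostZero e f k := by
    intro M
    induction M with
    | zero => simp
    | succ M ih =>
      intro h h'
      by_cases hM : f M ≤ sigOnes e f M
      · refine ih (fun m hm => ?_) ?_
        · rcases hm.eq_or_lt with rfl | hm
          · exact hM
          · exact h m hm
        · rw [Finset.sum_range_succ] at h'; omega
      · exact ⟨M, not_le.1 hM, fun m hm => h m hm⟩
  exact h2 (N + 1) (fun m hm => by have := zero_of_tail ht (k := m) hm; omega) h

theorem IsLeftmostZero.unique {k k' : ℕ} (h : IsLeftmostZero e f k) (h' : IsLeftmostZero e f k') :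
    k = k' := by
  rcases lt_trichotomy k k' with hk | hk | hk
  · have := h.2 k' hk; have := h'.1; omega
  · exact hk
  · have := h'.2 k hk; have := h.1; omega

theorem IsRightmostOne.unique {k k' : ℕ} (h : IsRightmostOne e f k) (h' : IsRightmostOne e f k') :
    k = k' := by
  rcases lt_trichotomy k k' with hk | hk | hk
  · have := h.2 k' hk; have := h'.1; omega
  · exact hk
  · have := h'.2 k hk; have := h.1; omega

/-- In a leftmost `0` there are more `0`s than `1`s in the column to the right. -/
theorem IsLeftmostZero.lt {k : ℕ} (h : IsLeftmostZero e f (k + 1)) : e k < f (k + 1) := by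
  have := h.1
  rw [sigOnes] at this
  omega

theorem IsRightmostOne.lt {k : ℕ} (h : IsRightmostOne e f k) : f (k + 1) < e k := by
  have h1 := h.1
  have h2 := h.2 (k + 1) (by omega)
  rw [sigOnes] at h2
  omega

variable {e' f' : ℕ → ℕ} {k : ℕ}

theorem sigOnes_congr (he : ∀ m, m < k → e' m = e m) (hf : ∀ m, m < k → f' m = f m) :
    sigOnes e' f' k = sigOnes e f k := by
  induction k with
  | zero => rfl
  | succ k ih =>
    rw [sigOnes, sigOnes, ih (fun m hm => he m (by omega)) fun m hm => hf m (by omega),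
      he k (by omega), hf k (by omega)]

/-- The new `1` raises `sigOnes` by one in all later columns, where the `0`s did not outnumber the
`1`s before. -/
theorem IsLeftmostZero.isRightmostOne (h : IsLeftmostZero e f k) (he : ∀ m, m ≠ k → e' m = e m)
    (hf : ∀ m, m ≠ k → f' m = f m) (hek : e' k = e k + 1) (hfk : f k = f' k + 1) :
    IsRightmostOne e' f' k := by
  have h0 : sigOnes e' f' k = sigOnes e f k :=
    sigOnes_congr (fun m hm => he m hm.ne) fun m hm => hf m hm.ne
  have h1 := h.1
  refine ⟨by omega, fun m hm => ?_⟩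
  have h2 : sigOnes e' f' m = sigOnes e f m + 1 := by
    induction m, hm using Nat.le_induction with
    | base => rw [sigOnes, sigOnes]; omega
    | succ m hm ih =>
      have := h.2 m hm
      rw [sigOnes, sigOnes, he m (by omega), hf m (by omega)]; omega
  have := h.2 m hm
  rw [hf m hm.ne']; omega

theorem IsRightmostOne.isLeftmostZero (h : IsRightmostOne e f k) (he : ∀ m, m ≠ k → e' m = e m)
    (hf : ∀ m, m ≠ k → f' m = f m) (hek : e k = e' k + 1) (hfk : f' k = f k + 1) :
    IsLeftmostZero e' f' k := by
  have h0 : sigOnes e' f' k = sigOnes e f k :=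
    sigOnes_congr (fun m hm => he m hm.ne) fun m hm => hf m hm.ne
  have h1 := h.1
  refine ⟨by omega, fun m hm => ?_⟩
  have h2 : sigOnes e f m = sigOnes e' f' m + 1 := by
    induction m, hm using Nat.le_induction with
    | base => rw [sigOnes, sigOnes]; omega
    | succ m hm ih =>
      have := h.2 m hm
      rw [sigOnes, sigOnes, he m (by omega), hf m (by omega)]; omega
  have := h.2 m hm
  rw [hf m hm.ne']; omega

theorem IsLeftmostZero.sigOnes_sub (h : IsLeftmostZero e f k) (he : ∀ m, m ≠ k → e' m = e m)
    (hf : ∀ m, m ≠ k → f' m = f m) (hek : e' k = e k + 1) (hfk : f k = f' k + 1) {m : ℕ}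
    (hm : k < m) : sigOnes e' f' m - f' m = sigOnes e f m - f m + 1 := by
  have h0 : sigOnes e' f' k = sigOnes e f k :=
    sigOnes_congr (fun m hm => he m hm.ne) fun m hm => hf m hm.ne
  have h1 := h.1
  have h2 : sigOnes e' f' m = sigOnes e f m + 1 := by
    induction m, hm using Nat.le_induction with
    | base => rw [sigOnes, sigOnes]; omega
    | succ m hm ih =>
      have := h.2 m hm
      rw [sigOnes, sigOnes, he m (by omega), hf m (by omega)]; omega
  have := h.2 m hm
  rw [hf m hm.ne']; omega

end

/-! ### Signatures of walls -/

section
variable {n l : ℕ}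

noncomputable def epsColumn (n i : ℕ) (Y : Wall l) (k : ℕ) : ℕ := (Y k).elim 0 (epsSlice n k i)

noncomputable def phiColumn (n i : ℕ) (Y : Wall l) (k : ℕ) : ℕ := (Y k).elim 0 (phiSlice n k i)

variable {i : ℕ} {Y : Wall l}

theorem columnWord_eq (k : ℕ) : columnWord n i Y k =
    List.replicate (epsColumn n i Y k) (.one, k) ++ List.replicate (phiColumn n i Y k) (.zero, k) := by
  unfold columnWord epsColumn phiColumn
  cases Y k <;> rfl

theorem cancel_word (K : ℕ) : cancel (word n i Y K) =
    (sigOneList (epsColumn n i Y) (phiColumn n i Y) K).map (Sign.one, ·) ++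
      (sigZeroList (epsColumn n i Y) (phiColumn n i Y) K).map (Sign.zero, ·) :=
  cancel_columns _ _ rfl (fun K => by rw [word, columnWord_eq]) K

theorem count_map_pair (s t : Sign) (k : ℕ) (L : List ℕ) :
    (L.map (s, ·)).count (t, k) = if s = t then L.count k else 0 := by
  split_ifs with h
  · subst h
    exact List.count_map_of_injective L _ (Prod.mk_right_injective s) k
  · refine List.count_eq_zero_of_not_mem fun h' => ?_
    simp [h] at h'

theorem count_cancel_word (s : Sign) (k K : ℕ) : (cancel (word n i Y K)).count (s, k) =
    match s with
    | .one => (sigOneList (epsColumn n i Y) (phiColumn n i Y) K).count k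
    | .zero => (sigZeroList (epsColumn n i Y) (phiColumn n i Y) K).count k := by
  rw [cancel_word, List.count_append, count_map_pair, count_map_pair]
  cases s <;> simp

theorem signCount_zero (k : ℕ) : signCount n i Y .zero k =
    phiColumn n i Y k - sigOnes (epsColumn n i Y) (phiColumn n i Y) k := by
  rw [signCount, ← csInf_singleton (phiColumn n i Y k - _)]
  congr 1
  ext m
  simp only [count_cancel_word, Set.mem_ofPred_eq, Set.mem_singleton_iff]
  constructor
  · rintro ⟨K, hK, rfl⟩
    rw [count_sigZeroList hK]
  · rintro rfl
    exact ⟨k + 1, by omega, by rw [count_sigZeroList (by omega)]⟩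

/-- The count decreases as columns are added on the left and is constant from `k + N + 2` on, so its
infimum is this final value. -/
theorem signCount_one {N : ℕ} (ht : ∀ K, N ≤ K → phiColumn n i Y (K + 1) = epsColumn n i Y K)
    {k K : ℕ} (hK : k + N + 2 ≤ K) : signCount n i Y .one k =
      (sigOneList (epsColumn n i Y) (phiColumn n i Y) K).count k := by
  set a := fun K => (sigOneList (epsColumn n i Y) (phiColumn n i Y) K).count k with ha
  have hanti : ∀ K1 K2, k < K1 → K1 ≤ K2 → a K2 ≤ a K1 := fun K1 K2 h1 h2 => by
    induction K2, h2 using Nat.le_induction with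
    | base => rfl
    | succ K2 h2 ih => exact (count_sigOneList_succ_le (by omega)).trans ih
  have hconst : ∀ K1 K2, k + N + 2 ≤ K1 → K1 ≤ K2 → a K2 = a K1 := fun K1 K2 h1 h2 => by
    have h3 := count_sigOneList (e := epsColumn n i Y) (f := phiColumn n i Y) k K1
    have h4 := count_sigOneList (e := epsColumn n i Y) (f := phiColumn n i Y) k K2
    rw [sigOnesBelow_of_tail ht (K := K1) (by omega) (by omega) h2,
      sigOnesBelow_of_tail ht (K := K1) (by omega) (by omega) h2] at h4
    simp only [ha]; omega
  refine IsLeast.csInf_eq ⟨⟨K, by omega, by rw [count_cancel_word]⟩, ?_⟩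
  rintro m ⟨K', hK', rfl⟩
  rw [count_cancel_word]
  change a K ≤ a K'
  rcases le_total K K' with h | h
  · exact (hconst K K' hK h).ge
  · exact hanti K' K hK' h

theorem hasLeftmostZero_iff (k : ℕ) :
    HasLeftmostZero n i Y k ↔ IsLeftmostZero (epsColumn n i Y) (phiColumn n i Y) k := by
  simp only [HasLeftmostZero, signCount_zero, IsLeftmostZero, Nat.sub_eq_zero_iff_le, ne_eq, not_le]

variable {N : ℕ} (ht : ∀ K, N ≤ K → phiColumn n i Y (K + 1) = epsColumn n i Y K)
include ht

theorem hasRightmostOne_iff (k : ℕ) :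
    HasRightmostOne n i Y k ↔ IsRightmostOne (epsColumn n i Y) (phiColumn n i Y) k :=
  isRightmostOne_iff_of_tail ht (fun _ _ hK => signCount_one ht hK) k

theorem signCount_eq_zero (s : Sign) {k : ℕ} (hk : N < k) : signCount n i Y s k = 0 := by
  cases s
  · exact (sum_count_of_tail ht fun _ _ hK => signCount_one ht hK).1 k hk
  · rw [signCount_zero, zero_of_tail ht hk]

theorem finsum_signCount (s : Sign) :
    ∑ᶠ k, signCount n i Y s k = ∑ k ∈ Finset.range (N + 1), signCount n i Y s k := by
  refine finsum_eq_sum_of_support_subset _ fun k hk => ?_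
  rw [Finset.coe_range, Set.mem_Iio]
  by_contra! h
  exact hk (signCount_eq_zero ht s h)

theorem epsWall_eq : epsWall n i Y =
    sigOnes (epsColumn n i Y) (phiColumn n i Y) N - phiColumn n i Y N := by
  rw [epsWall, finsum_signCount ht]
  exact (sum_count_of_tail ht fun _ _ hK => signCount_one ht hK).2

theorem phiWall_eq : phiWall n i Y = ∑ k ∈ Finset.range (N + 1),
    (phiColumn n i Y k - sigOnes (epsColumn n i Y) (phiColumn n i Y) k) := by
  rw [phiWall, finsum_signCount ht]
  simp only [signCount_zero]

theorem phiWall_sub_epsWall : (phiWall n i Y : ℤ) - epsWall n i Y =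
    ∑ k ∈ Finset.range N, ((phiColumn n i Y k : ℤ) - epsColumn n i Y k) + phiColumn n i Y N := by
  rw [epsWall_eq ht, phiWall_eq ht, ← sum_zero_sub (e := epsColumn n i Y)]

theorem phiWall_eq_zero_iff : phiWall n i Y = 0 ↔ ¬ ∃ k, HasLeftmostZero n i Y k := by
  simp only [hasLeftmostZero_iff]
  constructor
  · rintro h ⟨k, hk, hk'⟩
    rw [phiWall_eq ht, Finset.sum_eq_zero_iff] at h
    by_cases hkN : k < N + 1
    · have := h k (Finset.mem_range.2 hkN); omega
    · have := zero_of_tail ht (k := k) (by omega); omega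
  · intro h
    by_contra h'
    rw [phiWall_eq ht] at h'
    exact h (exists_isLeftmostZero ht h')

theorem epsWall_eq_zero_iff : epsWall n i Y = 0 ↔ ¬ ∃ k, HasRightmostOne n i Y k := by
  simp only [hasRightmostOne_iff ht]
  constructor
  · rintro h ⟨k, hk, hk'⟩
    rw [epsWall_eq ht, ← sub_eq_of_tail ht (show N ≤ N + k + 1 by omega)] at h
    have := hk' (N + k + 1) (by omega)
    omega
  · intro h
    by_contra h'
    rw [epsWall_eq ht] at h'
    exact h (exists_isRightmostOne ht h')

end
end YoungWall

namespace YoungWall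

section
variable {n l : ℕ} {A B C : Layers l} {a b c : Code}

/-! ### Neighbouring columns -/

theorem Layer.eq_flat_iff {x : Layer} {r : ℤ} : x = ⟨r, .flat⟩ ↔ x.height = 2 * r := by
  constructor
  · rintro rfl; exact Layer.height_flat r
  · intro h
    rcases x.height_cases with ⟨h1, h2⟩ | ⟨h1, h2⟩
    · exact Layer.ext (by simp only; omega) h1
    · omega

/-- A half lies outside the interval of single blocks: before it if it is an upper half, after it if
it is a lower half. -/
theorem Rep.half_cases (hC : Rep n C c) {p : Fin l} (hp : (C p).top = .half)
    (hd : cycleLength n ∣ (C p).height - 1) :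
    (∀ t, ((p : ℕ) : ℤ) < c.Q t ((C p).height - 1)) ∨
      (∀ t, c.Q t ((C p).height - 1) ≤ (p : ℕ)) := by
  have h1 := mt (hC.single_iff p .front).2 (by simp [hp])
  have h2 := mt (hC.single_iff p .back).2 (by simp [hp])
  simp only [hd, true_and, Side.swap] at h1 h2
  by_cases h : c.Q .front ((C p).height - 1) ≤ (p : ℕ)
  · right; rintro (_ | _) <;> omega
  · left; rintro (_ | _) <;> omega

/-- Un-splitting contracts the class `e + 1` to the interval of single blocks; the layers before it
fall to `e`, those after it rise to `e + 2`. -/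
theorem Rep.unsplitAll_half (hn : 4 ≤ n) (hl : 1 ≤ l) (hc : c.IsSemi n l) (hC : Rep n C c) (i : ℕ)
    {p : Fin l} (hp : (C p).top = .half) (hj : rowBlock n (C p).row = wholeOf i) :
    (unsplitAll n (wholeOf i) C p = ⟨(C p).row, .flat⟩ ↔
        ∀ t, ((p : ℕ) : ℤ) < c.Q t ((C p).height - 1)) ∧
      (unsplitAll n (wholeOf i) C p = ⟨(C p).row + 1, .flat⟩ ↔
        ∀ t, c.Q t ((C p).height - 1) ≤ (p : ℕ)) := by
  have hTe := endBase_dvd (n := n) i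
  have hH := Layer.height_of_ne_flat (c := C p) (by simp [hp])
  rw [rowBlock_wholeOf_iff hn i rfl] at hj
  change 2 * cycleLength n ∣ _ - endBase n i at hj
  obtain ⟨m, hm⟩ := exists_eq_add_mul_of_dvd hj
  obtain ⟨m', -, hd, hD, s, hs⟩ := hC.rep_unsplitAll hn hl hc (wholeOf_isEnd i) rfl
  change Rep n _ (c.flip n (endBase n i + 2) (-m')) at hD
  change (c.flip n (endBase n i + 2) (-m')).IsSemi n l at hd
  change c.Q s (endBase n i) = c.a (endBase n i + 2) - m' at hs
  obtain ⟨f0, f1, f2, f3⟩ := c.flip_end (n := n) (-m') hTe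
  have bal := hc.balance s _ hTe
  generalize endBase n i = e at *
  have hEd : cycleLength n ∣ (C p).height - 1 := by
    rw [hH, add_sub_cancel_right, hm]
    exact hTe.add ((Dvd.intro_left 2 rfl).trans (Dvd.intro _ rfl))
  have hcs := hC.half_cases hp hEd
  rw [hH, add_sub_cancel_right, hm] at hcs ⊢
  have k := (hC.height_eq_iff p (e + 1 + 2 * cycleLength n * m)).1 (by rw [hH, hm]; ring)
  rw [show e + 1 + 2 * cycleLength n * m + 1 = e + 2 + 2 * cycleLength n * m by ring,
    hc.period.add_mul, hc.period.add_mul] at k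
  have q := fun t => (hc.periodQ t).add_mul e m
  simp only [q] at hcs ⊢
  rw [Layer.eq_flat_iff, Layer.eq_flat_iff, mul_add, hm, hD.height_eq_iff, hD.height_eq_iff,
    show e + 2 * cycleLength n * m + 1 = e + 1 + 2 * cycleLength n * m by ring,
    show e + 2 * cycleLength n * m + 2 * 1 = e + 2 + 2 * cycleLength n * m by ring,
    show e + 2 + 2 * cycleLength n * m + 1 = e + 3 + 2 * cycleLength n * m by ring,
    hd.period.add_mul, hd.period.add_mul, hd.period.add_mul, hd.period.add_mul, f0, f1, f2, f3]
  have u1 := hc.mono e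
  have u2 := hc.mono (e + 2)
  rw [add_assoc, show (2 : ℤ) + 1 = 3 by norm_num] at u2
  have u3 := hc.lower s e hTe
  have u4 := hd.mono (e + 1)
  rw [add_assoc, one_add_one_eq_two, f1, f2] at u4
  constructor
  · constructor
    · intro h
      exact forall_side s (by omega) (by omega)
    · intro h
      have h1 := h s
      have h2 := h s.swap
      omega
  · constructor
    · intro h
      rcases hcs with hcs | hcs
      · have h1 := hcs s
        have h2 := hcs s.swap
        omega
      · exact hcs
    · intro h
      have h1 := h s
      have h2 := h s.swap
      omega

theorem exists_wholeOf (hn : 4 ≤ n) {j : Whole} (hj : j = .zo ∨ j = .nn) : ∃ i, j = wholeOf i := by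
  rcases hj with rfl | rfl
  · exact ⟨0, rfl⟩
  · exact ⟨n, by rw [wholeOf, if_neg (by omega)]⟩

theorem Rep.isUpperHalf_iff (hn : 4 ≤ n) (hl : 1 ≤ l) (hc : c.IsSemi n l) (hC : Rep n C c)
    {p : Fin l} (hp : (C p).top = .half) (hd : cycleLength n ∣ (C p).height - 1) :
    IsUpperHalf n C p ↔ ∀ t, ((p : ℕ) : ℤ) < c.Q t ((C p).height - 1) := by
  have h0 := hd
  rw [Layer.height_of_ne_flat (by simp [hp]), add_sub_cancel_right, ← rowBlock_end_iff hn] at h0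
  obtain ⟨i, hi⟩ := exists_wholeOf hn h0
  rw [← (hC.unsplitAll_half hn hl hc i hp hi).1]
  constructor
  · rintro ⟨-, j, hj, h1, h2⟩
    rwa [← hi, h1]
  · exact fun h => ⟨hp, _, wholeOf_cases i, hi, h⟩

theorem Rep.isLowerHalf_iff (hn : 4 ≤ n) (hl : 1 ≤ l) (hc : c.IsSemi n l) (hC : Rep n C c)
    {p : Fin l} (hp : (C p).top = .half) (hd : cycleLength n ∣ (C p).height - 1) :
    IsLowerHalf n C p ↔ ∀ t, c.Q t ((C p).height - 1) ≤ (p : ℕ) := by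
  have h0 := hd
  rw [Layer.height_of_ne_flat (by simp [hp]), add_sub_cancel_right, ← rowBlock_end_iff hn] at h0
  obtain ⟨i, hi⟩ := exists_wholeOf hn h0
  rw [← (hC.unsplitAll_half hn hl hc i hp hi).2]
  constructor
  · rintro ⟨-, j, hj, h1, h2⟩
    rwa [← hi, h1]
  · exact fun h => ⟨hp, _, wholeOf_cases i, hi, h⟩

/-- The slice with the code `a` may stand to the left of the slice with the code `b` in a proper
Young wall. -/
structure Code.Rel (n : ℕ) (a b : Code) : Prop where
  le : ∀ h, Even h → b.a (h + 1) ≤ a.a h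
  leQ : ∀ s e, cycleLength n ∣ e → b.Q s e ≤ a.Q s e

theorem Code.Rel.a_le (hab : a.Rel n b) (ha : a.Basic n l) (hb : b.Basic n l) (h : ℤ) :
    b.a h ≤ a.a h := by
  rcases Int.even_or_odd h with hh | hh
  · exact (hb.mono h).trans (hab.le h hh)
  · have := hab.le (h - 1) (hh.sub_odd odd_one)
    have h2 := ha.mono (h - 1)
    rw [sub_add_cancel] at this h2
    exact this.trans h2

theorem Layer.top_ne_flat_of_odd {x : Layer} (h : Odd x.height) : x.top ≠ .flat := fun h' => by
  rw [Layer.height_of_flat h'] at h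
  exact Int.not_odd_iff_even.2 (even_two_mul _) h

theorem NoFreeSpace.height_le {p : Fin l} (h : NoFreeSpace n A B p) :
    (A p).height ≤ (B p).height := by
  rcases h with h | ⟨h, h'⟩
  · have := (A p).height_cases
    have := (B p).height_cases
    omega
  · rcases (A p).height_cases with ⟨h1, h2⟩ | ⟨h1, h2⟩
    · have := (B p).height_cases
      omega
    · rcases (B p).height_cases with ⟨h3, h4⟩ | ⟨h3, h4⟩
      · rw [h3] at h'
        rcases hA : (A p).top with _ | _ | _ <;> simp [hA] at h' h1
      · omega

/-- Heights do not increase to the left, and at an even height equality would mean two flat tops of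
equal height, which properness forbids; this gives the strict form of `le`. -/
theorem Code.Rel.of_noFreeSpace (hn : 4 ≤ n) (hl : 1 ≤ l) (ha : a.IsSliceCode n l)
    (hb : b.IsSliceCode n l) (hA : Rep n A a) (hB : Rep n B b) (h : ∀ p, NoFreeSpace n A B p)
    (h' : ∀ p, (A p).top = .flat → (B p).top = .flat → (A p).row ≠ (B p).row) : a.Rel n b := by
  have key : ∀ h, Even h → b.a (h + 1) ≤ a.a h := by
    intro x hx
    by_contra! hlt
    obtain ⟨p, m, hp⟩ := exists_index hl (a.a x)
    have hx' : Even (x + 2 * cycleLength n * m) := hx.add ((even_two_mul _).mul_right _)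
    have h1 := (hA.le_iff p (x + 2 * cycleLength n * m)).1 (by rw [ha.period.add_mul]; omega)
    have h2 := (hB.lt_iff p (x + 1 + 2 * cycleLength n * m)).1 (by rw [hb.period.add_mul]; omega)
    have h3 := (h p).height_le
    obtain ⟨z, hz⟩ := hx'
    have h4 := (A p).height_cases
    have h5 := (B p).height_cases
    have h6 := h' p
    rcases h4 with ⟨h4, h4'⟩ | ⟨h4, h4'⟩
    · rcases h5 with ⟨h5, h5'⟩ | ⟨h5, h5'⟩
      · exact h6 h4 h5 (by omega)
      · omega
    · omega
  refine ⟨key, fun s e he => ?_⟩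
  by_contra! hlt
  obtain ⟨p, m, hp⟩ := exists_index hl (a.Q s e)
  have hE : cycleLength n ∣ e + 2 * cycleLength n * m :=
    he.add ((Dvd.intro_left 2 rfl).trans (Dvd.intro _ rfl))
  have q1 : a.Q s (e + 2 * cycleLength n * m) ≤ (p : ℕ) := by
    rw [(ha.periodQ s).add_mul]; omega
  have q2 : ((p : ℕ) : ℤ) < b.Q s (e + 2 * cycleLength n * m) := by
    rw [(hb.periodQ s).add_mul]; omega
  generalize e + 2 * cycleLength n * m = E at *
  have h1 := (hA.le_iff p (E + 1)).1 ((ha.lower s E hE).trans q1)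
  have h2 := (hB.lt_iff p (E + 2)).1 (q2.trans_le (hb.upper s E hE))
  have h3 := (h p).height_le
  have HA : (A p).height = E + 1 := by omega
  have HB : (B p).height = E + 1 := by omega
  have balA := ha.balance s E hE
  have balB := hb.balance s E hE
  have hodd := (even_of_dvd hE).add_one
  have hfA := Layer.top_ne_flat_of_odd (x := A p) (by rwa [HA])
  have hfB := Layer.top_ne_flat_of_odd (x := B p) (by rwa [HB])
  have HA' := Layer.height_of_ne_flat hfA
  have HB' := Layer.height_of_ne_flat hfB
  have dA : cycleLength n ∣ (A p).height - 1 := by rwa [HA, add_sub_cancel_right]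
  have dB : cycleLength n ∣ (B p).height - 1 := by rwa [HB, add_sub_cancel_right]
  have hup := fun h => hA.isUpperHalf_iff hn hl ha.toIsSemi (p := p) h dA
  have hlo := fun h => hB.isLowerHalf_iff hn hl hb.toIsSemi (p := p) h dB
  have cA := fun h => hA.half_cases (p := p) h dA
  have cB := fun h => hB.half_cases (p := p) h dB
  have sA := hA.single_iff p
  have sB := hB.single_iff p
  rw [HA, add_sub_cancel_right] at hup cA
  rw [HB, add_sub_cancel_right] at hlo cB
  simp only [HA, add_sub_cancel_right] at sA
  simp only [HB, add_sub_cancel_right] at sB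
  rcases h p with h4 | ⟨-, h4⟩
  · omega
  · rcases tA : (A p).top with _ | t | _
    · exact hfA tA
    · obtain ⟨-, w1, w2⟩ := (sA t).1 tA
      obtain rfl : t = s := by
        by_contra hts
        obtain rfl := Side.eq_swap_of_ne (Ne.symm hts)
        omega
      rcases tB : (B p).top with _ | u | _
      · exact hfB tB
      · simp only [tA, tB] at h4
        subst h4
        have := ((sB t).1 tB).2.1
        omega
      · simp only [tA, tB] at h4
        have := (hlo tB).1 h4 t
        omega
    · rcases tB : (B p).top with _ | u | _
      · exact hfB tB
      · simp only [tA, tB] at h4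
        have := (hup tA).1 h4 s
        omega
      -- Two broken halves never leave free space, so a lower half to the left of an upper half has
      -- to be ruled out by counting: it contradicts `balance` and the inequalities for `a`.
      · have m1 : b.a (E + 1) ≤ a.a (E + 1) := by
          have := key E (even_of_dvd hE)
          have := ha.mono E
          omega
        have m2 : b.a (E + 2) ≤ a.a (E + 2) := by
          have := key (E + 2) ((even_of_dvd hE).add even_two)
          have := hb.mono (E + 2)
          omega
        rcases cA tA with h5 | h5
        · have := h5 s; omega
        · rcases cB tB with h6 | h6
          · have := h5 s.swap
            have := h6 s.swap
            omega
          · have := h6 s; omega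

theorem Code.Rel.noFreeSpace (hn : 4 ≤ n) (hl : 1 ≤ l) (ha : a.IsSliceCode n l)
    (hb : b.IsSliceCode n l) (hA : Rep n A a) (hB : Rep n B b) (hab : a.Rel n b) (p : Fin l) :
    NoFreeSpace n A B p ∧ ((A p).top = .flat → (B p).top = .flat → (A p).row ≠ (B p).row) := by
  have hle : (A p).height ≤ (B p).height :=
    (hB.le_iff p _).1 ((hab.a_le ha.toBasic hb.toBasic _).trans ((hA.le_iff p _).2 le_rfl))
  constructor
  · by_cases hr : (A p).row < (B p).row
    · exact Or.inl hr
    have cA := (A p).height_cases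
    have cB := (B p).height_cases
    have hr' : (A p).row = (B p).row := by omega
    refine Or.inr ⟨hr', ?_⟩
    by_cases tA : (A p).top = .flat
    · simp only [tA]
    · have tB : (B p).top ≠ .flat := fun h => by
        have := Layer.height_of_ne_flat tA
        have := Layer.height_of_flat h
        omega
      have HA := Layer.height_of_ne_flat tA
      have HB := Layer.height_of_ne_flat tB
      have hH : (B p).height = (A p).height := by omega
      have sA := hA.single_iff p
      have sB := hB.single_iff p
      rw [hH] at sB
      have hQ : cycleLength n ∣ (A p).height - 1 → ∀ s,
          a.Q s ((A p).height - 1) ≤ (p : ℕ) → b.Q s ((A p).height - 1) ≤ (p : ℕ) :=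
        fun hd s h => (hab.leQ s _ hd).trans h
      have hup := hA.isUpperHalf_iff hn hl ha.toIsSemi (p := p)
      have hlo := hB.isLowerHalf_iff hn hl hb.toIsSemi (p := p)
      have eA := hA.half_cases (p := p)
      have eB := hB.half_cases (p := p)
      rw [hH] at hlo eB
      generalize (A p).height - 1 = E at *
      rcases tA' : (A p).top with _ | s | _
      · exact (tA tA').elim
      · obtain ⟨hE, u1, u2⟩ := (sA s).1 tA'
        have u3 := hQ hE s u1
        rcases tB' : (B p).top with _ | t | _
        · exact (tB tB').elim
        · obtain ⟨-, v1, v2⟩ := (sB t).1 tB'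
          simp only
          by_contra hst
          obtain rfl := Side.eq_swap_of_ne hst
          omega
        · simp only
          rw [hlo tB' hE]
          rcases eB tB' hE with h | h
          · have := h s; omega
          · exact h
      · rcases tB' : (B p).top with _ | t | _
        · exact (tB tB').elim
        · obtain ⟨hE, v1, v2⟩ := (sB t).1 tB'
          simp only
          rw [hup tA' hE]
          rcases eA tA' hE with h | h
          · exact h
          · have := hQ hE _ (h t.swap); omega
        · trivial
  · intro tA tB hr
    have HA := Layer.height_of_flat tA
    have HB := Layer.height_of_flat tB
    have h1 := hab.le _ (HA ▸ even_two_mul _)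
    have h2 := ((hA.height_eq_iff p _).1 rfl).1
    have h3 := ((hB.height_eq_iff p _).1 rfl).2
    rw [show (B p).height = (A p).height by omega] at h3
    omega

end
end YoungWall

namespace YoungWall

section
variable {n l : ℕ} {a b c : Code}

/-! ### The operators on neighbouring columns -/

theorem Code.Rel.trans (hab : a.Rel n b) (hbc : b.Rel n c) (hb : b.Basic n l) : a.Rel n c where
  le h hh := (hbc.le h hh).trans ((hb.mono h).trans (hab.le h hh))
  leQ s e he := (hbc.leQ s e he).trans (hab.leQ s e he)

theorem Code.Rel.lower_left (hab : a.Rel n b) (ha : a.Basic n l) (hb : b.Basic n l) {x : ℤ}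
    (hx : Even x → b.a (x + 1) < a.a x) : (a.bumpA n x (-1)).Rel n b where
  le h hh := by
    simp only [bumpA]
    by_cases hd : 2 * cycleLength n ∣ h - x
    · rw [bump_of_dvd hd]
      obtain ⟨m, rfl⟩ := exists_eq_add_mul_of_dvd hd
      have hx' : Even x := by
        have := hh.sub ((even_two_mul (cycleLength n)).mul_right m)
        rwa [add_sub_cancel_right] at this
      have := hx hx'
      rw [add_right_comm, hb.period.add_mul, ha.period.add_mul]
      omega
    · rw [bump_of_not_dvd hd]
      exact hab.le h hh
  leQ := hab.leQ

theorem Code.Rel.raise_right (hab : a.Rel n b) (ha : a.Basic n l) (hb : b.Basic n l) {x : ℤ}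
    (hx : Odd x → b.a x < a.a (x - 1)) : a.Rel n (b.bumpA n x 1) where
  le h hh := by
    simp only [bumpA]
    by_cases hd : 2 * cycleLength n ∣ h + 1 - x
    · rw [bump_of_dvd hd]
      obtain ⟨m, hm⟩ := exists_eq_add_mul_of_dvd hd
      obtain rfl : h = x - 1 + 2 * cycleLength n * m := by linarith
      have hx' : Odd x := by
        have := (hh.sub ((even_two_mul (cycleLength n)).mul_right m)).add_one
        rwa [add_sub_cancel_right, sub_add_cancel] at this
      have := hx hx'
      rw [hm, hb.period.add_mul, ha.period.add_mul]
      omega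
    · rw [bump_of_not_dvd hd]
      exact hab.le h hh
  leQ := hab.leQ

theorem Code.Rel.lowerQ_left (hab : a.Rel n b) (ha : a.Basic n l) (hb : b.Basic n l) {s : Side}
    {e : ℤ} (h : b.Q s e < a.Q s e) : (a.bumpQ n s e (-1)).Rel n b where
  le := hab.le
  leQ := forall_side s (fun x hx => by
      rw [bumpQ_self]
      by_cases hd : 2 * cycleLength n ∣ x - e
      · rw [bump_of_dvd hd]
        obtain ⟨m, rfl⟩ := exists_eq_add_mul_of_dvd hd
        rw [(ha.periodQ s).add_mul, (hb.periodQ s).add_mul]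
        omega
      · rw [bump_of_not_dvd hd]
        exact hab.leQ s x hx)
    (by rw [bumpQ_swap]; exact hab.leQ _)

theorem Code.Rel.raiseQ_right (hab : a.Rel n b) (ha : a.Basic n l) (hb : b.Basic n l) {s : Side}
    {e : ℤ} (h : b.Q s e < a.Q s e) : a.Rel n (b.bumpQ n s e 1) where
  le := hab.le
  leQ := forall_side s (fun x hx => by
      rw [bumpQ_self]
      by_cases hd : 2 * cycleLength n ∣ x - e
      · rw [bump_of_dvd hd]
        obtain ⟨m, rfl⟩ := exists_eq_add_mul_of_dvd hd
        rw [(ha.periodQ s).add_mul, (hb.periodQ s).add_mul]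
        omega
      · rw [bump_of_not_dvd hd]
        exact hab.leQ s x hx)
    (by rw [bumpQ_swap]; exact hab.leQ _)

theorem Code.Rel.mono (hab : a.Rel n b) {a' b' : Code} (ha : ∀ h, a.a h ≤ a'.a h)
    (haQ : ∀ s h, a.Q s h ≤ a'.Q s h) (hb : ∀ h, b'.a h ≤ b.a h) (hbQ : ∀ s h, b'.Q s h ≤ b.Q s h) :
    a'.Rel n b' where
  le h hh := (hb _).trans ((hab.le h hh).trans (ha _))
  leQ s e he := (hbQ _ _).trans ((hab.leQ s e he).trans (haQ _ _))

theorem Code.bumpQ_le (c : Code) (s t : Side) (e x : ℤ) {k : ℤ} (hk : k ≤ 0) :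
    (c.bumpQ n s e k).Q t x ≤ c.Q t x :=
  forall_side (P := fun t => (c.bumpQ n s e k).Q t x ≤ c.Q t x) s
    (by rw [bumpQ_self]; exact bump_le _ _ hk _) (by rw [bumpQ_swap]) t

theorem Code.le_bumpQ (c : Code) (s t : Side) (e x : ℤ) {k : ℤ} (hk : 0 ≤ k) :
    c.Q t x ≤ (c.bumpQ n s e k).Q t x :=
  forall_side (P := fun t => c.Q t x ≤ (c.bumpQ n s e k).Q t x) s
    (by rw [bumpQ_self]; exact le_bump _ _ hk _) (by rw [bumpQ_swap]) t

theorem Code.f_le (c : Code) (k i : ℕ) :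
    (∀ h, (c.f n k i).a h ≤ c.a h) ∧ ∀ s h, (c.f n k i).Q s h ≤ c.Q s h := by
  unfold Code.f
  split_ifs
  · exact ⟨fun h => (bump_le _ _ (by norm_num) _).trans (bump_le _ _ (by norm_num) _),
      fun _ _ => le_rfl⟩
  · exact ⟨fun h => bump_le _ _ (by norm_num) _, fun s h => bumpQ_le _ _ _ _ _ (by norm_num)⟩

theorem Code.le_e (c : Code) (k i : ℕ) :
    (∀ h, c.a h ≤ (c.e n k i).a h) ∧ ∀ s h, c.Q s h ≤ (c.e n k i).Q s h := by
  unfold Code.e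
  split_ifs
  · exact ⟨fun h => (le_bump _ _ (by norm_num) _).trans (le_bump _ _ (by norm_num) _),
      fun _ _ => le_rfl⟩
  · exact ⟨fun h => le_bump _ _ (by norm_num) _, fun s h => le_bumpQ _ _ _ _ _ (by norm_num)⟩

theorem Code.Rel.f_right (hab : a.Rel n b) (k i : ℕ) : a.Rel n (b.f n k i) :=
  hab.mono (fun _ => le_rfl) (fun _ _ => le_rfl) (b.f_le k i).1 (b.f_le k i).2

theorem Code.Rel.e_left (hab : a.Rel n b) (k i : ℕ) : (a.e n k i).Rel n b :=
  hab.mono (a.le_e k i).1 (a.le_e k i).2 (fun _ => le_rfl) (fun _ _ => le_rfl)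

/-- If the two bumps never hit the same height, each can be tested separately. -/
theorem bump_bump_of_ne {x y h k : ℤ} {f : ℤ → ℤ} {z : ℤ}
    (hxy : 2 * cycleLength n ∣ h - x → 2 * cycleLength n ∣ h - y → False)
    (h1 : z ≤ bump n f x k h) (h2 : z ≤ bump n f y k h) : z ≤ bump n (bump n f x k) y k h := by
  by_cases hd : 2 * cycleLength n ∣ h - y
  · rw [bump_of_dvd hd] at h2 ⊢
    rwa [bump_of_not_dvd fun h => hxy h hd]
  · rwa [bump_of_not_dvd hd]

theorem bump_bump_of_ne' {x y h k : ℤ} {f : ℤ → ℤ} {z : ℤ}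
    (hxy : 2 * cycleLength n ∣ h - x → 2 * cycleLength n ∣ h - y → False)
    (h1 : bump n f x k h ≤ z) (h2 : bump n f y k h ≤ z) : bump n (bump n f x k) y k h ≤ z := by
  by_cases hd : 2 * cycleLength n ∣ h - y
  · rw [bump_of_dvd hd] at h2 ⊢
    rwa [bump_of_not_dvd fun h => hxy h hd]
  · rwa [bump_of_not_dvd hd]

/-- Only the alternatives `w - x` and `w + x` have the parity of `h`, and they differ by `2 * x`,
which is no multiple of the period. -/
theorem not_dvd_of_mid {x h u v : ℤ} (hTx : ¬ cycleLength n ∣ x) {w : ℤ}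
    (hu : (h - u) % 2 = 1 ∨ u = w - x) (hv : (h - v) % 2 = 1 ∨ v = w - -x)
    (h1 : 2 * cycleLength n ∣ h - u) (h2 : 2 * cycleLength n ∣ h - v) : False := by
  have t : ∀ y, 2 * cycleLength n ∣ y → ¬ y % 2 = 1 := fun y hy hy' =>
    not_two_mul_dvd_of (Or.inl hy') hy
  have hu' := hu.resolve_left (t _ h1)
  have hv' := hv.resolve_left (t _ h2)
  subst hu' hv'
  have h3 := dvd_sub h1 h2
  rw [show h - (w - x) - (h - (w - -x)) = 2 * x by ring] at h3
  exact not_two_mul_dvd_two_mul hTx h3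

/-- Only completing a half can violate the relation. It occurs when a full-slot class of `a` is
empty; then `symm` bounds `φ` above and `ε` below by differences with a common subtrahend, and `h`
becomes the strict inequality needed. -/
theorem Code.Rel.midF_left (hab : a.Rel n b) (ha : a.IsSliceCode n l) (hb : b.IsSliceCode n l)
    {x : ℤ} (hbe : Even x) (hTx : ¬ cycleLength n ∣ x) (h : b.midEps x < a.midPhi x) :
    (a.midF n x).Rel n b := by
  have s1 := ha.midSymm hbe
  have s2 := hb.midSymm hbe
  have r1 := hab.le x hbe
  have r2 := hab.le (-x) hbe.neg
  have r3 := hab.le (x + 2) (hbe.add even_two)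
  have r4 := hab.le (-x + 2) (hbe.neg.add even_two)
  rw [add_assoc, show (2 : ℤ) + 1 = 3 by norm_num] at r3 r4
  have n1 := hb.mono (x + 2)
  have n2 := hb.mono (-x + 2)
  rw [add_assoc, show (2 : ℤ) + 1 = 3 by norm_num] at n1 n2
  unfold midPhi midEps at *
  obtain ⟨z, hz⟩ := hbe
  have step1 : (a.bumpA n (if a.a x < a.a (x + 1) then x + 1 else 2 - x) (-1)).Rel n b := by
    refine hab.lower_left ha.toBasic hb.toBasic fun h' => ?_
    obtain ⟨w, hw⟩ := h'
    split_ifs at hw ⊢ with h1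
    · omega
    · rw [show 2 - x + 1 = -x + 3 by ring, show 2 - x = -x + 2 by ring]; omega
  have step2 : (a.bumpA n (if a.a (-x) < a.a (-x + 1) then -x + 1 else 2 - -x) (-1)).Rel n b := by
    refine hab.lower_left ha.toBasic hb.toBasic fun h' => ?_
    obtain ⟨w, hw⟩ := h'
    split_ifs at hw ⊢ with h1
    · omega
    · rw [show 2 - -x + 1 = x + 3 by ring, show 2 - -x = x + 2 by ring]; omega
  refine ⟨fun h hh => bump_bump_of_ne (not_dvd_of_mid hTx (w := 2) ?_ ?_) (step1.le h hh)
    (step2.le h hh), hab.leQ⟩ <;> obtain ⟨w, hw⟩ := hh <;> split_ifs <;> omega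

theorem Code.Rel.midE_right (hab : a.Rel n b) (ha : a.IsSliceCode n l) (hb : b.IsSliceCode n l)
    {x : ℤ} (hbe : Even x) (hTx : ¬ cycleLength n ∣ x) (h : a.midPhi x < b.midEps x) :
    a.Rel n (b.midE n x) := by
  have s1 := ha.midSymm hbe
  have s2 := hb.midSymm hbe
  have r1 := hab.le x hbe
  have r2 := hab.le (-x) hbe.neg
  have r3 := hab.le (x + 2) (hbe.add even_two)
  have r4 := hab.le (-x + 2) (hbe.neg.add even_two)
  rw [add_assoc, show (2 : ℤ) + 1 = 3 by norm_num] at r3 r4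
  have n1 := ha.mono x
  have n2 := ha.mono (-x)
  unfold midPhi midEps at *
  obtain ⟨z, hz⟩ := hbe
  have step1 : a.Rel n (b.bumpA n (if b.a (x + 2) < b.a (x + 3) then x + 2 else 1 - x) 1) := by
    refine hab.raise_right ha.toBasic hb.toBasic fun h' => ?_
    obtain ⟨w, hw⟩ := h'
    split_ifs at hw ⊢ with h1
    · omega
    · rw [show 1 - x - 1 = -x by ring, show 1 - x = -x + 1 by ring]; omega
  have step2 : a.Rel n (b.bumpA n (if b.a (-x + 2) < b.a (-x + 3) then -x + 2 else 1 - -x) 1) := by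
    refine hab.raise_right ha.toBasic hb.toBasic fun h' => ?_
    obtain ⟨w, hw⟩ := h'
    split_ifs at hw ⊢ with h1
    · omega
    · rw [show 1 - -x - 1 = x by ring, show 1 - -x = x + 1 by ring]; omega
  refine ⟨fun h hh => bump_bump_of_ne' (not_dvd_of_mid hTx (w := 1) ?_ ?_) (step1.le h hh)
    (step2.le h hh), hab.leQ⟩ <;> obtain ⟨w, hw⟩ := hh <;> split_ifs <;> omega

theorem Code.Rel.endF_left (hab : a.Rel n b) (ha : a.IsSliceCode n l) (hb : b.IsSliceCode n l)
    {s : Side} {e : ℤ} (he : cycleLength n ∣ e) (h : b.endEps s.swap e < a.endPhi s e) :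
    (a.endF n s e).Rel n b := by
  have balA := ha.balance s e he
  have balB := hb.balance s e he
  have hee := even_of_dvd he
  have r1 := hab.le e hee
  have r3 := hab.le (e + 2) (hee.add even_two)
  have n1 := hb.mono (e + 2)
  rw [add_assoc, show (2 : ℤ) + 1 = 3 by norm_num] at r3 n1
  have q2 := hab.leQ s.swap e he
  have u1 := ha.upper s e he
  unfold endEps endPhi at h
  unfold endF
  have h1 : b.Q s e < a.Q s e := by omega
  have key : (a.bumpA n (if a.a e < a.a (e + 1) then e + 1 else e + 2) (-1)).Rel n b := by
    refine hab.lower_left ha.toBasic hb.toBasic fun h' => ?_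
    obtain ⟨w, hw⟩ := h'
    obtain ⟨z, hz⟩ := hee
    split_ifs at hw ⊢ with h2
    · omega
    · rw [add_assoc, show (2 : ℤ) + 1 = 3 by norm_num]; omega
  exact ⟨key.le, (hab.lowerQ_left ha.toBasic hb.toBasic h1).leQ⟩

theorem Code.Rel.endE_right (hab : a.Rel n b) (ha : a.IsSliceCode n l) (hb : b.IsSliceCode n l)
    {s : Side} {e : ℤ} (he : cycleLength n ∣ e) (h : a.endPhi s.swap e < b.endEps s e) :
    a.Rel n (b.endE n s e) := by
  have balA := ha.balance s e he
  have balB := hb.balance s e he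
  have hee := even_of_dvd he
  have r1 := hab.le e hee
  have r3 := hab.le (e + 2) (hee.add even_two)
  have n1 := ha.mono e
  rw [add_assoc, show (2 : ℤ) + 1 = 3 by norm_num] at r3
  have q2 := hab.leQ s.swap e he
  have u1 := hb.lower s e he
  unfold endEps endPhi at h
  unfold endE
  have h1 : b.Q s e < a.Q s e := by omega
  have key : a.Rel n (b.bumpA n (if b.a (e + 2) < b.a (e + 3) then e + 2 else e + 1) 1) := by
    refine hab.raise_right ha.toBasic hb.toBasic fun h' => ?_
    obtain ⟨w, hw⟩ := h'
    obtain ⟨z, hz⟩ := hee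
    split_ifs at hw ⊢ with h2
    · omega
    · rw [add_sub_cancel_right]; omega
  exact ⟨key.le, (hab.raiseQ_right ha.toBasic hb.toBasic h1).leQ⟩

/-- The inequality is the one that holds at the leftmost `0` of the signature, by
`IsLeftmostZero.lt`. -/
theorem Code.Rel.f_left (hab : a.Rel n b) (ha : a.IsSliceCode n l) (hb : b.IsSliceCode n l)
    {k i : ℕ} (h : b.eps n k i < a.phi n (k + 1) i) : (a.f n (k + 1) i).Rel n b := by
  unfold eps phi at h
  unfold Code.f
  split_ifs at * with hi
  · exact hab.midF_left ha hb (even_two_mul_sub_two _) (not_cycleLength_dvd hi) h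
  · rw [endSide_succ] at *
    exact hab.endF_left ha hb (endBase_dvd i) (by rwa [Side.swap_swap])

theorem Code.Rel.e_right (hab : a.Rel n b) (ha : a.IsSliceCode n l) (hb : b.IsSliceCode n l)
    {k i : ℕ} (h : a.phi n (k + 1) i < b.eps n k i) : a.Rel n (b.e n k i) := by
  unfold eps phi at h
  unfold Code.e
  split_ifs at * with hi
  · exact hab.midE_right ha hb (even_two_mul_sub_two _) (not_cycleLength_dvd hi) h
  · rw [endSide_succ] at *
    exact hab.endE_right ha hb (endBase_dvd i) h

/-! ### Codes of walls -/

/-- The slices of a wall are encoded by `c`. -/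
def WallCodes (n : ℕ) (Y : Wall l) (c : ℕ → Code) : Prop :=
  ∀ k C, Y k = some C → (c k).IsSliceCode n l ∧ Rep n C (c k)

variable {Y : Wall l} {d : ℕ → Code}

theorem exists_wallCodes (hn : 4 ≤ n) (hl : 1 ≤ l) (hY : ∀ k C, Y k = some C → IsSlice n C) :
    ∃ d, WallCodes n Y d := by
  have : ∀ k, ∃ c : Code, ∀ C, Y k = some C → c.IsSliceCode n l ∧ Rep n C c := by
    intro k
    rcases h : Y k with _ | C
    · exact ⟨⟨0, 0⟩, by simp⟩
    · obtain ⟨c, hc, hC⟩ := (isSlice_iff hn hl).1 (hY k C h)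
      refine ⟨c, fun C' hC' => ?_⟩
      obtain rfl := Option.some.inj hC'
      exact ⟨hc, hC⟩
  choose d hd using this
  exact ⟨d, hd⟩

theorem row_le_iff {x : Layer} {g : ℤ} : g ≤ x.row ↔ 2 * g ≤ x.height := by
  have := x.height_cases
  omega

theorem standsOn_iff (hl : 1 ≤ l) (hd : WallCodes n Y d) (g : ℤ) :
    StandsOn g Y ↔ ∀ k, Y k ≠ none → (d k).a (2 * g) ≤ 0 := by
  constructor
  · intro h k hk
    obtain ⟨C, hC⟩ := Option.ne_none_iff_exists'.1 hk
    have := ((hd k C hC).2.le_iff ⟨0, by omega⟩ (2 * g)).2 (row_le_iff.1 (h k C hC _))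
    exact_mod_cast this
  · intro h k C hC p
    rw [row_le_iff, ← (hd k C hC).2.le_iff]
    exact (h k (by simp [hC])).trans (by positivity)

theorem ne_none_of_lt (h : ∀ k, Y k = none → Y (k + 1) = none) {k k' : ℕ} (hk : k ≤ k')
    (hY : Y k' ≠ none) : Y k ≠ none := by
  induction k', hk using Nat.le_induction with
  | base => exact hY
  | succ k' _ ih => exact ih fun h' => hY (h k' h')

/-- Transitivity gives properness for all pairs of columns from neighbouring pairs. -/
theorem rel_of_lt (hd : WallCodes n Y d) (hc : ∀ k, Y k = none → Y (k + 1) = none)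
    (h : ∀ k, Y (k + 1) ≠ none → (d (k + 1)).Rel n (d k)) {k k' : ℕ} (hk : k < k')
    (hY : Y k' ≠ none) : (d k').Rel n (d k) := by
  induction k', hk using Nat.le_induction with
  | base => exact h k hY
  | succ k' _ ih =>
    have h1 : Y k' ≠ none := fun h' => hY (hc k' h')
    obtain ⟨C, hC⟩ := Option.ne_none_iff_exists'.1 h1
    exact (h k' hY).trans (ih h1) (hd k' C hC).1.toBasic

theorem isProper_iff (hn : 4 ≤ n) (hl : 1 ≤ l) (hd : WallCodes n Y d) : IsProper n Y ↔
    (∀ k, Y k = none → Y (k + 1) = none) ∧ (∃ g, ∀ k, Y k ≠ none → (d k).a (2 * g) ≤ 0) ∧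
      ∀ k, Y (k + 1) ≠ none → (d (k + 1)).Rel n (d k) := by
  simp only [← standsOn_iff hl hd]
  constructor
  · intro h
    refine ⟨h.connected, h.ground, fun k hk => ?_⟩
    obtain ⟨A, hA⟩ := Option.ne_none_iff_exists'.1 hk
    obtain ⟨B, hB⟩ := Option.ne_none_iff_exists'.1 fun h' => hk (h.connected k h')
    exact Code.Rel.of_noFreeSpace hn hl (hd _ A hA).1 (hd _ B hB).1 (hd _ A hA).2 (hd _ B hB).2
      (h.noFreeSpace k A B hA hB) (h.proper (k + 1) k A B (by omega) hA hB)
  · rintro ⟨h1, h2, h3⟩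
    refine ⟨⟨h1, fun k C hC => (isSlice_iff hn hl).2 ⟨_, hd k C hC⟩, fun k A B hA hB p => ?_, h2⟩,
      fun k k' A B hk hA hB p tA tB => ?_⟩
    · exact ((h3 k (by simp [hA])).noFreeSpace hn hl (hd _ A hA).1 (hd _ B hB).1 (hd _ A hA).2
        (hd _ B hB).2 p).1
    · rcases lt_or_gt_of_ne hk with hk | hk
      · exact (((rel_of_lt hd h1 h3 hk (by simp [hB])).noFreeSpace hn hl (hd _ B hB).1 (hd _ A hA).1
          (hd _ B hB).2 (hd _ A hA).2 p).2 tB tA).symm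
      · exact ((rel_of_lt hd h1 h3 hk (by simp [hA])).noFreeSpace hn hl (hd _ A hA).1 (hd _ B hB).1
          (hd _ A hA).2 (hd _ B hB).2 p).2 tA tB

end
end YoungWall

namespace YoungWall

section
variable {n l : ℕ} {Y Y' : Wall l} {d : ℕ → Code}

/-! ### Finiteness of signatures -/

theorem eventually_succ_eq {u : ℕ → ℤ} (hu : ∀ k, u k ≤ u (k + 1)) {b : ℤ} (hb : ∀ k, u k ≤ b) :
    ∀ᶠ k in Filter.atTop, u (k + 1) = u k := by
  obtain ⟨m, ⟨k0, hk0⟩, hm⟩ := Int.exists_greatest_of_bdd (P := fun z => ∃ k, u k = z)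
    ⟨b, by rintro z ⟨k, rfl⟩; exact hb k⟩ ⟨u 0, 0, rfl⟩
  have key : ∀ k, k0 ≤ k → u k = m := fun k hk =>
    le_antisymm (hm _ ⟨k, rfl⟩) (hk0 ▸ monotone_nat_of_le_succ hu hk)
  filter_upwards [Filter.eventually_ge_atTop k0] with k hk
  rw [key k hk, key (k + 1) (by omega)]

theorem phiColumn_eq (hn : 4 ≤ n) (hl : 1 ≤ l) (hd : WallCodes n Y d) {i : ℕ} (hi : i ≤ n) {k : ℕ}
    (hk : Y k ≠ none) : (phiColumn n i Y k : ℤ) = (d k).phi n k i := by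
  obtain ⟨C, hC⟩ := Option.ne_none_iff_exists'.1 hk
  obtain ⟨h1, h2⟩ := hd k C hC
  rw [phiColumn, hC, Option.elim_some, h2.phiSlice hn hl h1 hi]

theorem epsColumn_eq (hn : 4 ≤ n) (hl : 1 ≤ l) (hd : WallCodes n Y d) {i : ℕ} (hi : i ≤ n) {k : ℕ}
    (hk : Y k ≠ none) : (epsColumn n i Y k : ℤ) = (d k).eps n k i := by
  obtain ⟨C, hC⟩ := Option.ne_none_iff_exists'.1 hk
  obtain ⟨h1, h2⟩ := hd k C hC
  rw [epsColumn, hC, Option.elim_some, h2.epsSlice hn hl h1 hi]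

/-- If the boundaries agree, the strict inequalities at even heights leave no flat layers in the
classes involved. Then `φ` and `ε` both count the layers of odd height, where for half-unit depth
blocks `balance` accounts for the swapped side. -/
theorem Code.Rel.phi_eq_eps {a b : Code} (hab : a.Rel n b)
    (hb : b.IsSliceCode n l) {k i : ℕ}
    (h : ∀ h ∈ [2 * (i : ℤ) - 2, 2 * i - 2 + 1, 2 * i - 2 + 2, 2 * i - 2 + 3, -(2 * (i : ℤ) - 2),
      -(2 * (i : ℤ) - 2) + 1, -(2 * (i : ℤ) - 2) + 2, -(2 * (i : ℤ) - 2) + 3, endBase n i,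
      endBase n i + 1, endBase n i + 2, endBase n i + 3], a.a h = b.a h)
    (hQ : ∀ s, a.Q s (endBase n i) = b.Q s (endBase n i)) : a.phi n (k + 1) i = b.eps n k i := by
  simp only [List.forall_mem_cons, List.not_mem_nil] at h
  obtain ⟨h0, h1, h2, h3, h4, h5, h6, h7, g0, g1, g2, g3, -⟩ := h
  unfold phi eps
  have key : ∀ x, Even x → a.a x = b.a x → b.a x = b.a (x + 1) := fun x hx h =>
    le_antisymm (hb.mono x) (h ▸ hab.le x hx)
  have two : ∀ x : ℤ, x + 2 + 1 = x + 3 := fun x => by ring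
  split_ifs with hi
  · have hbe := even_two_mul_sub_two (i : ℤ)
    generalize 2 * (i : ℤ) - 2 = x at *
    have k1 := key _ hbe h0
    have k2 := key _ hbe.neg h4
    have k3 := key _ (hbe.add even_two) h2
    have k4 := key _ (hbe.neg.add even_two) h6
    rw [two] at k3 k4
    unfold midPhi midEps
    omega
  · have hTe := endBase_dvd (n := n) i
    rw [endSide_succ]
    generalize endBase n i = x at *
    have hee := even_of_dvd hTe
    have k1 := key _ hee g0
    have k3 := key _ (hee.add even_two) g2
    rw [two] at k3
    have bal := hb.balance (endSide n k i) x hTe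
    have := hQ (endSide n k i).swap
    unfold endPhi endEps
    omega

theorem exists_tail (hn : 4 ≤ n) (hl : 1 ≤ l) (hY : IsProper n Y) {i : ℕ} (hi : i ≤ n) :
    ∃ N, ∀ K, N ≤ K → phiColumn n i Y (K + 1) = epsColumn n i Y K := by
  by_cases hfin : ∃ K, Y K = none
  · obtain ⟨N, hN⟩ := hfin
    have h : ∀ K, N ≤ K → Y K = none := fun K hK => by
      by_contra h
      exact ne_none_of_lt hY.connected hK h hN
    refine ⟨N, fun K hK => ?_⟩
    rw [phiColumn, epsColumn, h K hK, h (K + 1) (by omega)]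
    rfl
  push Not at hfin
  obtain ⟨d, hd⟩ := exists_wallCodes hn hl hY.slices
  obtain ⟨-, ⟨g, hg⟩, hrel⟩ := (isProper_iff hn hl hd).1 hY
  have hsl : ∀ k, (d k).IsSliceCode n l := fun k => by
    obtain ⟨C, hC⟩ := Option.ne_none_iff_exists'.1 (hfin k)
    exact (hd k C hC).1
  have hrel' := fun k => hrel k (hfin _)
  have hT := cycleLength_pos hn
  have hmono : ∀ h k, (d k).a h ≤ (d (k + 1)).a h := fun h k =>
    (hrel' k).a_le (hsl _).toBasic (hsl _).toBasic h
  have hbdd : ∀ h, ∃ b, ∀ k, (d k).a h ≤ b := fun h => by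
    -- The height `h` is at most `|h - 2 * g|` periods above the ground, where `a` is at most `0`.
    refine ⟨l * (|h - 2 * g|), fun k => ?_⟩
    have h1 : h ≤ 2 * g + 2 * cycleLength n * |h - 2 * g| := by
      have := le_abs_self (h - 2 * g)
      have := abs_nonneg (h - 2 * g)
      nlinarith
    have h2 := (hsl k).monotone h1
    rw [(hsl k).period.add_mul] at h2
    have := hg k (hfin k)
    omega
  have hev : ∀ h, ∀ᶠ k in Filter.atTop, (d (k + 1)).a h = (d k).a h := fun h => by
    obtain ⟨b, hb⟩ := hbdd h
    exact eventually_succ_eq (hmono h) hb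
  have hevQ : ∀ s, ∀ᶠ k in Filter.atTop,
      (d (k + 1)).Q s (endBase n i) = (d k).Q s (endBase n i) := fun s => by
    obtain ⟨b, hb⟩ := hbdd (endBase n i + 2)
    exact eventually_succ_eq (fun k => (hrel' k).leQ s _ (endBase_dvd i))
      fun k => ((hsl k).upper s _ (endBase_dvd i)).trans (hb k)
  have hall : ∀ L : List ℤ, ∀ᶠ k in Filter.atTop, ∀ h ∈ L, (d (k + 1)).a h = (d k).a h := by
    intro L
    induction L with
    | nil => simp
    | cons x L ih =>
      filter_upwards [hev x, ih] with k h1 h2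
      exact List.forall_mem_cons.2 ⟨h1, h2⟩
  obtain ⟨N, hN⟩ := Filter.eventually_atTop.1
    ((hall _).and ((hevQ .front).and (hevQ .back)))
  refine ⟨N, fun K hK => ?_⟩
  obtain ⟨h1, h2, h3⟩ := hN K hK
  have := (hrel' K).phi_eq_eps (hsl _) h1 (by rintro (_ | _); exacts [h2, h3]) (k := K)
  rw [← phiColumn_eq hn hl hd hi (hfin _), ← epsColumn_eq hn hl hd hi (hfin _)] at this
  exact_mod_cast this

theorem exists_tail_gt (hn : 4 ≤ n) (hl : 1 ≤ l) (hY : IsProper n Y) (hY' : IsProper n Y') {i : ℕ}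
    (hi : i ≤ n) (k : ℕ) : ∃ N, k < N ∧ (∀ K, N ≤ K → phiColumn n i Y (K + 1) = epsColumn n i Y K) ∧
      ∀ K, N ≤ K → phiColumn n i Y' (K + 1) = epsColumn n i Y' K := by
  obtain ⟨N, hN⟩ := exists_tail hn hl hY hi
  obtain ⟨N', hN'⟩ := exists_tail hn hl hY' hi
  exact ⟨N + N' + k + 1, by omega, fun K hK => hN K (by omega), fun K hK => hN' K (by omega)⟩

/-! ### Replacing a column -/

theorem WallCodes.update (hd : WallCodes n Y d) {c : Code} {C' : Layers l} {k : ℕ}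
    (hc : c.IsSliceCode n l) (hC' : Rep n C' c) :
    WallCodes n (Function.update Y k (some C')) (Function.update d k c) := by
  intro m C hC
  by_cases h : m = k
  · subst h
    rw [Function.update_self] at hC ⊢
    obtain rfl := Option.some.inj hC
    exact ⟨hc, hC'⟩
  · rw [Function.update_of_ne h] at hC ⊢
    exact hd m C hC

theorem Code.Basic.exists_ground {c : Code} (hl : 1 ≤ l) (hc : c.Basic n l) :
    ∃ g, c.a (2 * g) ≤ 0 := by
  refine ⟨cycleLength n * (-|c.a 0|), ?_⟩
  have h1 := hc.period.add_mul 0 (-|c.a 0|)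
  rw [show (0 : ℤ) + 2 * cycleLength n * (-|c.a 0|) = 2 * (cycleLength n * (-|c.a 0|)) by ring] at h1
  rw [h1]
  have := le_abs_self (c.a 0)
  have := abs_nonneg (c.a 0)
  have : (1 : ℤ) ≤ l := by exact_mod_cast hl
  nlinarith

theorem isProper_update (hn : 4 ≤ n) (hl : 1 ≤ l) (hd : WallCodes n Y d) (hY : IsProper n Y)
    {c : Code} {C' : Layers l} {k : ℕ} (hk : Y k ≠ none) (hc : c.IsSliceCode n l) (hC' : Rep n C' c)
    (hleft : Y (k + 1) ≠ none → (d (k + 1)).Rel n c) (hright : ∀ j, k = j + 1 → c.Rel n (d j)) :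
    IsProper n (Function.update Y k (some C')) := by
  obtain ⟨h1, ⟨g, hg⟩, h3⟩ := (isProper_iff hn hl hd).1 hY
  have hne : ∀ m, Function.update Y k (some C') m = none ↔ Y m = none := fun m => by
    by_cases h : m = k
    · subst h; simp [hk]
    · rw [Function.update_of_ne h]
  rw [isProper_iff hn hl (hd.update hc hC')]
  simp only [hne, ne_eq]
  refine ⟨h1, ?_, fun m hm => ?_⟩
  · obtain ⟨g', hg'⟩ := hc.toBasic.exists_ground hl
    refine ⟨min g g', fun m hm => ?_⟩
    by_cases h : m = k
    · subst h
      rw [Function.update_self]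
      exact (hc.monotone (by omega)).trans hg'
    · rw [Function.update_of_ne h]
      obtain ⟨C, hC⟩ := Option.ne_none_iff_exists'.1 hm
      exact ((hd m C hC).1.monotone (by omega)).trans (hg m hm)
  · by_cases h : m = k
    · subst h
      rw [Function.update_self, Function.update_of_ne (by omega)]
      exact hleft hm
    · rw [Function.update_of_ne h]
      by_cases h' : m + 1 = k
      · subst h'
        rw [Function.update_self]
        exact hright m rfl
      · rw [Function.update_of_ne h']
        exact h3 m hm

theorem column_update_of_ne {i k m : ℕ} (C : Option (Layers l)) (h : m ≠ k) :
    epsColumn n i (Function.update Y k C) m = epsColumn n i Y m ∧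
      phiColumn n i (Function.update Y k C) m = phiColumn n i Y m := by
  simp only [epsColumn, phiColumn, Function.update_of_ne h, and_self]

/-- Up to a common tail, `φ - ε` of a wall is the sum of the contributions of its columns, so only
the replaced column matters. -/
theorem wt_update (hn : 4 ≤ n) (hl : 1 ≤ l) (hY : IsProper n Y) {k : ℕ} {C' : Layers l}
    (hY' : IsProper n (Function.update Y k (some C'))) {j : ℕ} (hj : j ≤ n) {x : ℤ}
    (h : (phiColumn n j (Function.update Y k (some C')) k : ℤ) -
      epsColumn n j (Function.update Y k (some C')) k = phiColumn n j Y k - epsColumn n j Y k - x) :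
    (phiWall n j (Function.update Y k (some C')) : ℤ) -
      epsWall n j (Function.update Y k (some C')) = phiWall n j Y - epsWall n j Y - x := by
  obtain ⟨N, hN, h1, h2⟩ := exists_tail_gt hn hl hY hY' hj k
  rw [phiWall_sub_epsWall h1, phiWall_sub_epsWall h2,
    (column_update_of_ne (n := n) (i := j) (Y := Y) (some C') hN.ne').2,
    ← Finset.sum_erase_add _ _ (Finset.mem_range.2 hN), h,
    ← Finset.sum_erase_add (Finset.range N) (fun m => (phiColumn n j Y m : ℤ) - epsColumn n j Y m)
      (Finset.mem_range.2 hN),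
    Finset.sum_congr rfl fun m hm => by
      rw [(column_update_of_ne (n := n) (i := j) (Y := Y) (some C') (Finset.ne_of_mem_erase hm)).1,
        (column_update_of_ne (n := n) (i := j) (Y := Y) (some C') (Finset.ne_of_mem_erase hm)).2]]
  ring

/-! ### The operators on walls -/

theorem exists_column_of_pos {i k : ℕ} (h : 0 < phiColumn n i Y k ∨ 0 < epsColumn n i Y k) :
    Y k ≠ none := by
  intro h'
  simp [phiColumn, epsColumn, h'] at h

/-- The wall `Y'` arises from `Y` by applying `f̃ᵢ` to the column `k`. -/
structure FStep (n i k : ℕ) (Y Y' : Wall l) : Prop where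
  exists_eq : ∃ C C', Y k = some C ∧ fSlice n k i C = some C' ∧ eSlice n k i C' = some C ∧
    Y' = Function.update Y k (some C') ∧ Y = Function.update Y' k (some C)
  proper : IsProper n Y'
  eps_ne : ∀ m, m ≠ k → epsColumn n i Y' m = epsColumn n i Y m
  phi_ne : ∀ m, m ≠ k → phiColumn n i Y' m = phiColumn n i Y m
  eps_eq : epsColumn n i Y' k = epsColumn n i Y k + 1
  phi_eq : phiColumn n i Y k = phiColumn n i Y' k + 1

theorem Rep.eSlice_f (hn : 4 ≤ n) (hl : 1 ≤ l) {C C' : Layers l} {c : Code} (hc : c.IsSliceCode n l)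
    (hC : Rep n C c) {i k : ℕ} (hi : i ≤ n) (h : 0 < c.phi n k i) (hC' : Rep n C' (c.f n k i)) :
    YoungWall.eSlice n k i C' = some C := by
  have h0 := Code.eps_nonneg hc k i
  obtain ⟨D, h1, h2⟩ := (hC'.eSlice hn hl (hc.f h) hi k).2 (by rw [Code.eps_f]; omega)
  rw [hc.e_f] at h2
  rw [h1, h2.unique hC]

theorem Rep.fSlice_e (hn : 4 ≤ n) (hl : 1 ≤ l) {C C' : Layers l} {c : Code} (hc : c.IsSliceCode n l)
    (hC : Rep n C c) {i k : ℕ} (hi : i ≤ n) (h : 0 < c.eps n k i) (hC' : Rep n C' (c.e n k i)) :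
    YoungWall.fSlice n k i C' = some C := by
  have h0 := Code.phi_nonneg hc k i
  obtain ⟨D, h1, h2⟩ := (hC'.fSlice hn hl (hc.e h) hi k).2 (by rw [hc.phi_e]; omega)
  rw [hc.f_e] at h2
  rw [h1, h2.unique hC]

theorem exists_fStep (hn : 4 ≤ n) (hl : 1 ≤ l) (hY : IsProper n Y) {i : ℕ} (hi : i ≤ n) {k : ℕ}
    (hk : IsLeftmostZero (epsColumn n i Y) (phiColumn n i Y) k) : ∃ Y', FStep n i k Y Y' := by
  obtain ⟨d, hd⟩ := exists_wallCodes hn hl hY.slices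
  have hrel := ((isProper_iff hn hl hd).1 hY).2.2
  have hpos : 0 < phiColumn n i Y k := by have := hk.1; omega
  have hne := exists_column_of_pos (Or.inl hpos)
  have e1 := phiColumn_eq hn hl hd hi hne
  have e2 := epsColumn_eq hn hl hd hi hne
  obtain ⟨C, hC⟩ := Option.ne_none_iff_exists'.1 hne
  obtain ⟨hc, hCc⟩ := hd k C hC
  have hpos' : 0 < (d k).phi n k i := by omega
  obtain ⟨C', h1, h2⟩ := (hCc.fSlice hn hl hc hi k).2 hpos'
  have hup := hd.update (k := k) (hc.f hpos') h2
  have hself : Function.update Y k (some C') k ≠ none := by simp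
  have f1 := phiColumn_eq hn hl hup hi hself
  have f2 := epsColumn_eq hn hl hup hi hself
  rw [Function.update_self, Code.phi_f] at f1
  rw [Function.update_self, Code.eps_f] at f2
  refine ⟨Function.update Y k (some C'), ⟨C, C', hC, h1, hCc.eSlice_f hn hl hc hi hpos' h2, rfl, ?_⟩,
    ?_, fun m hm => (column_update_of_ne _ hm).1, fun m hm => (column_update_of_ne _ hm).2,
    by omega, by omega⟩
  · rw [Function.update_idem, ← hC, Function.update_eq_self]
  · refine isProper_update hn hl hd hY hne (hc.f hpos') h2 (fun h => (hrel k h).f_right k i) ?_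
    rintro j rfl
    have hj : Y j ≠ none := fun h => hne (hY.connected j h)
    obtain ⟨B, hB⟩ := Option.ne_none_iff_exists'.1 hj
    refine (hrel j hne).f_left hc (hd j B hB).1 ?_
    rw [← e1, ← epsColumn_eq hn hl hd hi hj]
    exact_mod_cast hk.lt

theorem exists_fStep_of_isRightmostOne (hn : 4 ≤ n) (hl : 1 ≤ l) (hY : IsProper n Y) {i : ℕ}
    (hi : i ≤ n) {k : ℕ} (hk : IsRightmostOne (epsColumn n i Y) (phiColumn n i Y) k) :
    ∃ Y', IsProper n Y' ∧ FStep n i k Y' Y := by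
  obtain ⟨d, hd⟩ := exists_wallCodes hn hl hY.slices
  have hrel := ((isProper_iff hn hl hd).1 hY).2.2
  have hpos : 0 < epsColumn n i Y k := by have := hk.lt; omega
  have hne := exists_column_of_pos (Or.inr hpos)
  have e1 := phiColumn_eq hn hl hd hi hne
  have e2 := epsColumn_eq hn hl hd hi hne
  obtain ⟨C, hC⟩ := Option.ne_none_iff_exists'.1 hne
  obtain ⟨hc, hCc⟩ := hd k C hC
  have hpos' : 0 < (d k).eps n k i := by omega
  obtain ⟨C', h1, h2⟩ := (hCc.eSlice hn hl hc hi k).2 hpos'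
  have hup := hd.update (k := k) (hc.e hpos') h2
  have hself : Function.update Y k (some C') k ≠ none := by simp
  have f1 := phiColumn_eq hn hl hup hi hself
  have f2 := epsColumn_eq hn hl hup hi hself
  rw [Function.update_self, hc.phi_e] at f1
  rw [Function.update_self, hc.eps_e] at f2
  refine ⟨Function.update Y k (some C'), ?_, ⟨C', C, by simp, hCc.fSlice_e hn hl hc hi hpos' h2, h1,
    ?_, rfl⟩, hY, fun m hm => (column_update_of_ne _ hm).1.symm,
    fun m hm => (column_update_of_ne _ hm).2.symm, by omega, by omega⟩
  · refine isProper_update hn hl hd hY hne (hc.e hpos') h2 (fun h => ?_) ?_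
    · obtain ⟨A, hA⟩ := Option.ne_none_iff_exists'.1 h
      refine (hrel k h).e_right (hd _ A hA).1 hc ?_
      rw [← e2, ← phiColumn_eq hn hl hd hi h]
      exact_mod_cast hk.lt
    · rintro j rfl
      exact (hrel j hne).e_left _ i
  · rw [Function.update_idem, ← hC, Function.update_eq_self]

theorem fWall_eq_some_iff (hn : 4 ≤ n) (hl : 1 ≤ l) (hY : IsProper n Y) {i : ℕ} (hi : i ≤ n) :
    fWall n i Y = some Y' ↔
      ∃ k, IsLeftmostZero (epsColumn n i Y) (phiColumn n i Y) k ∧ FStep n i k Y Y' := by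
  have key : ∀ k Z, FStep n i k Y Z → replaceColumn (fSlice n k i) Y k = some Z := by
    rintro k Z ⟨⟨C, C', h1, h2, -, h3, -⟩, -, -, -, -⟩
    rw [replaceColumn, h1, Option.bind_some, h2, Option.map_some, h3]
  unfold fWall
  split_ifs with h
  · have h0 := (hasLeftmostZero_iff _).1 h.choose_spec
    obtain ⟨Z, hZ⟩ := exists_fStep hn hl hY hi h0
    rw [key _ _ hZ]
    constructor
    · rintro h'
      obtain rfl := Option.some.inj h'
      exact ⟨_, h0, hZ⟩
    · rintro ⟨k, h1, h2⟩
      obtain rfl := h0.unique h1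
      rw [← key _ _ hZ, key _ _ h2]
  · simp only [false_iff, not_exists, not_and]
    exact fun k hk => (h ⟨k, (hasLeftmostZero_iff k).2 hk⟩).elim

theorem eWall_eq_some_iff (hn : 4 ≤ n) (hl : 1 ≤ l) (hY : IsProper n Y) {i : ℕ} (hi : i ≤ n) :
    eWall n i Y = some Y' ↔
      ∃ k, IsRightmostOne (epsColumn n i Y) (phiColumn n i Y) k ∧ IsProper n Y' ∧
        FStep n i k Y' Y := by
  obtain ⟨N, ht⟩ := exists_tail hn hl hY hi
  have key : ∀ k Z, FStep n i k Z Y → replaceColumn (eSlice n k i) Y k = some Z := by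
    rintro k Z ⟨⟨C, C', h1, -, h2, h3, h4⟩, -, -, -, -⟩
    rw [replaceColumn, show Y k = some C' by rw [h3, Function.update_self], Option.bind_some, h2,
      Option.map_some, ← h4]
  unfold eWall
  split_ifs with h
  · have h0 := (hasRightmostOne_iff ht _).1 h.choose_spec
    obtain ⟨Z, hZ, hZ'⟩ := exists_fStep_of_isRightmostOne hn hl hY hi h0
    rw [key _ _ hZ']
    constructor
    · rintro h'
      obtain rfl := Option.some.inj h'
      exact ⟨_, h0, hZ, hZ'⟩
    · rintro ⟨k, h1, -, h2⟩
      obtain rfl := h0.unique h1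
      rw [← key _ _ hZ', key _ _ h2]
  · simp only [false_iff, not_exists, not_and]
    exact fun k hk => (h ⟨k, (hasRightmostOne_iff ht k).2 hk⟩).elim

theorem fWall_eq_some_iff_eWall (hn : 4 ≤ n) (hl : 1 ≤ l) (hY : IsProper n Y) (hY' : IsProper n Y')
    {i : ℕ} (hi : i ≤ n) : fWall n i Y = some Y' ↔ eWall n i Y' = some Y := by
  rw [fWall_eq_some_iff hn hl hY hi, eWall_eq_some_iff hn hl hY' hi]
  constructor
  · rintro ⟨k, h1, h2⟩
    exact ⟨k, h1.isRightmostOne h2.eps_ne h2.phi_ne h2.eps_eq h2.phi_eq, hY, h2⟩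
  · rintro ⟨k, h1, -, h2⟩
    exact ⟨k, h1.isLeftmostZero (fun m hm => (h2.eps_ne m hm).symm)
      (fun m hm => (h2.phi_ne m hm).symm) h2.eps_eq h2.phi_eq, h2⟩

theorem epsWall_of_fStep (hn : 4 ≤ n) (hl : 1 ≤ l) (hY : IsProper n Y) {i : ℕ} (hi : i ≤ n) {k : ℕ}
    (h1 : IsLeftmostZero (epsColumn n i Y) (phiColumn n i Y) k) (h2 : FStep n i k Y Y') :
    epsWall n i Y' = epsWall n i Y + 1 := by
  obtain ⟨N, hN, ht, ht'⟩ := exists_tail_gt hn hl hY h2.proper hi k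
  rw [epsWall_eq ht, epsWall_eq ht',
    h1.sigOnes_sub h2.eps_ne h2.phi_ne h2.eps_eq h2.phi_eq hN]

theorem wt_of_fStep (hn : 4 ≤ n) (hl : 1 ≤ l) (hY : IsProper n Y) {i : Fin (n + 1)} {k : ℕ}
    (h : FStep n i k Y Y') (j : Fin (n + 1)) :
    (phiWall n j Y' : ℤ) - epsWall n j Y' = phiWall n j Y - epsWall n j Y - affineCartanD n j i := by
  have hi : (i : ℕ) ≤ n := by omega
  have hj : (j : ℕ) ≤ n := by omega
  obtain ⟨C, C', h1, h2, -, rfl, -⟩ := h.exists_eq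
  refine wt_update hn hl hY h.proper hj ?_
  obtain ⟨d, hd⟩ := exists_wallCodes hn hl hY.slices
  obtain ⟨hc, hCc⟩ := hd k C h1
  have hpos : 0 < (d k).phi n k i := by
    refine lt_of_le_of_ne (Code.phi_nonneg hc k i) fun h0 => ?_
    rw [(hCc.fSlice hn hl hc hi k).1 h0.symm] at h2
    simp at h2
  obtain ⟨D, h3, h4⟩ := (hCc.fSlice hn hl hc hi k).2 hpos
  obtain rfl : D = C' := Option.some.inj (h3.symm.trans h2)
  have hup := hd.update (k := k) (hc.f hpos) h4
  have hself : Function.update Y k (some D) k ≠ none := by simp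
  have hne : Y k ≠ none := by simp [h1]
  rw [phiColumn_eq hn hl hd hj hne, epsColumn_eq hn hl hd hj hne,
    phiColumn_eq hn hl hup hj hself, epsColumn_eq hn hl hup hj hself, Function.update_self,
    Code.wt_f hn]

theorem standsOn_of_fStep (hn : 4 ≤ n) (hl : 1 ≤ l) (hY : IsProper n Y) {i : ℕ} (hi : i ≤ n) {k : ℕ}
    (h : FStep n i k Y Y') {g : ℤ} (hg : StandsOn g Y) : StandsOn g Y' := by
  obtain ⟨C, C', h1, h2, -, rfl, -⟩ := h.exists_eq
  obtain ⟨d, hd⟩ := exists_wallCodes hn hl hY.slices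
  obtain ⟨hc, hCc⟩ := hd k C h1
  have hpos : 0 < (d k).phi n k i := by
    refine lt_of_le_of_ne (Code.phi_nonneg hc k i) fun h0 => ?_
    rw [(hCc.fSlice hn hl hc hi k).1 h0.symm] at h2
    simp at h2
  obtain ⟨D, h3, h4⟩ := (hCc.fSlice hn hl hc hi k).2 hpos
  obtain rfl : D = C' := Option.some.inj (h3.symm.trans h2)
  rw [standsOn_iff hl hd] at hg
  rw [standsOn_iff hl (hd.update (hc.f hpos) h4)]
  intro m hm
  by_cases hmk : m = k
  · subst hmk
    rw [Function.update_self]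
    exact (((d m).f_le m i).1 _).trans (hg m (by simp [h1]))
  · rw [Function.update_of_ne hmk] at hm ⊢
    exact hg m hm

/-- An infinite wall has a column to the left of the changed one. That neighbour is unchanged and
stands on the ground, and each layer to its right is at least as high. -/
theorem standsOn_of_fStep_symm (hn : 4 ≤ n) (hl : 1 ≤ l) (hY' : IsProper n Y') {i k : ℕ}
    (h : FStep n i k Y' Y) (hinf : ∀ k, Y k ≠ none) {g : ℤ} (hg : StandsOn g Y) :
    StandsOn g Y' := by
  obtain ⟨C', C, h1, -, -, h2, h3⟩ := h.exists_eq
  obtain ⟨d, hd⟩ := exists_wallCodes hn hl hY'.slices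
  obtain ⟨-, -, hrel⟩ := (isProper_iff hn hl hd).1 hY'
  have hne : ∀ m, m ≠ k → Y' m = Y m := fun m hm => by rw [h2, Function.update_of_ne hm]
  intro m D hD p
  by_cases hmk : m = k
  · subst hmk
    obtain ⟨B, hB⟩ := Option.ne_none_iff_exists'.1 (hinf (m + 1))
    rw [← hne _ (by omega)] at hB
    obtain ⟨a1, a2⟩ := hd _ _ hB
    obtain ⟨b1, b2⟩ := hd _ _ hD
    have h4 := (hrel m (by simp [hB])).a_le a1.toBasic b1.toBasic (2 * g)
    rw [row_le_iff, ← b2.le_iff]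
    refine h4.trans ((a2.le_iff p _).2 (row_le_iff.1 (hg (m + 1) B ?_ p)))
    rw [← hne _ (by omega), hB]
  · exact hg m D (by rw [← hne m hmk, hD]) p

end
end YoungWall

namespace YoungWall

section
variable {n l : ℕ}

/-! ### The crystal of proper Young walls -/

theorem finite_signCount (hn : 4 ≤ n) (hl : 1 ≤ l) {Y : Wall l} (hY : IsProper n Y) {i : ℕ}
    (hi : i ≤ n) (s : Sign) : {k | signCount n i Y s k ≠ 0}.Finite := by
  obtain ⟨N, ht⟩ := exists_tail hn hl hY hi
  refine (Set.finite_Iic N).subset fun k hk => ?_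
  by_contra h
  exact hk (signCount_eq_zero ht s (not_le.1 h))

theorem bind_toProper_eq_some_iff {x : Option (Wall l)} {Y : ProperWall n l} :
    x.bind (toProper n) = some Y ↔ x = some Y.1 := by
  rw [Option.bind_eq_some_iff]
  unfold toProper
  constructor
  · rintro ⟨Z, hZ, h⟩
    split_ifs at h with hp
    rw [hZ, ← Option.some.inj h]
  · intro h
    exact ⟨Y.1, h, by rw [dif_pos Y.2]⟩

theorem fProper_eq_some_iff {i : Fin (n + 1)} {Y Y' : ProperWall n l} :
    fProper i Y = some Y' ↔ fWall n i Y.1 = some Y'.1 := bind_toProper_eq_some_iff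

theorem eProper_eq_some_iff {i : Fin (n + 1)} {Y Y' : ProperWall n l} :
    eProper i Y = some Y' ↔ eWall n i Y.1 = some Y'.1 := bind_toProper_eq_some_iff

theorem fProper_eq_none_iff (hn : 4 ≤ n) (hl : 1 ≤ l) (i : Fin (n + 1)) (Y : ProperWall n l) :
    fProper i Y = none ↔ phiProper i Y = 0 := by
  have hi : (i : ℕ) ≤ n := by omega
  obtain ⟨N, ht⟩ := exists_tail hn hl Y.2 hi
  rw [phiProper, Nat.cast_eq_zero, phiWall_eq_zero_iff ht, Option.eq_none_iff_forall_ne_some]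
  simp only [hasLeftmostZero_iff, ne_eq, fProper_eq_some_iff, fWall_eq_some_iff hn hl Y.2 hi]
  constructor
  · rintro h ⟨k, hk⟩
    obtain ⟨Y', hY'⟩ := exists_fStep hn hl Y.2 hi hk
    exact h ⟨Y', hY'.proper⟩ ⟨k, hk, hY'⟩
  · rintro h Y' ⟨k, hk, -⟩
    exact h ⟨k, hk⟩

theorem eProper_eq_none_iff (hn : 4 ≤ n) (hl : 1 ≤ l) (i : Fin (n + 1)) (Y : ProperWall n l) :
    eProper i Y = none ↔ epsProper i Y = 0 := by
  have hi : (i : ℕ) ≤ n := by omega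
  obtain ⟨N, ht⟩ := exists_tail hn hl Y.2 hi
  rw [epsProper, Nat.cast_eq_zero, epsWall_eq_zero_iff ht, Option.eq_none_iff_forall_ne_some]
  simp only [hasRightmostOne_iff ht, ne_eq, eProper_eq_some_iff, eWall_eq_some_iff hn hl Y.2 hi]
  constructor
  · rintro h ⟨k, hk⟩
    obtain ⟨Y', hY', h'⟩ := exists_fStep_of_isRightmostOne hn hl Y.2 hi hk
    exact h ⟨Y', hY'⟩ ⟨k, hk, hY', h'⟩
  · rintro h Y' ⟨k, hk, -⟩
    exact h ⟨k, hk⟩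

theorem fProper_iff_eProper (hn : 4 ≤ n) (hl : 1 ≤ l) (i : Fin (n + 1)) (Y Y' : ProperWall n l) :
    fProper i Y = some Y' ↔ eProper i Y' = some Y := by
  rw [fProper_eq_some_iff, eProper_eq_some_iff,
    fWall_eq_some_iff_eWall hn hl Y.2 Y'.2 (by omega)]

theorem wtProper_of_fProper (hn : 4 ≤ n) (hl : 1 ≤ l) {i : Fin (n + 1)} {Y Y' : ProperWall n l}
    (h : fProper i Y = some Y') :
    wtProper Y' = wtProper Y - simpleRoot (affineCartanD n) i := by
  rw [fProper_eq_some_iff, fWall_eq_some_iff hn hl Y.2 (by omega)] at h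
  obtain ⟨k, -, h⟩ := h
  funext j
  exact wt_of_fStep hn hl Y.2 h j

theorem epsProper_of_fProper (hn : 4 ≤ n) (hl : 1 ≤ l) {i : Fin (n + 1)} {Y Y' : ProperWall n l}
    (h : fProper i Y = some Y') : epsProper i Y' = epsProper i Y + 1 := by
  rw [fProper_eq_some_iff, fWall_eq_some_iff hn hl Y.2 (by omega)] at h
  obtain ⟨k, hk, h⟩ := h
  rw [epsProper, epsProper, epsWall_of_fStep hn hl Y.2 (by omega) hk h]
  push_cast
  rfl

theorem phiProper_of_fProper (hn : 4 ≤ n) (hl : 1 ≤ l) {i : Fin (n + 1)} {Y Y' : ProperWall n l}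
    (h : fProper i Y = some Y') : phiProper i Y = phiProper i Y' + 1 := by
  have h1 := congrFun (wtProper_of_fProper hn hl h) i
  have h2 := epsProper_of_fProper hn hl h
  simp only [wtProper, Pi.sub_apply, simpleRoot, affineCartanD_apply, if_true] at h1
  omega

theorem isCrystal_properWall (hn : 4 ≤ n) (hl : 1 ≤ l) :
    IsCrystal (affineCartanD n) (wtProper (n := n) (l := l)) eProper fProper
      (fun i Y => (epsProper i Y : WithBot ℤ)) (fun i Y => (phiProper i Y : WithBot ℤ)) where
  phi_eq i Y := by
    rw [wtProper, ← WithBot.coe_add, add_sub_cancel]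
  wt_e i Y Y' h := by
    rw [wtProper_of_fProper hn hl ((fProper_iff_eProper hn hl i Y' Y).2 h), sub_add_cancel]
  wt_f i Y Y' h := wtProper_of_fProper hn hl h
  eps_e i Y Y' h := by
    rw [epsProper_of_fProper hn hl ((fProper_iff_eProper hn hl i Y' Y).2 h)]
    rfl
  phi_e i Y Y' h := by
    rw [phiProper_of_fProper hn hl ((fProper_iff_eProper hn hl i Y' Y).2 h)]
    rfl
  eps_f i Y Y' h := by
    rw [epsProper_of_fProper hn hl h]
    rfl
  phi_f i Y Y' h := by
    rw [phiProper_of_fProper hn hl h]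
    rfl
  f_iff_e i Y Y' := fProper_iff_eProper hn hl i Y Y'
  bot i Y h := (WithBot.coe_ne_bot h).elim

end
end YoungWall

/-- Let `n ≥ 4` and `l ≥ 1`.  The numbers `φᵢ`, `εᵢ` of slices are maxima, signatures of proper Young
walls are finite, the Kashiwara operators preserve proper Young walls and vanish exactly when the
signature has no `0` (no `1`), they respect the ground on which an infinite wall stands, and the
proper Young walls form a crystal. -/
theorem mainTheorem3 (n l : ℕ) (hn : 4 ≤ n) (hl : 1 ≤ l) :
    (∀ (k : ℕ) (i : Fin (n + 1)) (C : YoungWall.Layers l), YoungWall.IsSlice n C →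
      BddAbove (YoungWall.powersDefined (YoungWall.fSlice n k i) C) ∧
      BddAbove (YoungWall.powersDefined (YoungWall.eSlice n k i) C)) ∧
    (∀ (i : Fin (n + 1)) (Y : YoungWall.ProperWall n l) (s : YoungWall.Sign),
      {k | YoungWall.signCount n i Y.1 s k ≠ 0}.Finite) ∧
    (∀ (i : Fin (n + 1)) (Y : YoungWall.ProperWall n l),
      (∀ Y', YoungWall.fWall n i Y.1 = some Y' → YoungWall.IsProper n Y') ∧
      (∀ Y', YoungWall.eWall n i Y.1 = some Y' → YoungWall.IsProper n Y') ∧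
      (YoungWall.fProper i Y = none ↔ YoungWall.phiProper i Y = 0) ∧
      (YoungWall.eProper i Y = none ↔ YoungWall.epsProper i Y = 0)) ∧
    (∀ (i : Fin (n + 1)) (Y Y' : YoungWall.ProperWall n l) (g : ℤ),
      (∀ k, Y.1 k ≠ none) → YoungWall.StandsOn g Y.1 →
      (YoungWall.fProper i Y = some Y' ∨ YoungWall.eProper i Y = some Y') →
      YoungWall.StandsOn g Y'.1) ∧
    YoungWall.IsCrystal (YoungWall.affineCartanD n)
      (YoungWall.wtProper (n := n) (l := l)) YoungWall.eProper YoungWall.fProper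
      (fun i Y => (YoungWall.epsProper i Y : WithBot ℤ))
      (fun i Y => (YoungWall.phiProper i Y : WithBot ℤ)) := by
  refine ⟨fun k i C hC => ?_, fun i Y s => ?_, fun i Y => ?_, fun i Y Y' g hinf hg h => ?_, ?_⟩
  · obtain ⟨c, hc, hCc⟩ := (YoungWall.isSlice_iff hn hl).1 hC
    rw [hCc.powersDefined_f hn hl hc (by omega), hCc.powersDefined_e hn hl hc (by omega)]
    exact ⟨bddAbove_Iic, bddAbove_Iic⟩
  · exact YoungWall.finite_signCount hn hl Y.2 (by omega) s
  · have hi : (i : ℕ) ≤ n := by omega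
    refine ⟨fun Y' h => ?_, fun Y' h => ?_, YoungWall.fProper_eq_none_iff hn hl i Y,
      YoungWall.eProper_eq_none_iff hn hl i Y⟩
    · obtain ⟨k, -, h⟩ := (YoungWall.fWall_eq_some_iff hn hl Y.2 hi).1 h
      exact h.proper
    · obtain ⟨k, -, h, -⟩ := (YoungWall.eWall_eq_some_iff hn hl Y.2 hi).1 h
      exact h
  · rw [YoungWall.fProper_eq_some_iff, YoungWall.eProper_eq_some_iff] at h
    rcases h with h | h
    · obtain ⟨k, -, h⟩ := (YoungWall.fWall_eq_some_iff hn hl Y.2 (by omega)).1 h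
      exact YoungWall.standsOn_of_fStep hn hl Y.2 (by omega) h hg
    · obtain ⟨k, -, h', h⟩ := (YoungWall.eWall_eq_some_iff hn hl Y.2 (by omega)).1 h
      exact YoungWall.standsOn_of_fStep_symm hn hl h' h hinf hg
  · exact YoungWall.isCrystal_properWall hn hl
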